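/- **Theorem (vector control with commuting fields).** *Problem.* Let $(\Omega,\rho)$ be a complete separable metric space with a Borel probability measure $\mu$, let $t_0<T$, and let $U=\prod_{i=1}^m[u_{\min,i},u_{\max,i}]$ with $u_{\min,i}<u_{\max,i}$. Let $f_0,\dots,f_m:\mathbb R^n\times\Omega\to\mathbb R^n$ and $g:\mathbb R^n\times\Omega\to\mathbb R$ be measurable and let $\varphi\in L^2(\mu,\Omega;\mathbb R^n)$ (e.g. $\varphi\equiv x_0$). Put $f(x,u,\omega)=f_0(x,\omega)+\sum_{i=1}^m u_if_i(x,\omega)$. An admissible process $(u,x)$ consists of $u\in L^\infty(t_0,T;\mathbb R^m)$ with $u(t)\in U$ for a.e. $t$ and, for every $\omega\in\Omega$, the absolutely continuous solution of $x(t,\omega)=\varphi(\omega)+\int_{t_0}^t f(x(s,\omega),u(s),\omega)\,ds$ on $[t_0,T]$; its cost is $\int_\Omega g(x(T,\omega),\omega)\,d\mu(\omega)$. For vector fields, $[a,b]=b'a-a'b$. (H0) There are constants with $|f_i(x,\omega)|\le c_i(1+|x|)$, $|f_i(x,\omega)-f_i(x',\omega)|\le k_i|x-x'|$ $(0\le i\le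 m)$, $|g|\le M$, $|g(x,\omega)-g(x',\omega)|\le k_g|x-x'|$, for all $x,x',\omega$. *Minimizer.* Let $(\bar u,\bar x)$ be a $W^{1,1}$-local minimizer, in one of the following two senses: either (a) $\varphi$ is bounded on $\operatorname{supp}\mu$ and for some $\varepsilon>0$ the cost of $(\bar u,\bar x)$ is at most that of every admissible $(u,x)$ with $\|\bar x(\cdot,\omega)-x(\cdot,\omega)\|_{W^{1,1}([t_0,T];\mathbb R^n)}\le\varepsilon$ for all $\omega\in\operatorname{supp}\mu$; or (b) for some $\varepsilon>0$ the cost of $(\bar u,\bar x)$ is at most that of every admissible $(u,x)$ with $\|\bar x-x\|_{W^{1,1}([t_0,T];L^2(\mu,\Omega;\mathbb R^n))}\le\varepsilon$. (H1) For some $\delta>0$, writing $\mathbb B$ for the open unit ball: (i) there is a modulus of continuity $\theta_f$ with $\int_{t_0}^T\sup_{x\in\bar x(t,\omega)+\delta\mathbb B,\,u\in U}|f(x,u,\omega_1)-f(x,u,\omega_2)|\,dt\le\theta_f(\rho(\omega_1,\omega_2))$ for all $\omega,\omega_1,\omega_2$; (ii) $g(\cdot,\omega)$ is differentiable on $\bar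 x(T,\omega)+\delta\mathbb B$ for all $\omega$, $\nabla_xg$ is continuous there in $x$ and, for each fixed $x$, continuous in $\omega$ on $\{\omega:|x-\bar x(T,\omega)|<\delta\}$, and $|\nabla_xg(\bar x(T,\omega),\omega)|\le C_g$; (iii) $f(\cdot,u,\omega)$ is $C^1$ on $\bar x(t,\omega)+\delta\mathbb B$ for all $u\in U$, all $\omega$ and a.e. $t$, and $\nabla_xf(x,u,\omega)$ is continuous in $\omega$ uniformly in $t\in[t_0,T]$, $u\in U$ and $x$ in these balls; (iv) the $f_i$ are $C^2$ on $\bar x(t,\omega)+\delta\mathbb B$ for all $\omega$ and a.e. $t$, and for $k=1,2$, $|\partial_x^kf_i(\bar x(t,\omega),\omega)|<C^k_{f_i}$ for all $\omega\in\operatorname{supp}\mu$ and a.e. $t$. *Commutativity.* $[f_i,f_j]=0$ for $i,j=1,\dots,m$ (at least on all the balls $\bar x(t,\omega)+\delta\mathbb B$). *Adjoint state.* Let $p$ be the adjoint state, i.e. the solution of $-\dot p=\big[\tfrac{\partial f}{\partial x}(\bar x,\bar u)\big]^{\top}p$, $-p(T)=\nabla_xg(\bar x(T))$, either pathwise for every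 $\omega\in\operatorname{supp}\mu$ (with $p$ measurable), or in $W^{1,1}([t_0,T];L^2(\mu,\Omega;\mathbb R^n))$. Put $\Psi_i(t)=\int_\Omega p\cdot f_i\,d\mu$, $W_{ij}(t)=\int_\Omega p\cdot[f_i,[f_0,f_j]]\,d\mu$ $(i,j=0,\dots,m)$, evaluated along $\bar x$, and $$S(t)=\{i:u_{\min,i}<\bar u_i(t)<u_{\max,i}\},\quad B_{\min}(t)=\{i:\Psi_i(t)<0\},\quad B_{\max}(t)=\{i:\Psi_i(t)>0\}.$$ *Conclusion.* Let $(a,b)\subset[t_0,T]$ be a nonempty open interval on which, for a.e. $t$, $S(t)=S$, $B_{\min}(t)=B_{\min}$ and $B_{\max}(t)=B_{\max}$ are constant, with $S\cup B_{\min}\cup B_{\max}=\{1,\dots,m\}$ (every control component is singular or bang). Then for a.e. $t\in(a,b)$ the integrals $W_{ij}(t)$ converge absolutely and $$W_S(t)\,\bar u_S(t)+b_S(t)=0,$$ where $W_S=[W_{ij}]_{i,j\in S}$, $\bar u_S=(\bar u_i)_{i\in S}$, and for $i\in S$ $$b_i=W_{0i}+\sum_{j\in B_{\min}}W_{ij}\,u_{\min,j}+\sum_{j\in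 B_{\max}}W_{ij}\,u_{\max,j}.$$ -/

import Mathlib

open MeasureTheory Set Filter Topology
open scoped ENNReal

noncomputable section

namespace EnsembleControl

/-- The state space `ℝⁿ` with its Euclidean norm. -/
abbrev State (n : ℕ) : Type := EuclideanSpace ℝ (Fin n)

/-- The data of the averaged control-affine problem with box constraints
`minimize ∫ g(x(T,ω),ω) dμ(ω)` subject to `ẋ = f₀(x,ω) + ∑ uᵢ fᵢ(x,ω)`, `x(t₀,ω) = φ(ω)`,
`u(t) ∈ ∏ [uminᵢ, umaxᵢ]`.  The drift is `f 0`; the controlled fields are `f j.succ`. -/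
structure Problem (n m : ℕ) (Ω : Type*) [MeasurableSpace Ω] where
  t₀ : ℝ
  T : ℝ
  μ : Measure Ω
  f : Fin (m + 1) → State n → Ω → State n
  g : State n → Ω → ℝ
  φ : Ω → State n
  umin : Fin m → ℝ
  umax : Fin m → ℝ

namespace Problem

variable {n m : ℕ} {Ω : Type*} [MeasurableSpace Ω]

/-- The control box `U = ∏ [uminᵢ, umaxᵢ]`. -/
def box (P : Problem n m Ω) : Set (Fin m → ℝ) := Icc P.umin P.umax

/-- The dynamics `f(x,u,ω) = f₀(x,ω) + ∑ uᵢ fᵢ(x,ω)`. -/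
def dyn (P : Problem n m Ω) (x : State n) (u : Fin m → ℝ) (ω : Ω) : State n :=
  P.f 0 x ω + ∑ j : Fin m, u j • P.f j.succ x ω

/-- `u ∈ L^∞(t₀,T;ℝᵐ)` with `u(t) ∈ U` for a.e. `t`. -/
def IsControl (P : Problem n m Ω) (u : ℝ → Fin m → ℝ) : Prop :=
  MemLp u ∞ (volume.restrict (Icc P.t₀ P.T)) ∧
    ∀ᵐ t ∂(volume.restrict (Icc P.t₀ P.T)), u t ∈ P.box

/-- Admissible processes: an admissible control together with, for every `ω`, the
(absolutely continuous) solution of the integral equation. -/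
def IsAdmissible (P : Problem n m Ω) (u : ℝ → Fin m → ℝ) (x : ℝ → Ω → State n) : Prop :=
  P.IsControl u ∧ ∀ ω,
    ContinuousOn (fun t => x t ω) (Icc P.t₀ P.T) ∧
    ∀ t ∈ Icc P.t₀ P.T, x t ω = P.φ ω + ∫ s in P.t₀..t, P.dyn (x s ω) (u s) ω

/-- The averaged cost. -/
def cost (P : Problem n m Ω) (x : ℝ → Ω → State n) : ℝ := ∫ ω, P.g (x P.T ω) ω ∂P.μ

/-- `‖y - z‖` in `W^{1,1}([t₀,T]; ℝⁿ)` for two absolutely continuous arcs. -/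
def arcDist (P : Problem n m Ω) (y z : ℝ → State n) : ℝ≥0∞ :=
  (∫⁻ t in Icc P.t₀ P.T, ‖y t - z t‖ₑ) + ∫⁻ t in Icc P.t₀ P.T, ‖deriv y t - deriv z t‖ₑ

/-- `‖y - z‖` in `W^{1,1}([t₀,T]; L²(μ,Ω;ℝⁿ))` for two families of arcs. -/
def meanDist (P : Problem n m Ω) (y z : ℝ → Ω → State n) : ℝ≥0∞ :=
  (∫⁻ t in Icc P.t₀ P.T, eLpNorm (fun ω => y t ω - z t ω) 2 P.μ) +
    ∫⁻ t in Icc P.t₀ P.T,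
      eLpNorm (fun ω => deriv (fun s => y s ω) t - deriv (fun s => z s ω) t) 2 P.μ

/-- `W^{1,1}`-local minimizer: optimal among the admissible processes all of whose arcs, for
`ω ∈ supp μ`, are `ε`-close in `W^{1,1}([t₀,T]; ℝⁿ)`. -/
def IsLocalMinimizer [TopologicalSpace Ω] (P : Problem n m Ω)
    (u : ℝ → Fin m → ℝ) (x : ℝ → Ω → State n) : Prop :=
  P.IsAdmissible u x ∧ ∃ ε : ℝ, 0 < ε ∧ ∀ v y, P.IsAdmissible v y →
    (∀ ω ∈ P.μ.support, P.arcDist (fun t => x t ω) (fun t => y t ω) ≤ ENNReal.ofReal ε) →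
    P.cost x ≤ P.cost y

/-- `W^{1,1}`-local minimizer for `L²`-valued states: optimal among the admissible processes
whose state is `ε`-close in `W^{1,1}([t₀,T]; L²(μ,Ω;ℝⁿ))`. -/
def IsMeanLocalMinimizer (P : Problem n m Ω)
    (u : ℝ → Fin m → ℝ) (x : ℝ → Ω → State n) : Prop :=
  P.IsAdmissible u x ∧ ∃ ε : ℝ, 0 < ε ∧ ∀ v y, P.IsAdmissible v y →
    P.meanDist x y ≤ ENNReal.ofReal ε → P.cost x ≤ P.cost y

/-- Standing assumptions on the data (those on `U` hold automatically for a box). -/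
structure H0 (P : Problem n m Ω) : Prop where
  prob : IsProbabilityMeasure P.μ
  f_measurable : ∀ i, Measurable fun z : State n × Ω => P.f i z.1 z.2
  f_growth : ∀ i, ∃ c : ℝ, 0 < c ∧ ∀ x ω, ‖P.f i x ω‖ ≤ c * (1 + ‖x‖)
  f_lipschitz : ∀ i, ∃ k : ℝ, 0 < k ∧ ∀ x x' ω, ‖P.f i x ω - P.f i x' ω‖ ≤ k * ‖x - x'‖
  g_measurable : Measurable fun z : State n × Ω => P.g z.1 z.2
  g_bounded : ∃ M : ℝ, 0 < M ∧ ∀ x ω, |P.g x ω| ≤ M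
  g_lipschitz : ∃ k : ℝ, 1 ≤ k ∧ ∀ x x' ω, |P.g x ω - P.g x' ω| ≤ k * ‖x - x'‖

/-- A modulus of continuity on `[0,∞)`. -/
def IsModulus (θ : ℝ → ℝ) : Prop :=
  MonotoneOn θ (Ici 0) ∧ (∀ s, 0 ≤ s → 0 ≤ θ s) ∧ Tendsto θ (𝓝[>] 0) (𝓝 0)

/-- Regularity along the reference family of arcs `x`, in tubes of radius `δ`. -/
structure H1 [PseudoMetricSpace Ω] (P : Problem n m Ω) (x : ℝ → Ω → State n) (δ : ℝ) :
    Prop where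
  f_modulus : ∃ θ : ℝ → ℝ, IsModulus θ ∧ ∀ ω ω₁ ω₂,
    (∫⁻ t in Icc P.t₀ P.T, ⨆ y ∈ Metric.ball (x t ω) δ, ⨆ u ∈ P.box,
      ‖P.dyn y u ω₁ - P.dyn y u ω₂‖ₑ) ≤ ENNReal.ofReal (θ (dist ω₁ ω₂))
  g_differentiable : ∀ ω, ∀ y ∈ Metric.ball (x P.T ω) δ,
    DifferentiableAt ℝ (fun z => P.g z ω) y
  g_gradient_state : ∀ ω,
    ContinuousOn (fun y => gradient (fun z => P.g z ω) y) (Metric.ball (x P.T ω) δ)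
  g_gradient_param : ∀ y,
    ContinuousOn (fun ω => gradient (fun z => P.g z ω) y) {ω | y ∈ Metric.ball (x P.T ω) δ}
  g_gradient_bound : ∃ C : ℝ, 0 < C ∧ ∀ ω, ‖gradient (fun z => P.g z ω) (x P.T ω)‖ ≤ C
  f_contDiff : ∀ ω, ∀ᵐ t ∂(volume.restrict (Icc P.t₀ P.T)), ∀ u ∈ P.box,
    ContDiffOn ℝ 1 (fun y => P.dyn y u ω) (Metric.ball (x t ω) δ)
  f_fderiv_param : ∀ ω₀, ∀ ε : ℝ, 0 < ε → ∃ η : ℝ, 0 < η ∧ ∀ ω, dist ω ω₀ < η →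
    ∀ t ∈ Icc P.t₀ P.T, ∀ y ∈ Metric.ball (x t ω₀) δ ∩ Metric.ball (x t ω) δ, ∀ u ∈ P.box,
      ‖fderiv ℝ (fun z => P.dyn z u ω) y - fderiv ℝ (fun z => P.dyn z u ω₀) y‖ < ε
  f_contDiff_two : ∀ i ω, ∀ᵐ t ∂(volume.restrict (Icc P.t₀ P.T)),
    ContDiffOn ℝ 2 (fun y => P.f i y ω) (Metric.ball (x t ω) δ)
  f_deriv_bound : ∀ i, ∀ k ∈ ({1, 2} : Set ℕ), ∃ C : ℝ, 0 < C ∧ ∀ ω ∈ P.μ.support,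
    ∀ᵐ t ∂(volume.restrict (Icc P.t₀ P.T)),
      ‖iteratedFDeriv ℝ k (fun y => P.f i y ω) (x t ω)‖ < C

/-- The controlled fields commute: `[fᵢ,fⱼ] = 0` for `i,j ≥ 1`, at all points of the tubes on
which the fields are assumed to be differentiable. -/
def Commuting (P : Problem n m Ω) (x : ℝ → Ω → State n) (δ : ℝ) : Prop :=
  ∀ i j : Fin m, ∀ ω, ∀ t ∈ Icc P.t₀ P.T, ∀ y ∈ Metric.ball (x t ω) δ,
    VectorField.lieBracket ℝ (fun z => P.f i.succ z ω) (fun z => P.f j.succ z ω) y = 0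

/-- The vector `[∂f/∂x(x(t,ω),u(t),ω)]ᵀ q`. -/
def adjointField (P : Problem n m Ω) (u : ℝ → Fin m → ℝ) (x : ℝ → Ω → State n)
    (t : ℝ) (ω : Ω) (q : State n) : State n :=
  ContinuousLinearMap.adjoint (fderiv ℝ (fun y => P.dyn y (u t) ω) (x t ω)) q

/-- Pathwise adjoint state: for every `ω ∈ supp μ`, `p(·,ω)` is the absolutely continuous
solution of `-ṗ = [∂f/∂x]ᵀ p`, `-p(T,ω) = ∇ₓ g(x(T,ω),ω)`. -/
structure IsCostate [TopologicalSpace Ω] (P : Problem n m Ω) (u : ℝ → Fin m → ℝ)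
    (x : ℝ → Ω → State n) (p : ℝ → Ω → State n) : Prop where
  measurable : AEStronglyMeasurable (fun z : ℝ × Ω => p z.1 z.2)
    ((volume.restrict (Icc P.t₀ P.T)).prod P.μ)
  continuousOn : ∀ ω ∈ P.μ.support, ContinuousOn (fun t => p t ω) (Icc P.t₀ P.T)
  adjoint_eq : ∀ ω ∈ P.μ.support, ∀ t ∈ Icc P.t₀ P.T,
    p t ω = p P.T ω + ∫ s in t..P.T, P.adjointField u x s ω (p s ω)
  terminal : ∀ ω ∈ P.μ.support, -p P.T ω = gradient (fun z => P.g z ω) (x P.T ω)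

/-- `L²`-valued adjoint state: `t ↦ p(t,·)` is a curve `q` in
`W^{1,1}([t₀,T]; L²(μ,Ω;ℝⁿ))` with derivative `dq`, and `-q̇(t) = [∂f/∂x]^* q(t)` in `L²` for
a.e. `t`, `-q(T) = ∇ₓ g(x(T))` in `L²`. -/
def IsMeanCostate (P : Problem n m Ω) (u : ℝ → Fin m → ℝ)
    (x : ℝ → Ω → State n) (p : ℝ → Ω → State n) : Prop :=
  ∃ q dq : ℝ → Lp (State n) 2 P.μ,
    (∀ t ∈ Icc P.t₀ P.T, p t =ᵐ[P.μ] q t) ∧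
    IntervalIntegrable dq volume P.t₀ P.T ∧
    (∀ t ∈ Icc P.t₀ P.T, q t = q P.t₀ + ∫ s in P.t₀..t, dq s) ∧
    (∀ᵐ t ∂(volume.restrict (Icc P.t₀ P.T)), ∀ᵐ ω ∂P.μ,
      -(dq t ω) = P.adjointField u x t ω (q t ω)) ∧
    ∀ᵐ ω ∂P.μ, -(q P.T ω) = gradient (fun z => P.g z ω) (x P.T ω)

/-- The switching functions `Ψᵢ(t) = ∫ p(t,ω) · fᵢ(x(t,ω),ω) dμ(ω)`, `i = 1,…,m`. -/
def switching (P : Problem n m Ω) (x p : ℝ → Ω → State n) (i : Fin m) (t : ℝ) : ℝ :=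
  ∫ ω, inner ℝ (p t ω) (P.f i.succ (x t ω) ω) ∂P.μ

/-- The set `S(t)` of singular indices. -/
def singularSet (P : Problem n m Ω) (u : ℝ → Fin m → ℝ) (t : ℝ) : Finset (Fin m) :=
  Finset.univ.filter fun i => P.umin i < u t i ∧ u t i < P.umax i

/-- The set `B_min(t)` of lower bang indices. -/
def bangMin (P : Problem n m Ω) (x p : ℝ → Ω → State n) (t : ℝ) : Finset (Fin m) :=
  Finset.univ.filter fun i => P.switching x p i t < 0

/-- The set `B_max(t)` of upper bang indices. -/
def bangMax (P : Problem n m Ω) (x p : ℝ → Ω → State n) (t : ℝ) : Finset (Fin m) :=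
  Finset.univ.filter fun i => 0 < P.switching x p i t

/-- The integrand `p · [fᵢ,[f₀,fⱼ]]`, evaluated at `(x(t,ω),ω)`, for `i,j = 0,…,m`; the bracket
is `[a,b] = b'a - a'b`. -/
def bracketTerm (P : Problem n m Ω) (x p : ℝ → Ω → State n) (i j : Fin (m + 1))
    (t : ℝ) (ω : Ω) : ℝ :=
  inner ℝ (p t ω)
    (VectorField.lieBracket ℝ (fun y => P.f i y ω)
      (VectorField.lieBracket ℝ (fun y => P.f 0 y ω) (fun y => P.f j y ω)) (x t ω))

/-- `W_{ij}(t) = ∫ p · [fᵢ,[f₀,fⱼ]] dμ`, `i,j = 0,…,m`. -/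
def W (P : Problem n m Ω) (x p : ℝ → Ω → State n) (i j : Fin (m + 1)) (t : ℝ) : ℝ :=
  ∫ ω, P.bracketTerm x p i j t ω ∂P.μ

/-- The matrix `W_S(t) = [W_{ij}(t)]_{i,j ∈ S}`. -/
def WS (P : Problem n m Ω) (x p : ℝ → Ω → State n) (S : Finset (Fin m)) (t : ℝ) :
    Matrix S S ℝ :=
  Matrix.of fun i j => P.W x p i.1.succ j.1.succ t

/-- The vector `b_S(t)`:
`bᵢ = W_{0i} + ∑_{j ∈ B_min} W_{ij} umin_j + ∑_{j ∈ B_max} W_{ij} umax_j`. -/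
def bS (P : Problem n m Ω) (x p : ℝ → Ω → State n) (S Bmin Bmax : Finset (Fin m)) (t : ℝ) :
    S → ℝ :=
  fun i => P.W x p 0 i.1.succ t + ∑ j ∈ Bmin, P.W x p i.1.succ j.succ t * P.umin j +
    ∑ j ∈ Bmax, P.W x p i.1.succ j.succ t * P.umax j

end Problem

end EnsembleControl

end

/-!
Let `(u, x)` be the minimizer and `p` its adjoint state. The first variation of the cost in the
direction `v - u` is `-∫∫ p · (f(x, v) - f(x, u)) dμ dt`, and the states of `u + λ (v - u)` are
`W^{1,1}`-close to `x` for small `λ`. Local minimality therefore gives the maximum principle: almost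
everywhere `uᵢ` takes its extreme value of the sign of `Ψᵢ` where `Ψᵢ ≠ 0`, so that `Ψᵢ = 0` where
`uᵢ` is singular.

For every field `G`, the function `p · G(x)` has the derivative `p · [f(·, u), G]` along the arcs.
Averaged and applied to `G = fᵢ` on an interval where `Ψᵢ = 0`, this gives `∫ p · [f₀, fᵢ] dμ = 0`,
since the controlled fields commute. Applied once more to `G = [f₀, fᵢ]`, it gives
`W₀ᵢ + ∑ⱼ uⱼ Wⱼᵢ = 0`. By the Jacobi identity and commutativity `Wⱼᵢ = Wᵢⱼ`, and splitting the sum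
over the singular, lower bang and upper bang indices yields the linear system.
-/

namespace EnsembleControl

/-! ### Absolutely continuous curves -/

section Gronwall

theorem le_mul_exp_of_le_add_integral {h : ℝ → ℝ} {a b C K : ℝ} (hh : ContinuousOn h (Icc a b))
    (hK : 0 ≤ K) (hle : ∀ t ∈ Icc a b, h t ≤ C + K * ∫ s in a..t, h s) {t : ℝ}
    (ht : t ∈ Icc a b) : h t ≤ C * Real.exp (K * (t - a)) := by
  have hab : a ≤ b := ht.1.trans ht.2
  set g : ℝ → ℝ := IccExtend hab ((Icc a b).domRestrict h)
  have hg : Continuous g := (continuousOn_iff_continuous_domRestrict.1 hh).Icc_extend'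
  have hgh : EqOn g h (Icc a b) := fun s hs => IccExtend_of_mem _ _ hs
  have hint : ∀ s ∈ Icc a b, ∫ r in a..s, g r = ∫ r in a..s, h r := fun s hs =>
    intervalIntegral.integral_congr
      (hgh.mono (uIcc_subset_Icc (left_mem_Icc.2 hab) hs))
  have hderiv : ∀ s, HasDerivAt (fun s => C + K * ∫ r in a..s, g r) (K * g s) s := fun s =>
    ((intervalIntegral.integral_hasDerivAt_right (hg.intervalIntegrable _ _)
      (hg.stronglyMeasurableAtFilter _ _) hg.continuousAt).const_mul K).const_add C
  have key := le_gronwallBound_of_liminf_deriv_right_le (f := fun s => C + K * ∫ r in a..s, g r)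
    (f' := fun s => K * g s) (δ := C) (K := K) (ε := 0) (a := a) (b := b)
    (fun s _ => (hderiv s).continuousAt.continuousWithinAt)
    (fun s _ r hr => (hderiv s).hasDerivWithinAt.liminf_right_slope_le hr) (by simp)
    (fun s hs => by
      have hs' : s ∈ Icc a b := Ico_subset_Icc_self hs
      have := hle s hs'
      rw [← hint s hs', ← hgh hs'] at this
      simpa using mul_le_mul_of_nonneg_left this hK) t ht
  rw [gronwallBound_ε0, hint t ht] at key
  exact (hle t ht).trans key

end Gronwall

/-- `y` is an absolutely continuous curve on `[a,b]` with velocity `v`, expressed through the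
integral equation so that `y` may be an arbitrary function outside `[a,b]`. State arcs, costate
arcs and curves in `L²` are all of this form. -/
structure HasVelocityOn {E : Type*} [NormedAddCommGroup E] [NormedSpace ℝ E]
    (y v : ℝ → E) (a b : ℝ) : Prop where
  integrableOn : IntegrableOn v (Icc a b)
  eq_add : ∀ t ∈ Icc a b, y t = y a + ∫ s in a..t, v s

theorem exists_mem_Icc_of_ae {a b : ℝ} (hab : a < b) {q : ℝ → Prop}
    (hq : ∀ᵐ t ∂volume.restrict (Icc a b), q t) : ∃ t ∈ Icc a b, q t := by
  have : NeZero (volume.restrict (Icc a b)) :=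
    ⟨by rw [Ne, Measure.restrict_eq_zero]; simpa using hab⟩
  exact ((ae_restrict_mem measurableSet_Icc).and hq).exists

theorem ae_restrict_Icc_mem_Ioo (a b : ℝ) : ∀ᵐ t ∂volume.restrict (Icc a b), t ∈ Ioo a b := by
  rw [← restrict_Ioo_eq_restrict_Icc]
  exact ae_restrict_mem measurableSet_Ioo

namespace HasVelocityOn

variable {E : Type*} [NormedAddCommGroup E] [NormedSpace ℝ E] {y z v w : ℝ → E}
  {a b c K M s t : ℝ}

theorem intervalIntegrable (h : HasVelocityOn y v a b) (hs : s ∈ Icc a b) (ht : t ∈ Icc a b) :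
    IntervalIntegrable v volume s t :=
  (h.integrableOn.mono_set (uIcc_subset_Icc hs ht)).intervalIntegrable

theorem integral_eq_sub (h : HasVelocityOn y v a b) (hs : s ∈ Icc a b) (ht : t ∈ Icc a b) :
    ∫ r in s..t, v r = y t - y s := by
  have ha : a ∈ Icc a b := left_mem_Icc.2 (hs.1.trans hs.2)
  rw [h.eq_add t ht, h.eq_add s hs, add_sub_add_left_eq_sub,
    intervalIntegral.integral_interval_sub_left (h.intervalIntegrable ha ht)
      (h.intervalIntegrable ha hs)]

theorem continuousOn (h : HasVelocityOn y v a b) : ContinuousOn y (Icc a b) :=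
  ((intervalIntegral.continuousOn_primitive_Icc h.integrableOn).const_add (y a)).congr
    fun t ht => by
      simp only [h.eq_add t ht, intervalIntegral.integral_of_le ht.1, integral_Icc_eq_integral_Ioc]

theorem mono {c d : ℝ} (h : HasVelocityOn y v a b) (hac : a ≤ c) (hcd : c ≤ d) (hdb : d ≤ b) :
    HasVelocityOn y v c d where
  integrableOn := h.integrableOn.mono_set (Icc_subset_Icc hac hdb)
  eq_add t ht := by
    rw [h.integral_eq_sub ⟨hac, hcd.trans hdb⟩ (Icc_subset_Icc hac hdb ht), add_sub_cancel]

theorem sub (hy : HasVelocityOn y v a b) (hz : HasVelocityOn z w a b) :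
    HasVelocityOn (fun t => y t - z t) (fun t => v t - w t) a b where
  integrableOn := hy.integrableOn.sub hz.integrableOn
  eq_add t ht := by
    have ha : a ∈ Icc a b := left_mem_Icc.2 (ht.1.trans ht.2)
    rw [hy.eq_add t ht, hz.eq_add t ht, intervalIntegral.integral_sub
      (hy.intervalIntegrable ha ht) (hz.intervalIntegrable ha ht)]
    abel

theorem congr (h : HasVelocityOn y v a b) (hyz : EqOn y z (Icc a b))
    (hvw : v =ᵐ[volume.restrict (Icc a b)] w) : HasVelocityOn z w a b where
  integrableOn := h.integrableOn.congr_fun_ae hvw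
  eq_add t ht := by
    have ha : a ∈ Icc a b := left_mem_Icc.2 (ht.1.trans ht.2)
    rw [← hyz ht, ← hyz ha, h.eq_add t ht, intervalIntegral.integral_congr_ae_restrict
      (ae_restrict_of_ae_restrict_of_subset (uIoc_subset_uIcc.trans (uIcc_subset_Icc ha ht)) hvw)]

theorem of_eq_add_integral_to_right (hw : IntegrableOn w (Icc a b))
    (hy : ∀ t ∈ Icc a b, y t = y b + ∫ s in t..b, w s) :
    HasVelocityOn y (fun t => -w t) a b where
  integrableOn := hw.neg
  eq_add t ht := by
    have ha : a ∈ Icc a b := left_mem_Icc.2 (ht.1.trans ht.2)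
    have hw' : ∀ s ∈ Icc a b, ∀ r ∈ Icc a b, IntervalIntegrable w volume s r := fun s hs r hr =>
      (hw.mono_set (uIcc_subset_Icc hs hr)).intervalIntegrable
    rw [hy t ht, hy a ha, intervalIntegral.integral_neg,
      ← intervalIntegral.integral_add_adjacent_intervals (hw' a ha t ht)
        (hw' t ht b (right_mem_Icc.2 (ha.1.trans ha.2)))]
    abel

theorem reverse (h : HasVelocityOn y v a b) :
    HasVelocityOn (fun t => y (a + b - t)) (fun t => -v (a + b - t)) a b where
  integrableOn := by
    have hpre : (fun t => a + b - t) ⁻¹' Icc a b = Icc a b := by simp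
    have := (Measure.measurePreserving_sub_left volume (a + b)).integrableOn_comp_preimage
      (MeasurableEquiv.subLeft (a + b)).measurableEmbedding (f := v) (s := Icc a b)
    rw [hpre] at this
    exact (this.2 h.integrableOn).neg
  eq_add t ht := by
    have hrefl : a + b - t ∈ Icc a b := ⟨by linarith [ht.2], by linarith [ht.1]⟩
    rw [intervalIntegral.integral_neg, intervalIntegral.integral_comp_sub_left v,
      add_sub_cancel_left, h.integral_eq_sub hrefl (right_mem_Icc.2 (ht.1.trans ht.2))]
    abel

theorem norm_sub_le (h : HasVelocityOn y v a b) (hM : ∀ᵐ r ∂volume.restrict (Icc a b), ‖v r‖ ≤ M)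
    (hs : s ∈ Icc a b) (ht : t ∈ Icc a b) : ‖y t - y s‖ ≤ M * |t - s| := by
  rw [← h.integral_eq_sub hs ht]
  refine intervalIntegral.norm_integral_le_of_norm_le_const_ae ?_
  filter_upwards [(ae_restrict_iff' measurableSet_Icc).1 hM] with r hr hrm
  exact hr (uIcc_subset_Icc hs ht (uIoc_subset_uIcc hrm))

theorem lipschitzOnWith (h : HasVelocityOn y v a b)
    (hM : ∀ᵐ r ∂volume.restrict (Icc a b), ‖v r‖ ≤ M) : LipschitzOnWith M.toNNReal y (Icc a b) :=
  LipschitzOnWith.of_dist_le_mul fun t ht s hs => by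
    rw [dist_eq_norm, Real.dist_eq]
    refine (h.norm_sub_le hM hs ht).trans ?_
    gcongr
    exact Real.le_coe_toNNReal M

theorem ae_hasDerivAt [CompleteSpace E] (h : HasVelocityOn y v a b) :
    ∀ᵐ t ∂volume.restrict (Icc a b), HasDerivAt y (v t) t := by
  rcases le_or_gt a b with hab | hab
  · have ha : a ∈ Icc a b := left_mem_Icc.2 hab
    have hderiv := (h.intervalIntegrable ha (right_mem_Icc.2 hab)).ae_hasDerivAt_integral
    filter_upwards [ae_restrict_Icc_mem_Ioo a b, ae_restrict_of_ae hderiv] with t ht hderivt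
    have hIcc : t ∈ uIcc a b := Icc_subset_uIcc (Ioo_subset_Icc_self ht)
    refine ((hderivt hIcc a left_mem_uIcc).const_add (y a)).congr_of_eventuallyEq ?_
    filter_upwards [Ioo_mem_nhds ht.1 ht.2] with s hs
    exact h.eq_add s (Ioo_subset_Icc_self hs)
  · simp [Icc_eq_empty hab.not_ge]

theorem of_lipschitzOnWith {h h' : ℝ → ℝ} {L : NNReal} (hL : LipschitzOnWith L h (Icc a b))
    (hderiv : ∀ᵐ t ∂volume.restrict (Icc a b), HasDerivAt h (h' t) t) :
    HasVelocityOn h h' a b where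
  integrableOn := by
    rcases le_or_gt a b with hab | hab
    · have hAC := (hL.mono (uIcc_subset_Icc (left_mem_Icc.2 hab)
        (right_mem_Icc.2 hab))).absolutelyContinuousOnInterval
      exact ((intervalIntegrable_iff_integrableOn_Icc_of_le hab).1
        hAC.intervalIntegrable_deriv).congr_fun_ae (hderiv.mono fun r hr => hr.deriv)
    · simp [Icc_eq_empty hab.not_ge]
  eq_add t ht := by
    have hsub : uIcc a t ⊆ Icc a b := uIcc_subset_Icc (left_mem_Icc.2 (ht.1.trans ht.2)) ht
    have hAC := (hL.mono hsub).absolutelyContinuousOnInterval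
    rw [← intervalIntegral.integral_congr_ae_restrict
      ((ae_restrict_of_ae_restrict_of_subset (uIoc_subset_uIcc.trans hsub) hderiv).mono
        fun r hr => hr.deriv), hAC.integral_deriv_eq_sub]
    abel

theorem norm_le_mul_exp (h : HasVelocityOn y v a b) (hK : 0 ≤ K) (hc : 0 ≤ c)
    (hv : ∀ᵐ s ∂volume.restrict (Icc a b), ‖v s‖ ≤ K * ‖y s‖ + c) (ht : t ∈ Icc a b) :
    ‖y t‖ ≤ (‖y a‖ + c * (b - a)) * Real.exp (K * (t - a)) := by
  have ha : a ∈ Icc a b := left_mem_Icc.2 (ht.1.trans ht.2)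
  refine le_mul_exp_of_le_add_integral (h := fun s => ‖y s‖) h.continuousOn.norm hK
    (fun r hr => ?_) ht
  have hint : IntervalIntegrable (fun s => K * ‖y s‖) volume a r :=
    ((h.continuousOn.norm.const_smul K).mono (uIcc_subset_Icc ha hr)).intervalIntegrable
  have hle : ‖∫ s in a..r, v s‖ ≤ ∫ s in a..r, (K * ‖y s‖ + c) := by
    refine intervalIntegral.norm_integral_le_of_norm_le hr.1 ?_ (hint.add (by simp))
    filter_upwards [(ae_restrict_iff' measurableSet_Icc).1 hv] with s hs hsr
    exact hs ⟨hsr.1.le, hsr.2.trans hr.2⟩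
  rw [intervalIntegral.integral_add hint (by simp), intervalIntegral.integral_const_mul,
    intervalIntegral.integral_const, smul_eq_mul] at hle
  have hcr : (r - a) * c ≤ c * (b - a) := by
    rw [mul_comm]; exact mul_le_mul_of_nonneg_left (by linarith [hr.2]) hc
  rw [h.eq_add r hr]
  linarith [norm_add_le (y a) (∫ s in a..r, v s)]

theorem norm_le_mul_exp_of_right (h : HasVelocityOn y v a b) (hK : 0 ≤ K)
    (hv : ∀ᵐ s ∂volume.restrict (Icc a b), ‖v s‖ ≤ K * ‖y s‖) (ht : t ∈ Icc a b) :
    ‖y t‖ ≤ ‖y b‖ * Real.exp (K * (b - t)) := by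
  have hrev : ∀ᵐ s ∂volume.restrict (Icc a b),
      ‖-v (a + b - s)‖ ≤ K * ‖y (a + b - s)‖ + 0 := by
    rw [ae_restrict_iff' measurableSet_Icc] at hv ⊢
    have hpres := Measure.measurePreserving_sub_left volume (a + b)
    filter_upwards [hpres.quasiMeasurePreserving.ae hv] with s hs hsm
    rw [norm_neg, add_zero]
    exact hs ⟨by linarith [hsm.2], by linarith [hsm.1]⟩
  have := h.reverse.norm_le_mul_exp hK le_rfl hrev (t := a + b - t)
    ⟨by linarith [ht.2], by linarith [ht.1]⟩
  rw [sub_sub_cancel, add_sub_cancel_left, zero_mul, add_zero] at this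
  rwa [show a + b - t - a = b - t by ring] at this

end HasVelocityOn

/-! ### Carathéodory equations with a parameter -/

section Picard

variable {Z E : Type*} [NormedAddCommGroup E] [NormedSpace ℝ E]

/-- The Picard iterates of the initial value problem `ẋ = F(t,z,x)`, `x(a) = ξ(z)`, as functions
of time and parameter. -/
noncomputable def picardIter (a : ℝ) (F : ℝ → Z → E → E) (ξ : Z → E) : ℕ → ℝ × Z → E
  | 0 => fun q => ξ q.2
  | k + 1 => fun q => ξ q.2 + ∫ s in Ioc a q.1, F s q.2 (picardIter a F ξ k (s, q.2))

theorem picardIter_left (a : ℝ) (F : ℝ → Z → E → E) (ξ : Z → E) (k : ℕ) (z : Z) :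
    picardIter a F ξ k (a, z) = ξ z := by
  cases k <;> simp [picardIter]

end Picard

section Caratheodory

variable {Z E : Type*} [MeasurableSpace Z] [NormedAddCommGroup E] [MeasurableSpace E]

/-- The right-hand side `F(t,z,x)` of a Carathéodory equation `ẋ = F(t,z,x)` depending on a
parameter `z`: jointly measurable, `K`-Lipschitz in the state, and bounded in time at the zero
state by a constant that may depend on the parameter. -/
structure IsCaratheodoryField (F : ℝ → Z → E → E) (K : ℝ) : Prop where
  measurable : Measurable fun q : ℝ × Z × E => F q.1 q.2.1 q.2.2
  pos : 0 < K
  lipschitz : ∀ t z x y, ‖F t z x - F t z y‖ ≤ K * ‖x - y‖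
  bounded_zero : ∀ z, ∃ C, ∀ t, ‖F t z 0‖ ≤ C

variable {F : ℝ → Z → E → E} {K a b : ℝ}

theorem IsCaratheodoryField.reverse (hF : IsCaratheodoryField F K) (c : ℝ) :
    IsCaratheodoryField (fun t => F (c - t)) K where
  measurable := hF.measurable.comp ((measurable_const.sub measurable_fst).prodMk measurable_snd)
  pos := hF.pos
  lipschitz t := hF.lipschitz (c - t)
  bounded_zero z := (hF.bounded_zero z).imp fun _ hC t => hC (c - t)

theorem IsCaratheodoryField.integrableOn [BorelSpace E] [SecondCountableTopology E]
    (hF : IsCaratheodoryField F K) (z : Z) {y : ℝ → E} {D : ℝ}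
    (hy : AEStronglyMeasurable y (volume.restrict (Icc a b))) (hD : ∀ s ∈ Icc a b, ‖y s‖ ≤ D) :
    IntegrableOn (fun s => F s z (y s)) (Icc a b) := by
  obtain ⟨C, hC⟩ := hF.bounded_zero z
  refine Integrable.of_bound (C := K * D + C) ?_ ?_
  · exact (hF.measurable.comp_aemeasurable (aemeasurable_id.prodMk
      ((aemeasurable_const (b := z)).prodMk hy.aemeasurable))).aestronglyMeasurable
  · filter_upwards [ae_restrict_mem measurableSet_Icc] with s hs
    have hLip := hF.lipschitz s z (y s) 0
    rw [sub_zero] at hLip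
    calc ‖F s z (y s)‖ ≤ ‖F s z (y s) - F s z 0‖ + ‖F s z 0‖ := norm_le_norm_sub_add _ _
      _ ≤ K * ‖y s‖ + C := add_le_add hLip (hC s)
      _ ≤ K * D + C := by have := hF.pos; gcongr; exact hD s hs

variable [NormedSpace ℝ E]

theorem IsCaratheodoryField.tendsto_integral (hF : IsCaratheodoryField F K) {z : Z} {t : ℝ}
    {x : ℕ → ℝ → E} {y : ℝ → E} {ε : ℕ → ℝ} (hat : a ≤ t)
    (hx : ∀ k, IntervalIntegrable (fun s => F s z (x k s)) volume a t)
    (hy : IntervalIntegrable (fun s => F s z (y s)) volume a t)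
    (hxy : ∀ k, ∀ s ∈ Icc a t, ‖x k s - y s‖ ≤ ε k) (hε : Tendsto ε atTop (𝓝 0)) :
    Tendsto (fun k => ∫ s in a..t, F s z (x k s)) atTop (𝓝 (∫ s in a..t, F s z (y s))) := by
  have hbound : Tendsto (fun k => K * ε k * |t - a|) atTop (𝓝 0) := by
    simpa using (hε.const_mul K).mul_const |t - a|
  refine tendsto_iff_norm_sub_tendsto_zero.2
    (squeeze_zero (fun _ => norm_nonneg _) (fun k => ?_) hbound)
  rw [← intervalIntegral.integral_sub (hx k) hy]
  refine intervalIntegral.norm_integral_le_of_norm_le_const fun s hs => ?_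
  rw [uIoc_of_le hat] at hs
  exact (hF.lipschitz _ _ _ _).trans
    (mul_le_mul_of_nonneg_left (hxy k s (Ioc_subset_Icc_self hs)) hF.pos.le)

theorem measurable_setIntegral_Ioc [BorelSpace E] [SecondCountableTopology E] {G : ℝ × Z → E}
    (hG : Measurable G) (a : ℝ) :
    Measurable fun q : ℝ × Z => ∫ s in Ioc a q.1, G (s, q.2) := by
  let A : Set ((ℝ × Z) × ℝ) := {r | r.2 ∈ Ioc a r.1.1}
  have hA : MeasurableSet A := (measurableSet_lt measurable_const measurable_snd).inter
    (measurableSet_le measurable_snd (measurable_fst.comp measurable_fst))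
  have hGA : StronglyMeasurable (A.indicator fun r => G (r.2, r.1.2)) :=
    ((hG.comp (measurable_snd.prodMk (measurable_snd.comp measurable_fst))).indicator
      hA).stronglyMeasurable
  have hindicator : (fun q : ℝ × Z => ∫ s in Ioc a q.1, G (s, q.2)) =
      fun q => ∫ s, A.indicator (fun r => G (r.2, r.1.2)) (q, s) := by
    funext q
    rw [← integral_indicator measurableSet_Ioc]
    rfl
  exact hindicator ▸ hGA.integral_prod_right'.measurable

variable [BorelSpace E] [SecondCountableTopology E] {ξ : Z → E} {t : ℝ}

theorem measurable_picardIter (hF : IsCaratheodoryField F K) (hξ : Measurable ξ) (k : ℕ) :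
    Measurable (picardIter a F ξ k) := by
  induction k with
  | zero => exact hξ.comp measurable_snd
  | succ k ih =>
    exact (hξ.comp measurable_snd).add
      (measurable_setIntegral_Ioc (G := fun q => F q.1 q.2 (picardIter a F ξ k q))
        (hF.measurable.comp (measurable_fst.prodMk (measurable_snd.prodMk ih))) a)

theorem aestronglyMeasurable_picardIter (hF : IsCaratheodoryField F K) (hξ : Measurable ξ)
    (k : ℕ) (z : Z) {ν : Measure ℝ} :
    AEStronglyMeasurable (fun s => picardIter a F ξ k (s, z)) ν :=
  ((measurable_picardIter hF hξ k).comp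
    (measurable_id.prodMk measurable_const)).aestronglyMeasurable

theorem exists_norm_picardIter_le (hF : IsCaratheodoryField F K) (hξ : Measurable ξ) (b : ℝ)
    (k : ℕ) (z : Z) : ∃ D, ∀ s ∈ Icc a b, ‖picardIter a F ξ k (s, z)‖ ≤ D := by
  induction k with
  | zero => exact ⟨‖ξ z‖, fun s _ => le_rfl⟩
  | succ k ih =>
    obtain ⟨D, hD⟩ := ih
    have hint := (hF.integrableOn z (aestronglyMeasurable_picardIter hF hξ k z) hD).norm
    refine ⟨‖ξ z‖ + ∫ s in Icc a b, ‖F s z (picardIter a F ξ k (s, z))‖, fun s hs => ?_⟩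
    refine (norm_add_le _ _).trans (add_le_add le_rfl ((norm_integral_le_integral_norm _).trans ?_))
    exact setIntegral_mono_set hint (Eventually.of_forall fun _ => norm_nonneg _)
      (Ioc_subset_Icc_self.trans (Icc_subset_Icc_right hs.2)).eventuallyLE

theorem hasVelocityOn_picardIter_succ (hF : IsCaratheodoryField F K) (hξ : Measurable ξ)
    (b : ℝ) (k : ℕ) (z : Z) : HasVelocityOn (fun t => picardIter a F ξ (k + 1) (t, z))
      (fun s => F s z (picardIter a F ξ k (s, z))) a b where
  integrableOn := by
    obtain ⟨D, hD⟩ := exists_norm_picardIter_le (a := a) hF hξ b k z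
    exact hF.integrableOn z (aestronglyMeasurable_picardIter hF hξ k z) hD
  eq_add t ht := by
    rw [picardIter_left, intervalIntegral.integral_of_le ht.1]
    rfl

/-- The weight `exp (2K(t - a))` makes the Picard map a contraction with factor `1/2`. -/
theorem exists_norm_picardIter_succ_sub_le (hF : IsCaratheodoryField F K) (hξ : Measurable ξ)
    (b : ℝ) (z : Z) : ∃ M, 0 ≤ M ∧ ∀ k, ∀ t ∈ Icc a b,
      ‖picardIter a F ξ (k + 1) (t, z) - picardIter a F ξ k (t, z)‖ ≤
        M * (1 / 2) ^ k * Real.exp (2 * K * (t - a)) := by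
  have hK := hF.pos
  obtain ⟨D, hD⟩ := exists_norm_picardIter_le (a := a) hF hξ b 1 z
  refine ⟨|D| + ‖ξ z‖, by positivity, fun k => ?_⟩
  set M := |D| + ‖ξ z‖
  induction k with
  | zero =>
    intro t ht
    have hexp : 1 ≤ Real.exp (2 * K * (t - a)) :=
      Real.one_le_exp (mul_nonneg (by positivity) (by linarith [ht.1]))
    calc _ ≤ M := (norm_sub_le _ _).trans
            (add_le_add ((hD t ht).trans (le_abs_self D)) le_rfl)
      _ ≤ M * (1 / 2) ^ 0 * Real.exp (2 * K * (t - a)) := by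
        rw [pow_zero, mul_one]; exact le_mul_of_one_le_right (by positivity) hexp
  | succ k ih =>
    intro t ht
    set H : ℝ → ℝ := fun s => M * (1 / 2) ^ (k + 1) * Real.exp (2 * K * (s - a))
    set h : ℝ → ℝ := fun s => K * (M * (1 / 2) ^ k * Real.exp (2 * K * (s - a))) with hh
    have hderiv : ∀ s, HasDerivAt H (h s) s := fun s =>
      (((((hasDerivAt_id s).sub_const a).const_mul (2 * K)).exp).const_mul
        (M * (1 / 2) ^ (k + 1))).congr_deriv (by simp only [hh, id]; ring)
    have hhint : IntervalIntegrable h volume a t := by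
      apply Continuous.intervalIntegrable; fun_prop
    have hdiff := (hasVelocityOn_picardIter_succ (a := a) hF hξ b (k + 1) z).sub
      (hasVelocityOn_picardIter_succ hF hξ b k z)
    have hHa : 0 ≤ H a := by positivity
    rw [hdiff.eq_add t ht, picardIter_left, picardIter_left, sub_self, zero_add]
    calc _ ≤ ∫ s in a..t, h s :=
          intervalIntegral.norm_integral_le_of_norm_le ht.1 (Eventually.of_forall fun s hs =>
            (hF.lipschitz _ _ _ _).trans (mul_le_mul_of_nonneg_left
              (ih s ⟨hs.1.le, hs.2.trans ht.2⟩) hK.le)) hhint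
      _ = H t - H a := intervalIntegral.integral_eq_sub_of_hasDerivAt (fun s _ => hderiv s) hhint
      _ ≤ H t := by linarith

theorem hasVelocityOn_of_picardIter_limit (hF : IsCaratheodoryField F K) (hξ : Measurable ξ)
    (hab : a ≤ b) {z : Z} {y : ℝ → E} {D : ℝ} (hy : Measurable y)
    (hD : ∀ t ∈ Icc a b, ∀ k, ‖picardIter a F ξ k (t, z) - y t‖ ≤ D * (1 / 2) ^ k) :
    y a = ξ z ∧ HasVelocityOn y (fun s => F s z (y s)) a b := by
  have hε : Tendsto (fun k : ℕ => D * (1 / 2) ^ k) atTop (𝓝 0) := by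
    simpa using (tendsto_pow_atTop_nhds_zero_of_lt_one (r := (1 / 2 : ℝ)) (by norm_num)
      (by norm_num)).const_mul D
  have hlim : ∀ t ∈ Icc a b, Tendsto (fun k => picardIter a F ξ k (t, z)) atTop (𝓝 (y t)) :=
    fun t ht => tendsto_iff_norm_sub_tendsto_zero.2
      (squeeze_zero (fun _ => norm_nonneg _) (hD t ht) hε)
  have ha : a ∈ Icc a b := left_mem_Icc.2 hab
  have hya : y a = ξ z := by
    have := hlim a ha
    simp only [picardIter_left] at this
    exact tendsto_nhds_unique this tendsto_const_nhds
  have hint : IntegrableOn (fun s => F s z (y s)) (Icc a b) := by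
    refine hF.integrableOn z hy.aestronglyMeasurable (D := ‖ξ z‖ + D) fun s hs => ?_
    have h₀ := hD s hs 0
    rw [pow_zero, mul_one] at h₀
    exact (norm_le_norm_add_norm_sub _ _).trans (add_le_add le_rfl h₀)
  have hiter := fun k => hasVelocityOn_picardIter_succ (a := a) hF hξ b k z
  refine ⟨hya, hint, fun t ht => ?_⟩
  refine tendsto_nhds_unique ((hlim t ht).comp (tendsto_add_atTop_nat 1)) ?_
  refine ((hF.tendsto_integral ht.1 (fun k => (hiter k).intervalIntegrable ha ht)
    (hint.mono_set (uIcc_subset_Icc ha ht)).intervalIntegrable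
    (fun k s hs => hD s (Icc_subset_Icc_right ht.2 hs) k) hε).const_add (y a)).congr fun k => ?_
  rw [Function.comp_apply, (hiter k).eq_add t ht, picardIter_left, hya]

variable [CompleteSpace E]

theorem exists_measurable_picardIter_limit (hF : IsCaratheodoryField F K) (hξ : Measurable ξ)
    (hab : a ≤ b) : ∃ Y : ℝ × Z → E, Measurable Y ∧ ∀ z, ∃ D, ∀ t ∈ Icc a b, ∀ k,
      ‖picardIter a F ξ k (t, z) - Y (t, z)‖ ≤ D * (1 / 2) ^ k := by
  have hK := hF.pos
  let x : ℕ → ℝ × Z → E := fun k q => picardIter a F ξ k (projIcc a b hab q.1, q.2)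
  choose M hM₀ hM using exists_norm_picardIter_succ_sub_le (a := a) hF hξ b
  let D : Z → ℝ := fun z => M z * Real.exp (2 * K * (b - a))
  have hdist : ∀ q k, dist (x k q) (x (k + 1) q) ≤ D q.2 * (1 / 2) ^ k := fun q k => by
    have hmem := (projIcc a b hab q.1).2
    have hMz := hM₀ q.2
    rw [dist_comm, dist_eq_norm]
    refine (hM q.2 k _ hmem).trans ?_
    rw [mul_right_comm]
    change _ ≤ M q.2 * Real.exp (2 * K * (b - a)) * (1 / 2) ^ k
    gcongr
    exact hmem.2
  choose Y hY using fun q => cauchySeq_tendsto_of_complete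
    (cauchySeq_of_le_geometric (1 / 2) _ (by norm_num) (hdist q))
  have hx : ∀ k, Measurable (x k) := fun k => (measurable_picardIter hF hξ k).comp
    (((continuous_subtype_val.comp continuous_projIcc).measurable.comp measurable_fst).prodMk
      measurable_snd)
  refine ⟨Y, measurable_of_tendsto_metrizable hx (tendsto_pi_nhds.2 hY), fun z =>
    ⟨D z / (1 - 1 / 2), fun t ht k => ?_⟩⟩
  have hgeom := dist_le_of_le_geometric_of_tendsto (1 / 2) _ (by norm_num) (hdist (t, z))
    (hY (t, z)) k
  simp only [x, projIcc_of_mem hab ht] at hgeom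
  rwa [dist_eq_norm, mul_div_right_comm] at hgeom

theorem exists_measurable_hasVelocityOn (hF : IsCaratheodoryField F K) (hξ : Measurable ξ)
    (hab : a ≤ b) : ∃ X : ℝ → Z → E, (Measurable fun q : ℝ × Z => X q.1 q.2) ∧
      (∀ z, Continuous fun t => X t z) ∧
      ∀ z, X a z = ξ z ∧ HasVelocityOn (fun t => X t z) (fun s => F s z (X s z)) a b := by
  obtain ⟨Y, hYm, hY⟩ := exists_measurable_picardIter_limit hF hξ hab
  have hYv : ∀ z, Y (a, z) = ξ z ∧
      HasVelocityOn (fun t => Y (t, z)) (fun s => F s z (Y (s, z))) a b := fun z =>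
    (hY z).elim fun D hD => hasVelocityOn_of_picardIter_limit (y := fun t => Y (t, z)) hF hξ hab
      (hYm.comp (measurable_id.prodMk measurable_const)) hD
  have hYX : ∀ z, EqOn (fun t => Y (t, z)) (fun t => Y (projIcc a b hab t, z)) (Icc a b) :=
    fun z t ht => by simp only [projIcc_of_mem hab ht]
  refine ⟨fun t z => Y (projIcc a b hab t, z), ?_, fun z => ?_, fun z => ⟨?_, ?_⟩⟩
  · exact hYm.comp (((continuous_subtype_val.comp continuous_projIcc).measurable.comp
      measurable_fst).prodMk measurable_snd)
  · exact (hYv z).2.continuousOn.comp_continuous (continuous_subtype_val.comp continuous_projIcc)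
      fun t => (projIcc a b hab t).2
  · exact (hYX z (left_mem_Icc.2 hab)).symm.trans (hYv z).1
  · exact (hYv z).2.congr (hYX z) ((ae_restrict_mem measurableSet_Icc).mono fun s hs =>
      congrArg (F s z) (hYX z hs))

theorem exists_measurable_hasVelocityOn_of_right (hF : IsCaratheodoryField F K)
    (hξ : Measurable ξ) (hab : a ≤ b) : ∃ X : ℝ → Z → E,
      (Measurable fun q : ℝ × Z => X q.1 q.2) ∧ (∀ z, Continuous fun t => X t z) ∧
      ∀ z, X b z = ξ z ∧ HasVelocityOn (fun t => X t z) (fun s => -F s z (X s z)) a b := by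
  obtain ⟨X, hXm, hXc, hX⟩ := exists_measurable_hasVelocityOn (hF.reverse (a + b)) hξ hab
  refine ⟨fun t => X (a + b - t),
    hXm.comp ((measurable_const.sub measurable_fst).prodMk measurable_snd),
    fun z => (hXc z).comp (by fun_prop), fun z => ⟨?_, ?_⟩⟩
  · simpa only [add_sub_cancel_right] using (hX z).1
  · simpa only [sub_sub_cancel] using (hX z).2.reverse

end Caratheodory

/-! ### Measurability in the parameter -/

section ParamFDeriv

variable {Z E F : Type*} [NormedAddCommGroup E] [NormedSpace ℝ E] [NormedAddCommGroup F]
  [NormedSpace ℝ F]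

/-- The derivative of `V(·,z)` at `y` in the direction `v`, for `q = (y,z)`, as the limit of a
sequence of difference quotients. Being such a limit, it is measurable in `q` although `V` need
not be differentiable everywhere nor continuous in `z`. -/
noncomputable def paramLineDeriv (V : E × Z → F) (v : E) (q : E × Z) : F :=
  limUnder atTop fun k : ℕ => ((k : ℝ) + 1) • (V (q.1 + ((k : ℝ) + 1)⁻¹ • v, q.2) - V q)

theorem paramLineDeriv_eq {V : E × Z → F} {y : E} {z : Z}
    (hV : DifferentiableAt ℝ (fun y => V (y, z)) y) (v : E) :
    paramLineDeriv V v (y, z) = fderiv ℝ (fun y => V (y, z)) y v :=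
  (hV.hasFDerivAt.lim v (c := fun k : ℕ => (k : ℝ) + 1) (tendsto_norm_atTop_atTop.comp
    (tendsto_natCast_atTop_atTop.atTop_add tendsto_const_nhds))).limUnder_eq

theorem measurable_paramLineDeriv [MeasurableSpace Z] [MeasurableSpace E] [BorelSpace E]
    [CompleteSpace F] [SecondCountableTopology F] [MeasurableSpace F] [BorelSpace F]
    {V : E × Z → F} (hV : Measurable V) (v : E) :
    Measurable (paramLineDeriv V v) :=
  (StronglyMeasurable.limUnder (l := atTop) fun k : ℕ =>
    (((hV.comp ((measurable_fst.add_const (((k : ℝ) + 1)⁻¹ • v)).prodMk measurable_snd)).sub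
      hV).const_smul ((k : ℝ) + 1)).stronglyMeasurable).measurable

variable [FiniteDimensional ℝ E]

/-- The linear map with the values of `paramLineDeriv V` on a basis: a version of the derivative
of `V(·,z)` that is measurable in `(y,z)`. -/
noncomputable def paramFDeriv (V : E × Z → F) (q : E × Z) : E →L[ℝ] F :=
  ∑ i, (LinearMap.toContinuousLinearMap ((Module.finBasis ℝ E).coord i)).smulRight
    (paramLineDeriv V (Module.finBasis ℝ E i) q)

theorem paramFDeriv_eq {V : E × Z → F} {y : E} {z : Z}
    (hV : DifferentiableAt ℝ (fun y => V (y, z)) y) :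
    paramFDeriv V (y, z) = fderiv ℝ (fun y => V (y, z)) y := by
  ext v
  simp only [paramFDeriv, paramLineDeriv_eq hV, sum_apply,
    ContinuousLinearMap.smulRight_apply, LinearMap.coe_toContinuousLinearMap']
  conv_rhs => rw [← (Module.finBasis ℝ E).sum_repr v]
  simp only [map_sum, map_smul, Module.Basis.coord_apply]

variable [MeasurableSpace E] [BorelSpace E] [MeasurableSpace F] [BorelSpace F]

theorem measurable_paramFDeriv [MeasurableSpace Z] [SecondCountableTopology F] [CompleteSpace F]
    {V : E × Z → F} (hV : Measurable V) : Measurable (paramFDeriv V) :=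
  Finset.measurable_sum _ fun i _ =>
    (ContinuousLinearMap.smulRightL ℝ E F (LinearMap.toContinuousLinearMap
      ((Module.finBasis ℝ E).coord i))).continuous.measurable.comp
      (measurable_paramLineDeriv hV _)

theorem measurable_clm_apply {α : Type*} [MeasurableSpace α] {A : α → E →L[ℝ] F} {v : α → E}
    (hA : Measurable A) (hv : Measurable v) : Measurable fun a => A a (v a) :=
  isBoundedBilinearMap_apply.continuous.measurable.comp (hA.prodMk hv)

end ParamFDeriv

section ParamLieBracket

variable {Z E : Type*} [NormedAddCommGroup E] [NormedSpace ℝ E] [FiniteDimensional ℝ E]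

/-- A version of the Lie bracket `[V(·,z), W(·,z)]` that is measurable in `(y,z)`. -/
noncomputable def paramLieBracket (V W : E × Z → E) (q : E × Z) : E :=
  paramFDeriv W q (V q) - paramFDeriv V q (W q)

theorem measurable_paramLieBracket [MeasurableSpace Z] [MeasurableSpace E] [BorelSpace E]
    {V W : E × Z → E} (hV : Measurable V) (hW : Measurable W) :
    Measurable (paramLieBracket V W) :=
  have := FiniteDimensional.complete ℝ E
  (measurable_clm_apply (measurable_paramFDeriv hW) hV).sub
    (measurable_clm_apply (measurable_paramFDeriv hV) hW)

theorem paramLieBracket_eq {V W : E × Z → E} {y : E} {z : Z}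
    (hV : DifferentiableAt ℝ (fun y => V (y, z)) y)
    (hW : DifferentiableAt ℝ (fun y => W (y, z)) y) :
    paramLieBracket V W (y, z) =
      VectorField.lieBracket ℝ (fun y => V (y, z)) (fun y => W (y, z)) y := by
  rw [paramLieBracket, paramFDeriv_eq hV, paramFDeriv_eq hW, VectorField.lieBracket]

theorem paramLieBracket_paramLieBracket_eq {U V W : E × Z → E} {y : E} {z : Z}
    (hU : DifferentiableAt ℝ (fun y => U (y, z)) y)
    (hV : ContDiffAt ℝ 2 (fun y => V (y, z)) y) (hW : ContDiffAt ℝ 2 (fun y => W (y, z)) y) :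
    paramLieBracket U (paramLieBracket V W) (y, z) =
      VectorField.lieBracket ℝ (fun y => U (y, z))
        (VectorField.lieBracket ℝ (fun y => V (y, z)) (fun y => W (y, z))) y := by
  have hinner : (fun y => paramLieBracket V W (y, z)) =ᶠ[𝓝 y]
      VectorField.lieBracket ℝ (fun y => V (y, z)) (fun y => W (y, z)) := by
    filter_upwards [hV.eventually (by simp), hW.eventually (by simp)] with w hVw hWw
    exact paramLieBracket_eq (hVw.differentiableAt (by simp)) (hWw.differentiableAt (by simp))
  have := FiniteDimensional.complete ℝ E
  have hdiff : DifferentiableAt ℝ (fun y => paramLieBracket V W (y, z)) y :=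
    ((ContDiffAt.lieBracket_vectorField hV hW (m := 1) (by norm_num)).differentiableAt
      (by simp)).congr_of_eventuallyEq hinner
  rw [paramLieBracket_eq hU hdiff]
  exact (EventuallyEq.refl _ _).lieBracket_vectorField_eq hinner

end ParamLieBracket

section DerivativeSwap

variable {Z E : Type*} [MeasurableSpace Z] [NormedAddCommGroup E] [NormedSpace ℝ E]

theorem hasDerivAt_iff_forall_rat {y : ℝ → E} (hy : Continuous y) {d : E} {t : ℝ} :
    HasDerivAt y d t ↔ ∀ e : ℚ, 0 < e → ∃ r : ℚ, 0 < r ∧ ∀ s : ℚ, |(s : ℝ)| < r →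
      ‖y (t + s) - y t - (s : ℝ) • d‖ ≤ e * |(s : ℝ)| := by
  rw [hasDerivAt_iff_isLittleO_nhds_zero, Asymptotics.isLittleO_iff]
  constructor
  · intro h e he
    obtain ⟨ρ, hρ, hρ'⟩ := Metric.eventually_nhds_iff.1 (h (c := e) (by exact_mod_cast he))
    obtain ⟨r, hr, hrρ⟩ := exists_rat_btwn hρ
    refine ⟨r, by exact_mod_cast hr, fun s hs => hρ' ?_⟩
    rw [dist_zero_right, Real.norm_eq_abs]
    exact hs.trans hrρ
  · intro h c hc
    obtain ⟨e, he, hec⟩ := exists_rat_btwn hc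
    obtain ⟨r, hr, hr'⟩ := h e (by exact_mod_cast he)
    have hball : Metric.ball (0 : ℝ) r ⊆ {s | ‖y (t + s) - y t - s • d‖ ≤ e * |s|} := by
      refine (Rat.isDenseEmbedding_coe_real.dense.open_subset_closure_inter
        Metric.isOpen_ball).trans (closure_minimal ?_ (isClosed_le (by fun_prop) (by fun_prop)))
      rintro _ ⟨hs, s, rfl⟩
      exact hr' s (by rwa [mem_ball_zero_iff, Real.norm_eq_abs] at hs)
    filter_upwards [Metric.ball_mem_nhds (0 : ℝ) (by exact_mod_cast hr : (0 : ℝ) < r)] with s hs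
    exact (hball hs).trans (by rw [Real.norm_eq_abs]; gcongr)

variable [SecondCountableTopology E] [MeasurableSpace E] [BorelSpace E]

theorem measurableSet_hasDerivAt {X d : ℝ → Z → E} (hX : Measurable fun q : ℝ × Z => X q.1 q.2)
    (hXc : ∀ z, Continuous fun t => X t z) (hd : Measurable fun q : ℝ × Z => d q.1 q.2) :
    MeasurableSet {q : ℝ × Z | HasDerivAt (fun s => X s q.2) (d q.1 q.2) q.1} := by
  have hrat : {q : ℝ × Z | HasDerivAt (fun s => X s q.2) (d q.1 q.2) q.1} =
      ⋂ (e : ℚ) (_ : 0 < e), ⋃ (r : ℚ) (_ : 0 < r), ⋂ (s : ℚ) (_ : |(s : ℝ)| < r),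
        {q | ‖X (q.1 + s) q.2 - X q.1 q.2 - (s : ℝ) • d q.1 q.2‖ ≤ e * |(s : ℝ)|} := by
    ext q
    simp only [mem_ofPred_eq, mem_iInter, mem_iUnion, exists_prop,
      hasDerivAt_iff_forall_rat (hXc q.2)]
  rw [hrat]
  refine .iInter fun e => .iInter fun _ => .iUnion fun r => .iUnion fun _ =>
    .iInter fun s => .iInter fun _ => measurableSet_le (Measurable.norm ?_) measurable_const
  exact ((hX.comp ((measurable_fst.add_const _).prodMk measurable_snd)).sub hX).sub
    (hd.const_smul (s : ℝ))

theorem ae_ae_hasDerivAt_comm {ν : Measure Z} [SFinite ν] {m : Measure ℝ} [SFinite m]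
    {X d : ℝ → Z → E} (hX : Measurable fun q : ℝ × Z => X q.1 q.2)
    (hXc : ∀ z, Continuous fun t => X t z) (hd : Measurable fun q : ℝ × Z => d q.1 q.2)
    (h : ∀ᵐ z ∂ν, ∀ᵐ t ∂m, HasDerivAt (fun s => X s z) (d t z) t) :
    ∀ᵐ t ∂m, ∀ᵐ z ∂ν, HasDerivAt (fun s => X s z) (d t z) t :=
  (Measure.ae_ae_comm (p := fun t z => HasDerivAt (fun s => X s z) (d t z) t)
    (measurableSet_hasDerivAt hX hXc hd)).2 h

end DerivativeSwap

section MeanVelocity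

variable {a b : ℝ}

theorem ae_eq_zero_of_ae_integral_eq_zero {E : Type*} [NormedAddCommGroup E] [NormedSpace ℝ E]
    [CompleteSpace E] {κ : ℝ → E} {c : ℝ} (hκ : IntegrableOn κ (Icc a b)) (hc : c ∈ Icc a b)
    (hzero : ∀ᵐ t ∂volume.restrict (Icc a b), ∫ r in c..t, κ r = 0) :
    ∀ᵐ t ∂volume.restrict (Icc a b), κ t = 0 := by
  have hab : a ≤ b := hc.1.trans hc.2
  have hκ' : IntervalIntegrable κ volume a b :=
    (intervalIntegrable_iff_integrableOn_Icc_of_le hab).2 hκ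
  have hcont : ContinuousOn (fun t => ∫ r in c..t, κ r) (Icc a b) := by
    have := intervalIntegral.continuousOn_primitive_interval' hκ' (by rwa [uIcc_of_le hab])
    rwa [uIcc_of_le hab] at this
  have hprim : EqOn (fun t => ∫ r in c..t, κ r) 0 (Ioo a b) :=
    Measure.eqOn_open_of_ae_eq (μ := volume)
      (ae_restrict_of_ae_restrict_of_subset Ioo_subset_Icc_self hzero) isOpen_Ioo
      (hcont.mono Ioo_subset_Icc_self) continuousOn_const
  filter_upwards [ae_restrict_of_ae (s := Icc a b) hκ'.ae_hasDerivAt_integral,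
    ae_restrict_Icc_mem_Ioo a b] with t hderiv ht
  rw [uIcc_of_le hab] at hderiv
  have hnear : (fun t => ∫ r in c..t, κ r) =ᶠ[𝓝 t] fun _ => 0 :=
    eventually_of_mem (Ioo_mem_nhds ht.1 ht.2) hprim
  exact ((hderiv (Ioo_subset_Icc_self ht) c hc).congr_of_eventuallyEq hnear.symm).unique
    (hasDerivAt_const t 0)

variable {Ω E : Type*} [MeasurableSpace Ω] {μ : Measure Ω} [SFinite μ] [NormedAddCommGroup E]
  [NormedSpace ℝ E] {h k : ℝ → Ω → E}

theorem integral_sub_eq_integral_integral_velocity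
    (hvel : ∀ᵐ ω ∂μ, HasVelocityOn (fun t => h t ω) (fun t => k t ω) a b)
    (hh : ∀ t ∈ Icc a b, Integrable (h t) μ)
    (hk : Integrable (fun q : ℝ × Ω => k q.1 q.2) ((volume.restrict (Icc a b)).prod μ))
    {s t : ℝ} (hs : s ∈ Icc a b) (ht : t ∈ Icc a b) :
    ∫ r in s..t, ∫ ω, k r ω ∂μ = ∫ ω, h t ω ∂μ - ∫ ω, h s ω ∂μ := by
  have hsub : uIoc s t ⊆ Icc a b := uIoc_subset_uIcc.trans (uIcc_subset_Icc hs ht)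
  rw [← integral_sub (hh t ht) (hh s hs), intervalIntegral_integral_swap
    (hk.mono_measure (Measure.prod_mono (Measure.restrict_mono_set _ hsub) le_rfl))]
  exact integral_congr_ae (hvel.mono fun ω hω => hω.integral_eq_sub hs ht)

theorem ae_integral_velocity_eq_zero [CompleteSpace E] (hab : a < b)
    (hvel : ∀ᵐ ω ∂μ, HasVelocityOn (fun t => h t ω) (fun t => k t ω) a b)
    (hh : ∀ t ∈ Icc a b, Integrable (h t) μ)
    (hk : Integrable (fun q : ℝ × Ω => k q.1 q.2) ((volume.restrict (Icc a b)).prod μ))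
    (hzero : ∀ᵐ t ∂volume.restrict (Icc a b), ∫ ω, h t ω ∂μ = 0) :
    ∀ᵐ t ∂volume.restrict (Icc a b), ∫ ω, k t ω ∂μ = 0 := by
  obtain ⟨c, hc, hc₀⟩ := exists_mem_Icc_of_ae hab hzero
  refine ae_eq_zero_of_ae_integral_eq_zero hk.integral_prod_left hc ?_
  filter_upwards [hzero, ae_restrict_mem measurableSet_Icc] with t ht₀ ht
  rw [integral_sub_eq_integral_integral_velocity hvel hh hk hc ht, ht₀, hc₀, sub_zero]

end MeanVelocity

/-! ### The state equation -/

theorem IsCaratheodoryField.comp_param {Z Z' E : Type*} [MeasurableSpace Z] [MeasurableSpace Z']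
    [NormedAddCommGroup E] [MeasurableSpace E] {F : ℝ → Z → E → E} {K : ℝ}
    (hF : IsCaratheodoryField F K) {π : Z' → Z} (hπ : Measurable π) :
    IsCaratheodoryField (fun t z => F t (π z)) K where
  measurable := hF.measurable.comp (measurable_fst.prodMk
    ((hπ.comp (measurable_fst.comp measurable_snd)).prodMk
      (measurable_snd.comp measurable_snd)))
  pos := hF.pos
  lipschitz t z := hF.lipschitz t (π z)
  bounded_zero z := hF.bounded_zero (π z)

theorem norm_add_sum_smul_le {m : ℕ} {E : Type*} [NormedAddCommGroup E] [NormedSpace ℝ E]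
    {v : Fin (m + 1) → E} {A : ℝ} (hv : ∀ i, ‖v i‖ ≤ A) (w : Fin m → ℝ) :
    ‖v 0 + ∑ j, w j • v j.succ‖ ≤ (1 + ∑ j, |w j|) * A := by
  rw [add_mul, one_mul, Finset.sum_mul]
  refine norm_add_le_of_le (hv 0) (norm_sum_le_of_le _ fun j _ => ?_)
  rw [norm_smul, Real.norm_eq_abs]
  exact mul_le_mul_of_nonneg_left (hv j.succ) (abs_nonneg _)

namespace Problem

variable {n m : ℕ} {Ω : Type*} [MeasurableSpace Ω] {P : Problem n m Ω}
  {u v : ℝ → Fin m → ℝ} {ω : Ω} {K : ℝ}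

/-- A common constant `K` for the growth and Lipschitz estimates on the fields `fᵢ`, on the
dynamics for controls in the box, and on the cost. -/
structure HasBound (P : Problem n m Ω) (K : ℝ) : Prop where
  pos : 0 < K
  f_lipschitz : ∀ i x x' ω, ‖P.f i x ω - P.f i x' ω‖ ≤ K * ‖x - x'‖
  f_growth : ∀ i x ω, ‖P.f i x ω‖ ≤ K * (1 + ‖x‖)
  dyn_lipschitz : ∀ w ∈ P.box, ∀ x x' ω, ‖P.dyn x w ω - P.dyn x' w ω‖ ≤ K * ‖x - x'‖
  dyn_growth : ∀ w ∈ P.box, ∀ x ω, ‖P.dyn x w ω‖ ≤ K * (1 + ‖x‖)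
  g_lipschitz : ∀ x x' ω, |P.g x ω - P.g x' ω| ≤ K * ‖x - x'‖

theorem abs_le_of_mem_box {w : Fin m → ℝ} (hw : w ∈ P.box) (j : Fin m) :
    |w j| ≤ |P.umin j| + |P.umax j| :=
  (abs_le_max_abs_abs (hw.1 j) (hw.2 j)).trans
    (max_le_add_of_nonneg (abs_nonneg _) (abs_nonneg _))

theorem dyn_sub_dyn_state (x x' : State n) (w : Fin m → ℝ) (ω : Ω) :
    P.dyn x w ω - P.dyn x' w ω = (P.f 0 x ω - P.f 0 x' ω) +
      ∑ j, w j • (P.f j.succ x ω - P.f j.succ x' ω) := by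
  simp only [dyn, smul_sub, Finset.sum_sub_distrib]
  abel

theorem H0.exists_hasBound (h0 : P.H0) : ∃ K, P.HasBound K := by
  choose c hc hgrowth using h0.f_growth
  choose k hk hlip using h0.f_lipschitz
  obtain ⟨kg, hkg, hglip⟩ := h0.g_lipschitz
  let R := ∑ j, (|P.umin j| + |P.umax j|)
  let L := ∑ i, (c i + k i) + kg
  have hR : 0 ≤ R := Finset.sum_nonneg fun j _ => by positivity
  have hsum : ∀ w ∈ P.box, ∑ j, |w j| ≤ R := fun w hw =>
    Finset.sum_le_sum fun j _ => abs_le_of_mem_box hw j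
  have hL : ∀ i, c i + k i ≤ L := fun i =>
    (Finset.single_le_sum (f := fun i => c i + k i) (fun i _ => (add_pos (hc i) (hk i)).le)
      (Finset.mem_univ i)).trans (le_add_of_nonneg_right (zero_le_one.trans hkg))
  have hkgL : kg ≤ L := le_add_of_nonneg_left
    (Finset.sum_nonneg fun i _ => (add_pos (hc i) (hk i)).le)
  have hL₀ : 0 < L := by linarith
  have hLK : L ≤ (1 + R) * L := le_mul_of_one_le_left hL₀.le (by linarith)
  have hf : ∀ i x ω, ‖P.f i x ω‖ ≤ L * (1 + ‖x‖) := fun i x ω =>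
    (hgrowth i x ω).trans (by gcongr; linarith [hL i, hk i])
  have hf' : ∀ i x x' ω, ‖P.f i x ω - P.f i x' ω‖ ≤ L * ‖x - x'‖ := fun i x x' ω =>
    (hlip i x x' ω).trans (by gcongr; linarith [hL i, hc i])
  refine ⟨(1 + R) * L, hL₀.trans_le hLK, fun i x x' ω => (hf' i x x' ω).trans (by gcongr),
    fun i x ω => (hf i x ω).trans (by gcongr), fun w hw x x' ω => ?_, fun w hw x ω => ?_,
    fun x x' ω => (hglip x x' ω).trans (by gcongr; exact hkgL.trans hLK)⟩
  · rw [dyn_sub_dyn_state, mul_assoc]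
    refine (norm_add_sum_smul_le (v := fun i => P.f i x ω - P.f i x' ω)
      (fun i => hf' i x x' ω) w).trans ?_
    gcongr
    exact hsum w hw
  · rw [mul_assoc]
    refine (norm_add_sum_smul_le (v := fun i => P.f i x ω) (fun i => hf i x ω) w).trans ?_
    gcongr
    exact hsum w hw

/-- Everywhere defined representatives of admissible controls: Borel functions with values in the
box at all times. -/
structure IsBoxControl (P : Problem n m Ω) (u : ℝ → Fin m → ℝ) : Prop where
  measurable : Measurable u
  mem : ∀ t, u t ∈ P.box

theorem IsControl.exists_isBoxControl (hu : P.IsControl u) (ht : P.t₀ < P.T) :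
    ∃ u', P.IsBoxControl u' ∧ u' =ᵐ[volume.restrict (Icc P.t₀ P.T)] u := by
  obtain ⟨hLp, hmem⟩ := hu
  obtain ⟨s, -, hs⟩ := exists_mem_Icc_of_ae ht hmem
  have hbox : P.umin ≤ P.umax := hs.1.trans hs.2
  have hw := hLp.aestronglyMeasurable.stronglyMeasurable_mk.measurable
  refine ⟨fun t j => max (P.umin j) (min (P.umax j) (hLp.aestronglyMeasurable.mk u t j)),
    ⟨measurable_pi_lambda _ fun j => measurable_const.max
      (measurable_const.min ((measurable_pi_apply j).comp hw)),
    fun t => ⟨fun j => le_max_left _ _, fun j => max_le (hbox j) (min_le_left _ _)⟩⟩, ?_⟩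
  filter_upwards [hLp.aestronglyMeasurable.ae_eq_mk, hmem] with t ht htb
  funext j
  rw [← ht, min_eq_right (htb.2 j), max_eq_right (htb.1 j)]

theorem IsBoxControl.isControl (hu : P.IsBoxControl u) : P.IsControl u :=
  ⟨memLp_top_of_bound hu.measurable.aestronglyMeasurable (∑ i, (|P.umin i| + |P.umax i|))
    (Eventually.of_forall fun t => (pi_norm_le_iff_of_nonneg
      (Finset.sum_nonneg fun i _ => by positivity)).2 fun j =>
        (abs_le_of_mem_box (hu.mem t) j).trans (Finset.single_le_sum
          (f := fun i => |P.umin i| + |P.umax i|) (fun i _ => by positivity)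
          (Finset.mem_univ j))),
    Eventually.of_forall hu.mem⟩

theorem measurable_dyn (h0 : P.H0) :
    Measurable fun q : State n × (Fin m → ℝ) × Ω => P.dyn q.1 q.2.1 q.2.2 := by
  have hf : ∀ i, Measurable fun q : State n × (Fin m → ℝ) × Ω => P.f i q.1 q.2.2 := fun i =>
    (h0.f_measurable i).comp (measurable_fst.prodMk (measurable_snd.comp measurable_snd))
  exact (hf 0).add (Finset.measurable_sum _ fun j _ =>
    ((measurable_pi_apply j).comp (measurable_fst.comp measurable_snd)).smul (hf j.succ))

theorem IsBoxControl.isCaratheodoryField (hu : P.IsBoxControl u) (hK : P.HasBound K)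
    (h0 : P.H0) : IsCaratheodoryField (fun t ω y => P.dyn y (u t) ω) K where
  measurable := (measurable_dyn h0).comp ((measurable_snd.comp measurable_snd).prodMk
    ((hu.measurable.comp measurable_fst).prodMk (measurable_fst.comp measurable_snd)))
  pos := hK.pos
  lipschitz t ω y y' := hK.dyn_lipschitz _ (hu.mem t) y y' ω
  bounded_zero ω := ⟨K, fun t => by simpa using hK.dyn_growth _ (hu.mem t) 0 ω⟩

/-- The arc `y` solves the state equation for the control `u` and the parameter `ω`. -/
abbrev IsArc (P : Problem n m Ω) (u : ℝ → Fin m → ℝ) (ω : Ω) (y : ℝ → State n) : Prop :=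
  HasVelocityOn y (fun s => P.dyn (y s) (u s) ω) P.t₀ P.T

theorem IsBoxControl.isArc_of_eq_add_integral (hu : P.IsBoxControl u) (hK : P.HasBound K)
    (h0 : P.H0) (ht : P.t₀ ≤ P.T) {y : ℝ → State n} {ξ : State n}
    (hy : ContinuousOn y (Icc P.t₀ P.T))
    (heq : ∀ t ∈ Icc P.t₀ P.T, y t = ξ + ∫ s in P.t₀..t, P.dyn (y s) (u s) ω) :
    y P.t₀ = ξ ∧ P.IsArc u ω y := by
  have hξ : y P.t₀ = ξ := by
    rw [heq _ (left_mem_Icc.2 ht), intervalIntegral.integral_same, add_zero]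
  obtain ⟨D, hD⟩ := isCompact_Icc.exists_bound_of_continuousOn hy
  exact ⟨hξ, (hu.isCaratheodoryField hK h0).integrableOn ω
    (hy.aestronglyMeasurable measurableSet_Icc) hD, fun t htm => hξ ▸ heq t htm⟩

theorem IsBoxControl.exists_flow (hu : P.IsBoxControl u) (hK : P.HasBound K) (h0 : P.H0)
    (ht : P.t₀ ≤ P.T) :
    ∃ Y : ℝ → Ω × State n → State n, (Measurable fun q : ℝ × Ω × State n => Y q.1 q.2) ∧
      (∀ z, Continuous fun t => Y t z) ∧
      ∀ z, Y P.t₀ z = z.2 ∧ P.IsArc u z.1 fun t => Y t z :=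
  exists_measurable_hasVelocityOn
    ((hu.isCaratheodoryField hK h0).comp_param measurable_fst) measurable_snd ht

/-- The family of arcs `y` solves the state equation with the initial datum of `P`. -/
abbrev IsState (P : Problem n m Ω) (u : ℝ → Fin m → ℝ) (y : ℝ → Ω → State n) : Prop :=
  ∀ ω, y P.t₀ ω = P.φ ω ∧ P.IsArc u ω fun t => y t ω

theorem IsBoxControl.exists_isState (hu : P.IsBoxControl u) (hK : P.HasBound K) (h0 : P.H0)
    (ht : P.t₀ ≤ P.T) : ∃ y, P.IsState u y :=
  let ⟨Y, _, _, hY⟩ := hu.exists_flow hK h0 ht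
  ⟨fun t ω => Y t (ω, P.φ ω), fun ω => hY (ω, P.φ ω)⟩

theorem IsBoxControl.isAdmissible (hu : P.IsBoxControl u) {y : ℝ → Ω → State n}
    (hy : P.IsState u y) : P.IsAdmissible u y :=
  ⟨hu.isControl, fun ω => ⟨(hy ω).2.continuousOn, fun t ht => (hy ω).1 ▸ (hy ω).2.eq_add t ht⟩⟩

theorem IsAdmissible.isState {y : ℝ → Ω → State n} (hy : P.IsAdmissible v y)
    (huv : u =ᵐ[volume.restrict (Icc P.t₀ P.T)] v) (hu : P.IsBoxControl u) (h0 : P.H0)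
    (ht : P.t₀ ≤ P.T) : P.IsState u y := by
  obtain ⟨K, hK⟩ := h0.exists_hasBound
  refine fun ω => hu.isArc_of_eq_add_integral hK h0 ht (hy.2 ω).1 fun t ht' => ?_
  rw [(hy.2 ω).2 t ht', add_right_inj]
  refine intervalIntegral.integral_congr_ae_restrict ?_
  rw [uIoc_of_le ht'.1]
  have hsub : Ioc P.t₀ t ⊆ Icc P.t₀ P.T :=
    (Ioc_subset_Icc_self).trans (Icc_subset_Icc_right ht'.2)
  filter_upwards [ae_restrict_of_ae_restrict_of_subset hsub huv] with s hs
  rw [hs]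

section Estimates

variable {x y : ℝ → State n} {t : ℝ}

theorem IsArc.norm_le (hx : P.IsArc u ω x) (hK : P.HasBound K) (hu : P.IsBoxControl u)
    (ht : t ∈ Icc P.t₀ P.T) :
    ‖x t‖ ≤ (‖x P.t₀‖ + K * (P.T - P.t₀)) * Real.exp (K * (P.T - P.t₀)) := by
  have hKpos := hK.pos
  have hT : 0 ≤ P.T - P.t₀ := sub_nonneg.2 (ht.1.trans ht.2)
  refine (hx.norm_le_mul_exp hKpos.le hKpos.le (Eventually.of_forall fun s => ?_) ht).trans ?_
  · exact (hK.dyn_growth _ (hu.mem s) _ _).trans_eq (by ring)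
  · gcongr
    exact ht.2

theorem HasBound.exists_one_add_norm_le (hK : P.HasBound K) (hT : P.t₀ ≤ P.T) :
    ∃ C, 0 < C ∧ ∀ {u : ℝ → Fin m → ℝ} {ω : Ω} {x : ℝ → State n}, P.IsBoxControl u →
      P.IsArc u ω x → ∀ t ∈ Icc P.t₀ P.T, 1 + ‖x t‖ ≤ C * (1 + ‖x P.t₀‖) := by
  have hKT : 0 ≤ K * (P.T - P.t₀) := mul_nonneg hK.pos.le (sub_nonneg.2 hT)
  refine ⟨1 + (1 + K * (P.T - P.t₀)) * Real.exp (K * (P.T - P.t₀)), by positivity,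
    fun {u ω x} hu hx t ht => ?_⟩
  have hξ : ‖x P.t₀‖ + K * (P.T - P.t₀) ≤ (1 + K * (P.T - P.t₀)) * (1 + ‖x P.t₀‖) := by
    nlinarith [norm_nonneg (x P.t₀)]
  calc 1 + ‖x t‖ ≤ (1 + ‖x P.t₀‖) + (1 + K * (P.T - P.t₀)) * (1 + ‖x P.t₀‖) *
        Real.exp (K * (P.T - P.t₀)) := by
        refine add_le_add (le_add_of_nonneg_right (norm_nonneg _)) ((hx.norm_le hK hu ht).trans ?_)
        gcongr
    _ = _ := by ring

end Estimates

/-- The control `u + l (v - u)`. -/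
def mix (u v : ℝ → Fin m → ℝ) (l : ℝ) (t : ℝ) : Fin m → ℝ := u t + l • (v t - u t)

theorem IsBoxControl.mix (hu : P.IsBoxControl u) (hv : P.IsBoxControl v) {l : ℝ}
    (hl : l ∈ Icc (0 : ℝ) 1) : P.IsBoxControl (mix u v l) :=
  ⟨hu.measurable.add ((hv.measurable.sub hu.measurable).const_smul l), fun t =>
    (convex_Icc P.umin P.umax).add_smul_sub_mem (hu.mem t) (hv.mem t) hl⟩

theorem dyn_mix (u v : ℝ → Fin m → ℝ) (l t : ℝ) (y : State n) (ω : Ω) :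
    P.dyn y (mix u v l t) ω =
      P.dyn y (u t) ω + l • (P.dyn y (v t) ω - P.dyn y (u t) ω) := by
  simp only [dyn, mix, Pi.add_apply, Pi.smul_apply, Pi.sub_apply, smul_eq_mul, add_smul, sub_smul,
    Finset.sum_add_distrib, Finset.sum_sub_distrib, smul_sub, smul_add, Finset.smul_sum,
    mul_smul]
  abel

section Variation

variable {x y : ℝ → State n} {l : ℝ}

theorem norm_dyn_mix_sub_le (hK : P.HasBound K) (hu : P.IsBoxControl u) (hv : P.IsBoxControl v)
    (hl : l ∈ Icc (0 : ℝ) 1) (s : ℝ) (x y : State n) :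
    ‖P.dyn y (mix u v l s) ω - P.dyn x (u s) ω‖ ≤ K * ‖y - x‖ + l * (2 * K * (1 + ‖x‖)) := by
  have hsplit : P.dyn y (mix u v l s) ω - P.dyn x (u s) ω =
      (P.dyn y (mix u v l s) ω - P.dyn x (mix u v l s) ω) +
        l • (P.dyn x (v s) ω - P.dyn x (u s) ω) := by
    rw [dyn_mix u v l s x]
    abel
  rw [hsplit]
  refine norm_add_le_of_le (hK.dyn_lipschitz _ ((hu.mix hv hl).mem s) _ _ _) ?_
  rw [norm_smul, Real.norm_of_nonneg hl.1]
  refine mul_le_mul_of_nonneg_left ?_ hl.1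
  exact (norm_sub_le_of_le (hK.dyn_growth _ (hv.mem s) x ω)
    (hK.dyn_growth _ (hu.mem s) x ω)).trans_eq (by ring)

theorem HasBound.exists_norm_sub_le_of_mix (hK : P.HasBound K) (hT : P.t₀ ≤ P.T) :
    ∃ C, 0 ≤ C ∧ ∀ {u v : ℝ → Fin m → ℝ}, P.IsBoxControl u → P.IsBoxControl v →
      ∀ {l : ℝ}, l ∈ Icc (0 : ℝ) 1 → ∀ {ω : Ω} {x y : ℝ → State n}, P.IsArc u ω x →
      P.IsArc (Problem.mix u v l) ω y → y P.t₀ = x P.t₀ → ∀ t ∈ Icc P.t₀ P.T,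
        ‖y t - x t‖ ≤ l * (C * (1 + ‖x P.t₀‖)) ∧
        ‖P.dyn (y t) (Problem.mix u v l t) ω - P.dyn (x t) (u t) ω‖ ≤
          l * (C * (1 + ‖x P.t₀‖)) := by
  have hKpos := hK.pos
  have : 0 ≤ P.T - P.t₀ := sub_nonneg.2 hT
  obtain ⟨C, hC, hCx⟩ := hK.exists_one_add_norm_le hT
  let D := 2 * K * C * (P.T - P.t₀) * Real.exp (K * (P.T - P.t₀))
  have hD : 0 ≤ D := by positivity
  refine ⟨max D (K * D + 2 * K * C), hD.trans (le_max_left _ _),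
    fun {u v} hu hv {l} hl {ω x y} hx hy hinit t ht => ?_⟩
  have hl₀ := hl.1
  have hvel : ∀ s ∈ Icc P.t₀ P.T, ‖P.dyn (y s) (Problem.mix u v l s) ω - P.dyn (x s) (u s) ω‖ ≤
      K * ‖y s - x s‖ + l * (2 * K * (C * (1 + ‖x P.t₀‖))) := fun s hs =>
    (norm_dyn_mix_sub_le hK hu hv hl s (x s) (y s)).trans (by gcongr; exact hCx hu hx s hs)
  have hdiff : ‖y t - x t‖ ≤ l * (D * (1 + ‖x P.t₀‖)) := by
    refine ((hy.sub hx).norm_le_mul_exp hKpos.le (by positivity)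
      ((ae_restrict_mem measurableSet_Icc).mono hvel) ht).trans ?_
    rw [hinit, sub_self, norm_zero, zero_add]
    calc _ ≤ l * (2 * K * (C * (1 + ‖x P.t₀‖))) * (P.T - P.t₀) *
          Real.exp (K * (P.T - P.t₀)) := by gcongr; exact ht.2
      _ = l * (D * (1 + ‖x P.t₀‖)) := by ring
  refine ⟨hdiff.trans (by gcongr; exact le_max_left _ _), (hvel t ht).trans ?_⟩
  calc K * ‖y t - x t‖ + l * (2 * K * (C * (1 + ‖x P.t₀‖)))
      ≤ K * (l * (D * (1 + ‖x P.t₀‖))) + l * (2 * K * (C * (1 + ‖x P.t₀‖))) := by gcongr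
    _ = l * ((K * D + 2 * K * C) * (1 + ‖x P.t₀‖)) := by ring
    _ ≤ _ := by gcongr; exact le_max_right _ _

end Variation

end Problem

/-! ### Lie brackets and regularity along the arcs -/

section LieBracketEstimates

variable {E : Type*} [NormedAddCommGroup E] [NormedSpace ℝ E]

open VectorField

theorem norm_lieBracket_le {V W : E → E} {y : E} {k A l B : ℝ} (hV : ‖fderiv ℝ V y‖ ≤ k)
    (hVA : ‖V y‖ ≤ A) (hW : ‖fderiv ℝ W y‖ ≤ l) (hWA : ‖W y‖ ≤ B) :
    ‖lieBracket ℝ V W y‖ ≤ l * A + k * B :=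
  norm_sub_le_of_le ((fderiv ℝ W y).le_of_opNorm_le_of_le hW hVA)
    ((fderiv ℝ V y).le_of_opNorm_le_of_le hV hWA)

theorem differentiableAt_fderiv_of_contDiffAt_two {V : E → E} {y : E}
    (hV : ContDiffAt ℝ 2 V y) : DifferentiableAt ℝ (fderiv ℝ V) y :=
  (hV.fderiv_right (m := 1) (by norm_num)).differentiableAt (by simp)

theorem norm_fderiv_fderiv_apply_le {V W : E → E} {y : E} {k A l C : ℝ}
    (hV : DifferentiableAt ℝ V y) (hW : DifferentiableAt ℝ (fderiv ℝ W) y)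
    (hVk : ‖fderiv ℝ V y‖ ≤ k) (hVA : ‖V y‖ ≤ A) (hWl : ‖fderiv ℝ W y‖ ≤ l)
    (hWC : ‖fderiv ℝ (fderiv ℝ W) y‖ ≤ C) :
    ‖fderiv ℝ (fun z => fderiv ℝ W z (V z)) y‖ ≤ l * k + C * A := by
  rw [fderiv_clm_apply hW hV]
  refine norm_add_le_of_le ((ContinuousLinearMap.opNorm_comp_le _ _).trans ?_)
    (ContinuousLinearMap.le_of_opNorm_le_of_le _ ?_ hVA)
  · exact mul_le_mul hWl hVk (norm_nonneg _) ((norm_nonneg _).trans hWl)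
  · rwa [ContinuousLinearMap.opNorm_flip]

theorem norm_lieBracket_lieBracket_le {U V W : E → E} {y : E} {k A C : ℝ}
    (hV : ContDiffAt ℝ 2 V y) (hW : ContDiffAt ℝ 2 W y)
    (hUk : ‖fderiv ℝ U y‖ ≤ k) (hVk : ‖fderiv ℝ V y‖ ≤ k) (hWk : ‖fderiv ℝ W y‖ ≤ k)
    (hUA : ‖U y‖ ≤ A) (hVA : ‖V y‖ ≤ A) (hWA : ‖W y‖ ≤ A)
    (hVC : ‖fderiv ℝ (fderiv ℝ V) y‖ ≤ C) (hWC : ‖fderiv ℝ (fderiv ℝ W) y‖ ≤ C) :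
    ‖lieBracket ℝ U (lieBracket ℝ V W) y‖ ≤
      (k * k + C * A + (k * k + C * A)) * A + k * (k * A + k * A) := by
  have hVd : DifferentiableAt ℝ V y := hV.differentiableAt (by simp)
  have hWd : DifferentiableAt ℝ W y := hW.differentiableAt (by simp)
  have hV' := differentiableAt_fderiv_of_contDiffAt_two hV
  have hW' := differentiableAt_fderiv_of_contDiffAt_two hW
  refine norm_lieBracket_le hUk hUA ?_ (norm_lieBracket_le hVk hVA hWk hWA)
  change ‖fderiv ℝ (fun z => fderiv ℝ W z (V z) - fderiv ℝ V z (W z)) y‖ ≤ _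
  rw [fderiv_fun_sub (hW'.clm_apply hVd) (hV'.clm_apply hWd)]
  exact norm_sub_le_of_le (norm_fderiv_fderiv_apply_le hVd hW' hVk hVA hWk hWC)
    (norm_fderiv_fderiv_apply_le hWd hV' hWk hWA hVk hVC)

theorem hasDerivAt_inner_lieBracket {E : Type*} [NormedAddCommGroup E] [InnerProductSpace ℝ E]
    [CompleteSpace E] {D G : E → E} {p x : ℝ → E} {t : ℝ} (hG : DifferentiableAt ℝ G (x t))
    (hx : HasDerivAt x (D (x t)) t)
    (hp : HasDerivAt p (-(ContinuousLinearMap.adjoint (fderiv ℝ D (x t)) (p t))) t) :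
    HasDerivAt (fun s => inner ℝ (p s) (G (x s))) (inner ℝ (p t) (lieBracket ℝ D G (x t))) t := by
  refine (hp.inner ℝ (hG.hasFDerivAt.comp_hasDerivAt t hx)).congr_deriv ?_
  rw [lieBracket_eq]
  simp only [Function.comp_apply, inner_neg_left, ContinuousLinearMap.adjoint_inner_left,
    inner_sub_right]
  ring

end LieBracketEstimates

theorem frequently_nhdsWithin_of_ae {a b : ℝ} (hab : a < b) {q : ℝ → Prop}
    (hq : ∀ᵐ s ∂volume.restrict (Icc a b), q s) {t : ℝ} (ht : t ∈ Icc a b) :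
    ∃ᶠ s in 𝓝[Icc a b] t, q s := by
  have hdense := (Measure.dense_of_ae ((ae_restrict_iff' measurableSet_Icc).1
    hq)).open_subset_closure_inter (isOpen_Ioo (a := a) (b := b))
  rw [← closure_Ioo hab.ne] at ht
  refine frequently_nhdsWithin_iff.2 ((mem_closure_iff_frequently.1
    (closure_minimal hdense isClosed_closure ht)).mono fun s hs => ?_)
  exact ⟨hs.2 (Ioo_subset_Icc_self hs.1), Ioo_subset_Icc_self hs.1⟩

namespace Problem

variable {n m : ℕ} {Ω : Type*} [MeasurableSpace Ω] {P : Problem n m Ω} {K : ℝ} {ω : Ω}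
  {y : State n}

theorem HasBound.norm_fderiv_f_le (hK : P.HasBound K) (i : Fin (m + 1)) (ω : Ω) (y : State n) :
    ‖fderiv ℝ (fun y => P.f i y ω) y‖ ≤ K :=
  norm_fderiv_le_of_lip' ℝ hK.pos.le (Eventually.of_forall fun y' => hK.f_lipschitz i y' y ω)

theorem HasBound.norm_fderiv_dyn_le (hK : P.HasBound K) {w : Fin m → ℝ} (hw : w ∈ P.box)
    (ω : Ω) (y : State n) : ‖fderiv ℝ (fun y => P.dyn y w ω) y‖ ≤ K :=
  norm_fderiv_le_of_lip' ℝ hK.pos.le (Eventually.of_forall fun y' => hK.dyn_lipschitz w hw y' y ω)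

theorem HasBound.norm_gradient_le (hK : P.HasBound K) (ω : Ω) (y : State n) :
    ‖gradient (fun z => P.g z ω) y‖ ≤ K := by
  rw [gradient, LinearIsometryEquiv.norm_map]
  exact norm_fderiv_le_of_lip' ℝ hK.pos.le
    (Eventually.of_forall fun y' => hK.g_lipschitz y' y ω)

theorem differentiableAt_dyn (h : ∀ i, DifferentiableAt ℝ (fun y => P.f i y ω) y)
    (w : Fin m → ℝ) : DifferentiableAt ℝ (fun y => P.dyn y w ω) y :=
  (h 0).add (DifferentiableAt.fun_sum fun j _ => (h j.succ).const_smul (w j))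

theorem lieBracket_dyn (h : ∀ i, DifferentiableAt ℝ (fun y => P.f i y ω) y) (w : Fin m → ℝ)
    (G : State n → State n) :
    VectorField.lieBracket ℝ (fun y => P.dyn y w ω) G y =
      VectorField.lieBracket ℝ (fun y => P.f 0 y ω) G y +
        ∑ j, w j • VectorField.lieBracket ℝ (fun y => P.f j.succ y ω) G y := by
  have hfderiv : fderiv ℝ (fun y => P.dyn y w ω) y = fderiv ℝ (fun y => P.f 0 y ω) y +
      ∑ j, w j • fderiv ℝ (fun y => P.f j.succ y ω) y :=
    ((h 0).hasFDerivAt.add (HasFDerivAt.fun_sum (u := Finset.univ)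
      fun j _ => (h (Fin.succ j)).hasFDerivAt.const_smul (w j))).fderiv
  simp only [VectorField.lieBracket_eq]
  rw [hfderiv]
  simp only [dyn, map_add, map_sum, map_smul, smul_sub, Finset.sum_sub_distrib, add_apply,
    sum_apply, smul_apply]
  abel

/-- The regularity along the reference arcs that the necessary conditions rest on, for almost
every parameter. -/
structure IsRegularAlong (P : Problem n m Ω) (x : ℝ → Ω → State n) : Prop where
  f_contDiffAt : ∀ᵐ ω ∂P.μ, ∀ t ∈ Icc P.t₀ P.T, ∀ i, ContDiffAt ℝ 2 (fun y => P.f i y ω) (x t ω)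
  exists_norm_fderiv_fderiv_le : ∃ C, ∀ᵐ ω ∂P.μ, ∀ t ∈ Icc P.t₀ P.T, ∀ i,
    ‖fderiv ℝ (fderiv ℝ fun y => P.f i y ω) (x t ω)‖ ≤ C
  g_differentiableAt : ∀ᵐ ω ∂P.μ, DifferentiableAt ℝ (fun y => P.g y ω) (x P.T ω)

/-- The controlled fields commute near the reference arcs, for almost every parameter. -/
def CommutesAlong (P : Problem n m Ω) (x : ℝ → Ω → State n) : Prop :=
  ∀ᵐ ω ∂P.μ, ∀ t ∈ Icc P.t₀ P.T, ∀ i j : Fin m,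
    VectorField.lieBracket ℝ (fun y => P.f i.succ y ω) (fun y => P.f j.succ y ω)
      =ᶠ[𝓝 (x t ω)] 0

theorem IsRegularAlong.differentiableAt_f {x : ℝ → Ω → State n} (hx : P.IsRegularAlong x) :
    ∀ᵐ ω ∂P.μ, ∀ t ∈ Icc P.t₀ P.T, ∀ i, DifferentiableAt ℝ (fun y => P.f i y ω) (x t ω) := by
  filter_upwards [hx.f_contDiffAt] with ω h t ht i
  exact (h t ht i).differentiableAt (by simp)

theorem Commuting.commutesAlong {x : ℝ → Ω → State n} {δ : ℝ} (h : P.Commuting x δ)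
    (hδ : 0 < δ) : P.CommutesAlong x :=
  Eventually.of_forall fun ω t ht i j =>
    mem_of_superset (Metric.ball_mem_nhds (x t ω) hδ) (h i j ω t ht)

section Tubes

variable [PseudoMetricSpace Ω] {x : ℝ → Ω → State n} {δ t : ℝ}

theorem H1.contDiffAt (h1 : P.H1 x δ) (hδ : 0 < δ) (hT : P.t₀ < P.T)
    (hx : ContinuousOn (fun t => x t ω) (Icc P.t₀ P.T)) (ht : t ∈ Icc P.t₀ P.T)
    (i : Fin (m + 1)) : ContDiffAt ℝ 2 (fun y => P.f i y ω) (x t ω) := by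
  have hnear := (hx t ht).eventually_mem (Metric.ball_mem_nhds (x t ω) hδ)
  obtain ⟨s, hs, hsx⟩ :=
    ((frequently_nhdsWithin_of_ae hT (h1.f_contDiff_two i ω) ht).and_eventually hnear).exists
  exact hs.contDiffAt (Metric.isOpen_ball.mem_nhds (Metric.mem_ball'.2 hsx))

theorem H1.exists_norm_fderiv_fderiv_le (h1 : P.H1 x δ) (hδ : 0 < δ) (hT : P.t₀ < P.T)
    (hx : ∀ ω, ContinuousOn (fun t => x t ω) (Icc P.t₀ P.T)) :
    ∃ C, ∀ ω ∈ P.μ.support, ∀ t ∈ Icc P.t₀ P.T, ∀ i,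
      ‖fderiv ℝ (fderiv ℝ fun y => P.f i y ω) (x t ω)‖ ≤ C := by
  choose C hC₀ hC using fun i => h1.f_deriv_bound i 2 (by simp)
  refine ⟨∑ i, C i, fun ω hω t ht i => le_trans ?_
    (Finset.single_le_sum (f := C) (fun i _ => (hC₀ i).le) (Finset.mem_univ i))⟩
  by_contra! hlt
  have hcont : ContinuousWithinAt (fun s => ‖fderiv ℝ (fderiv ℝ fun y => P.f i y ω) (x s ω)‖)
      (Icc P.t₀ P.T) t := by
    have h' := (h1.contDiffAt hδ hT (hx ω) ht i).fderiv_right (m := 1) (by norm_num)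
    exact (((h'.fderiv_right (m := 0) (by norm_num)).continuousAt).comp_continuousWithinAt
      (f := fun s => x s ω) (hx ω t ht)).norm
  obtain ⟨s, hs, hs'⟩ := ((frequently_nhdsWithin_of_ae hT (hC i ω hω) ht).and_eventually
    (hcont.eventually_const_lt hlt)).exists
  rw [← norm_iteratedFDeriv_fderiv, norm_iteratedFDeriv_one] at hs
  exact lt_asymm hs hs'

theorem H1.isRegularAlong [HereditarilyLindelofSpace Ω] (h1 : P.H1 x δ) (hδ : 0 < δ)
    (hT : P.t₀ < P.T) (hx : ∀ ω, ContinuousOn (fun t => x t ω) (Icc P.t₀ P.T)) :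
    P.IsRegularAlong x where
  f_contDiffAt := Eventually.of_forall fun ω _ ht i => h1.contDiffAt hδ hT (hx ω) ht i
  exists_norm_fderiv_fderiv_le :=
    let ⟨C, hC⟩ := h1.exists_norm_fderiv_fderiv_le hδ hT hx
    ⟨C, Filter.mem_of_superset P.μ.support_mem_ae hC⟩
  g_differentiableAt := Eventually.of_forall fun ω =>
    h1.g_differentiable ω _ (Metric.mem_ball_self hδ)

end Tubes

end Problem

/-! ### Weak velocities and curves in `L^p` -/

section Uniqueness

variable {E : Type*} [NormedAddCommGroup E] [NormedSpace ℝ E] {a b K : ℝ}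

theorem HasVelocityOn.clm_comp {F : Type*} [NormedAddCommGroup F] [NormedSpace ℝ F]
    [CompleteSpace E] [CompleteSpace F] {y v : ℝ → E} (h : HasVelocityOn y v a b)
    (L : E →L[ℝ] F) : HasVelocityOn (fun t => L (y t)) (fun t => L (v t)) a b where
  integrableOn := L.integrable_comp h.integrableOn
  eq_add t ht := by
    rw [h.eq_add t ht, map_add, L.intervalIntegral_comp_comm
      (h.intervalIntegrable (left_mem_Icc.2 (ht.1.trans ht.2)) ht)]

variable {Z : Type*} [MeasurableSpace Z] [MeasurableSpace E] {F : ℝ → Z → E → E} {z : Z}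
  {x y : ℝ → E}

theorem IsCaratheodoryField.eqOn_of_left (hF : IsCaratheodoryField F K)
    (hx : HasVelocityOn x (fun s => F s z (x s)) a b)
    (hy : HasVelocityOn y (fun s => F s z (y s)) a b) (hxy : x a = y a) :
    EqOn x y (Icc a b) := fun t ht => by
  have hle := (hx.sub hy).norm_le_mul_exp hF.pos.le le_rfl
    (Eventually.of_forall fun s => (hF.lipschitz s z _ _).trans_eq (add_zero _).symm) ht
  simpa only [hxy, sub_self, norm_zero, zero_mul, add_zero, norm_le_zero_iff, sub_eq_zero]
    using hle

theorem IsCaratheodoryField.eqOn_of_right (hF : IsCaratheodoryField F K)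
    (hx : HasVelocityOn x (fun s => -F s z (x s)) a b)
    (hy : HasVelocityOn y (fun s => -F s z (y s)) a b) (hxy : x b = y b) :
    EqOn x y (Icc a b) := fun t ht => by
  have hle := (hx.sub hy).norm_le_mul_exp_of_right hF.pos.le (Eventually.of_forall fun s => by
    rw [← neg_sub', norm_neg]
    exact hF.lipschitz s z _ _) ht
  simpa only [hxy, sub_self, norm_zero, zero_mul, norm_le_zero_iff, sub_eq_zero] using hle

theorem isCaratheodoryField_clm [BorelSpace E] [FiniteDimensional ℝ E] {A : ℝ × Z → E →L[ℝ] E}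
    (hA : Measurable A) (hK : 0 < K) (hAK : ∀ q, ‖A q‖ ≤ K) :
    IsCaratheodoryField (fun t z y => A (t, z) y) K where
  measurable := measurable_clm_apply
    (hA.comp (measurable_fst.prodMk (measurable_fst.comp measurable_snd)))
    (measurable_snd.comp measurable_snd)
  pos := hK
  lipschitz t z x y := by
    rw [← map_sub]
    exact (A (t, z)).le_of_opNorm_le (hAK _) _
  bounded_zero _ := ⟨0, fun t => by simp⟩

end Uniqueness

section WeakVelocity

variable {H : Type*} [NormedAddCommGroup H] [InnerProductSpace ℝ H] {a b K : ℝ}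

/-- Testing with `y t` itself bounds `‖y t‖` by `K ∫_t^b ‖y‖`. -/
theorem eqOn_zero_of_forall_hasVelocityOn_inner {y v : ℝ → H} (hy : ContinuousOn y (Icc a b))
    (hvel : ∀ w, HasVelocityOn (fun t => inner ℝ w (y t)) (fun t => inner ℝ w (v t)) a b)
    (hK : 0 ≤ K) (hv : ∀ᵐ s ∂volume.restrict (Icc a b), ‖v s‖ ≤ K * ‖y s‖) (hb : y b = 0) :
    EqOn y 0 (Icc a b) := by
  have hle : ∀ t ∈ Icc a b, ‖y t‖ ≤ K * ∫ s in t..b, ‖y s‖ := fun t ht => by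
    have hbmem : b ∈ Icc a b := right_mem_Icc.2 (ht.1.trans ht.2)
    have hint : IntervalIntegrable (fun s => ‖y s‖) volume t b :=
      (hy.norm.mono (uIcc_subset_Icc ht hbmem)).intervalIntegrable
    have hsq : ‖y t‖ * ‖y t‖ ≤ ‖y t‖ * (K * ∫ s in t..b, ‖y s‖) := by
      have hself := (hvel (y t)).integral_eq_sub ht hbmem
      rw [hb, inner_zero_right, zero_sub, real_inner_self_eq_norm_mul_norm] at hself
      rw [← neg_neg (‖y t‖ * ‖y t‖), ← hself, ← intervalIntegral.integral_const_mul,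
        ← intervalIntegral.integral_const_mul]
      refine (neg_le_abs _).trans ?_
      rw [← Real.norm_eq_abs]
      refine intervalIntegral.norm_integral_le_of_norm_le ht.2 ?_ ((hint.const_mul K).const_mul _)
      filter_upwards [(ae_restrict_iff' measurableSet_Icc).1 hv] with s hs hst
      refine (norm_inner_le_norm _ _).trans ?_
      gcongr
      exact hs ⟨ht.1.trans hst.1.le, hst.2⟩
    rcases (norm_nonneg (y t)).eq_or_lt with h0 | h0
    · rw [← h0]
      exact mul_nonneg hK (intervalIntegral.integral_nonneg ht.2 fun _ _ => norm_nonneg _)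
    · exact le_of_mul_le_mul_left hsq h0
  have hmaps : MapsTo (fun t => a + b - t) (Icc a b) (Icc a b) := fun t ht =>
    ⟨by linarith [ht.2], by linarith [ht.1]⟩
  intro t ht
  have hrev := le_mul_exp_of_le_add_integral (h := fun t => ‖y (a + b - t)‖) (C := 0)
    (hy.norm.comp (by fun_prop) hmaps) hK (fun r hr => by
      rw [intervalIntegral.integral_comp_sub_left (fun s => ‖y s‖), add_sub_cancel_left, zero_add]
      exact hle _ (hmaps hr)) (hmaps ht)
  simpa only [sub_sub_cancel, zero_mul, norm_le_zero_iff, Pi.zero_apply] using hrev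

end WeakVelocity

section LpCurves

variable {Ω E : Type*} [MeasurableSpace Ω] {μ : Measure Ω} [NormedAddCommGroup E]

theorem exists_lp_curve {ι : Type*} {p : ℝ≥0∞} {h : ι → Ω → E} {s : Set ι}
    (hh : ∀ t ∈ s, MemLp (h t) p μ) : ∃ Q : ι → Lp E p μ, ∀ t ∈ s, Q t =ᵐ[μ] h t := by
  have hex : ∀ t, ∃ q : Lp E p μ, t ∈ s → q =ᵐ[μ] h t := fun t => by
    by_cases ht : t ∈ s
    · exact ⟨(hh t ht).toLp, fun _ => (hh t ht).coeFn_toLp⟩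
    · exact ⟨0, fun ht' => absurd ht' ht⟩
  choose Q hQ using hex
  exact ⟨Q, hQ⟩

variable [IsFiniteMeasure μ] {a b D : ℝ} {h k : ℝ → Ω → E}

theorem continuousOn_lp_of_ae_hasVelocityOn [NormedSpace ℝ E] {p : ℝ≥0∞} [Fact (1 ≤ p)]
    {Q : ℝ → Lp E p μ}
    (hvel : ∀ᵐ ω ∂μ, HasVelocityOn (fun t => h t ω) (fun t => k t ω) a b)
    (hk : ∀ᵐ ω ∂μ, ∀ t ∈ Icc a b, ‖k t ω‖ ≤ D) (hD : 0 ≤ D)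
    (hQ : ∀ t ∈ Icc a b, Q t =ᵐ[μ] h t) : ContinuousOn Q (Icc a b) := by
  refine LipschitzOnWith.continuousOn (K := measureUnivNNReal μ ^ p.toReal⁻¹ * D.toNNReal)
    (LipschitzOnWith.of_dist_le_mul fun t ht s hs => ?_)
  rw [dist_eq_norm, Real.dist_eq, NNReal.coe_mul, Real.coe_toNNReal _ hD, mul_assoc]
  refine Lp.norm_le_of_ae_bound (by positivity) ?_
  filter_upwards [Lp.coeFn_sub (Q t) (Q s), hQ t ht, hQ s hs, hvel, hk] with ω h₁ h₂ h₃ h₄ h₅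
  rw [h₁, Pi.sub_apply, h₂, h₃]
  exact h₄.norm_sub_le ((ae_restrict_mem measurableSet_Icc).mono h₅) hs ht

theorem hasVelocityOn_inner_of_ae_hasVelocityOn [InnerProductSpace ℝ E] [CompleteSpace E]
    {Q dQ : ℝ → Lp E 2 μ}
    (hvel : ∀ᵐ ω ∂μ, HasVelocityOn (fun t => h t ω) (fun t => k t ω) a b)
    (hkm : AEStronglyMeasurable (fun q : ℝ × Ω => k q.1 q.2) ((volume.restrict (Icc a b)).prod μ))
    (hk : ∀ᵐ ω ∂μ, ∀ t ∈ Icc a b, ‖k t ω‖ ≤ D) (hQ : ∀ t ∈ Icc a b, Q t =ᵐ[μ] h t)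
    (hdQ : ∀ t ∈ Icc a b, dQ t =ᵐ[μ] k t) (w : Lp E 2 μ) :
    HasVelocityOn (fun t => inner ℝ w (Q t)) (fun t => inner ℝ w (dQ t)) a b := by
  have hvelw : ∀ᵐ ω ∂μ, HasVelocityOn (fun t => inner ℝ (w ω) (h t ω))
      (fun t => inner ℝ (w ω) (k t ω)) a b :=
    hvel.mono fun ω hω => hω.clm_comp (innerSL ℝ (w ω))
  have hinner : ∀ (q : Lp E 2 μ) (f : Ω → E), q =ᵐ[μ] f →
      inner ℝ w q = ∫ ω, inner ℝ (w ω) (f ω) ∂μ := fun q f hqf => by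
    rw [L2.inner_def]
    exact integral_congr_ae (hqf.mono fun ω hω => by simp only [hω])
  have hint : ∀ t ∈ Icc a b, Integrable (fun ω => inner ℝ (w ω) (h t ω)) μ := fun t ht =>
    (L2.integrable_inner w (Q t)).congr ((hQ t ht).mono fun ω hω => by simp only [hω])
  have hjoint : Integrable (fun q : ℝ × Ω => inner ℝ (w q.2) (k q.1 q.2))
      ((volume.restrict (Icc a b)).prod μ) := by
    refine (((((Lp.memLp w).integrable (by norm_num)).norm.mul_const D)).comp_snd
      (volume.restrict (Icc a b))).mono' ((Lp.aestronglyMeasurable w).comp_snd.inner hkm) ?_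
    filter_upwards [Measure.quasiMeasurePreserving_snd.ae hk,
      Measure.quasiMeasurePreserving_fst.ae (ae_restrict_mem measurableSet_Icc)] with q hq hqt
    refine (norm_inner_le_norm _ _).trans ?_
    gcongr
    exact hq _ hqt
  have hdinner : ∀ t ∈ Icc a b, ∫ ω, inner ℝ (w ω) (k t ω) ∂μ = inner ℝ w (dQ t) := fun t ht =>
    (hinner _ _ (hdQ t ht)).symm
  refine ⟨hjoint.integral_prod_left.congr
    ((ae_restrict_mem measurableSet_Icc).mono hdinner), fun t ht => ?_⟩
  have ha : a ∈ Icc a b := left_mem_Icc.2 (ht.1.trans ht.2)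
  rw [hinner _ _ (hQ t ht), hinner _ _ (hQ a ha), ← sub_eq_iff_eq_add',
    ← integral_sub_eq_integral_integral_velocity hvelw hint hjoint ha ht]
  exact intervalIntegral.integral_congr fun s hs => hdinner s (uIcc_subset_Icc ha ht hs)

end LpCurves

/-! ### The adjoint state -/

namespace Problem

variable {n m : ℕ} {Ω : Type*} [MeasurableSpace Ω] {P : Problem n m Ω}
  {u u₀ : ℝ → Fin m → ℝ} {x X p p' : ℝ → Ω → State n} {K C : ℝ}

/-- The setting of the necessary conditions: an everywhere box-valued control `u`, its states `x`
along which the fields are regular, and a jointly measurable version `X` of `x`. -/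
structure IsReference (P : Problem n m Ω) (u : ℝ → Fin m → ℝ) (x X : ℝ → Ω → State n) (K : ℝ) :
    Prop where
  data : P.H0
  lt : P.t₀ < P.T
  bound : P.HasBound K
  control : P.IsBoxControl u
  initial : MemLp P.φ 2 P.μ
  state : P.IsState u x
  regular : P.IsRegularAlong x
  measurable : Measurable fun q : ℝ × Ω => X q.1 q.2
  eq : ∀ᵐ ω ∂P.μ, ∀ t ∈ Icc P.t₀ P.T, x t ω = X t ω

theorem IsState.exists_measurable_version {y : ℝ → Ω → State n} (hy : P.IsState u y)
    (hu : P.IsBoxControl u) (hK : P.HasBound K) (h0 : P.H0) (ht : P.t₀ ≤ P.T)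
    (hφ : AEStronglyMeasurable P.φ P.μ) :
    ∃ Y : ℝ → Ω → State n, (Measurable fun q : ℝ × Ω => Y q.1 q.2) ∧
      (∀ ω, Continuous fun t => Y t ω) ∧ ∀ᵐ ω ∂P.μ, ∀ t ∈ Icc P.t₀ P.T, y t ω = Y t ω := by
  obtain ⟨Y, hYm, hYc, hY⟩ := hu.exists_flow hK h0 ht
  have hφm : Measurable (hφ.mk P.φ) := hφ.stronglyMeasurable_mk.measurable
  refine ⟨fun t ω => Y t (ω, hφ.mk P.φ ω),
    hYm.comp (measurable_fst.prodMk (measurable_snd.prodMk (hφm.comp measurable_snd))),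
    fun ω => hYc _, ?_⟩
  filter_upwards [hφ.ae_eq_mk] with ω hω
  refine (hu.isCaratheodoryField hK h0).eqOn_of_left (hy ω).2 (hY (ω, hφ.mk P.φ ω)).2 ?_
  rw [(hy ω).1, (hY _).1, hω]

theorem IsState.exists_isReference (hx : P.IsState u x) (hu : P.IsBoxControl u) (h0 : P.H0)
    (ht : P.t₀ < P.T) (hφ : MemLp P.φ 2 P.μ) (hreg : P.IsRegularAlong x) :
    ∃ X K, P.IsReference u x X K := by
  obtain ⟨K, hK⟩ := h0.exists_hasBound
  obtain ⟨X, hXm, -, hX⟩ := hx.exists_measurable_version hu hK h0 ht.le hφ.1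
  exact ⟨X, K, h0, ht, hK, hu, hφ, hx, hreg, hXm, hX⟩

namespace IsReference

theorem norm_adjointField_le (R : P.IsReference u x X K) (t : ℝ) (ω : Ω) (q : State n) :
    ‖P.adjointField u x t ω q‖ ≤ K * ‖q‖ := by
  refine ContinuousLinearMap.le_of_opNorm_le _ ?_ q
  rw [LinearIsometryEquiv.norm_map]
  exact R.bound.norm_fderiv_dyn_le (R.control.mem t) ω _

theorem exists_measurable_adjoint (R : P.IsReference u x X K) :
    ∃ A : ℝ × Ω → State n →L[ℝ] State n, Measurable A ∧ (∀ q, ‖A q‖ ≤ K) ∧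
      ∀ᵐ ω ∂P.μ, ∀ t ∈ Icc P.t₀ P.T, P.adjointField u x t ω = A (t, ω) := by
  let V : State n × (ℝ × Ω) → State n := fun q => P.dyn q.1 (u q.2.1) q.2.2
  have hV : Measurable V := (measurable_dyn R.data).comp (measurable_fst.prodMk
    ((R.control.measurable.comp (measurable_fst.comp measurable_snd)).prodMk
      (measurable_snd.comp measurable_snd)))
  let D : ℝ × Ω → State n →L[ℝ] State n := fun q => paramFDeriv V (X q.1 q.2, q)
  have hD : Measurable D := (measurable_paramFDeriv hV).comp (R.measurable.prodMk measurable_id)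
  let s : Set (ℝ × Ω) := {q | ‖D q‖ ≤ K}
  refine ⟨fun q => ContinuousLinearMap.adjoint (s.indicator D q), ?_, fun q => ?_, ?_⟩
  · exact ContinuousLinearMap.adjoint.continuous.measurable.comp
      (hD.indicator (measurableSet_le hD.norm measurable_const))
  · rw [LinearIsometryEquiv.norm_map]
    by_cases hq : q ∈ s
    · rwa [indicator_of_mem hq]
    · rw [indicator_of_notMem hq, norm_zero]
      exact R.bound.pos.le
  · filter_upwards [R.eq, R.regular.differentiableAt_f] with ω hω hdiff t ht
    have hDeq : D (t, ω) = fderiv ℝ (fun y => P.dyn y (u t) ω) (x t ω) := by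
      rw [hω t ht]
      refine paramFDeriv_eq ?_
      rw [← hω t ht]
      exact differentiableAt_dyn (hdiff t ht) (u t)
    have hs : (t, ω) ∈ s := by
      rw [mem_ofPred_eq, hDeq]
      exact R.bound.norm_fderiv_dyn_le (R.control.mem t) ω _
    funext q
    rw [indicator_of_mem hs, hDeq, adjointField]

theorem exists_measurable_gradient (R : P.IsReference u x X K) :
    ∃ η : Ω → State n, Measurable η ∧
      ∀ᵐ ω ∂P.μ, gradient (fun z => P.g z ω) (x P.T ω) = η ω := by
  refine ⟨fun ω => (InnerProductSpace.toDual ℝ (State n)).symm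
    (paramFDeriv (fun q : State n × Ω => P.g q.1 q.2) (X P.T ω, ω)), ?_, ?_⟩
  · exact (LinearIsometryEquiv.continuous _).measurable.comp
      ((measurable_paramFDeriv R.data.g_measurable).comp
        ((R.measurable.comp measurable_prodMk_left).prodMk measurable_id))
  · filter_upwards [R.eq, R.regular.g_differentiableAt] with ω hω hg
    rw [hω _ (right_mem_Icc.2 R.lt.le)] at hg ⊢
    rw [paramFDeriv_eq hg, gradient]

end IsReference

/-- A jointly measurable, bounded solution of the adjoint equation for almost every parameter:
the representative of the adjoint state in which the computations are carried out. -/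
structure IsRegularCostate (P : Problem n m Ω) (u : ℝ → Fin m → ℝ) (x p : ℝ → Ω → State n)
    (C : ℝ) : Prop where
  measurable : Measurable fun q : ℝ × Ω => p q.1 q.2
  bound : ∀ᵐ ω ∂P.μ, ∀ t ∈ Icc P.t₀ P.T, ‖p t ω‖ ≤ C
  hasVelocityOn : ∀ᵐ ω ∂P.μ, HasVelocityOn (fun t => p t ω)
    (fun s => -P.adjointField u x s ω (p s ω)) P.t₀ P.T
  terminal : ∀ᵐ ω ∂P.μ, -p P.T ω = gradient (fun z => P.g z ω) (x P.T ω)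

theorem IsReference.exists_isRegularCostate (R : P.IsReference u x X K) :
    ∃ p C, P.IsRegularCostate u x p C := by
  obtain ⟨A, hA, hAK, hadj⟩ := R.exists_measurable_adjoint
  obtain ⟨η, hη, hgrad⟩ := R.exists_measurable_gradient
  obtain ⟨p, hpm, -, hp⟩ := exists_measurable_hasVelocityOn_of_right
    (isCaratheodoryField_clm hA R.bound.pos hAK) hη.neg R.lt.le
  refine ⟨p, K * Real.exp (K * (P.T - P.t₀)), hpm, ?_, ?_, ?_⟩
  · filter_upwards [hgrad] with ω hω t ht
    refine ((hp ω).2.norm_le_mul_exp_of_right R.bound.pos.le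
      (Eventually.of_forall fun s => ?_) ht).trans ?_
    · rw [norm_neg]
      exact (A (s, ω)).le_of_opNorm_le (hAK _) _
    · have hK := R.bound.pos.le
      rw [(hp ω).1, Pi.neg_apply, norm_neg, ← hω]
      gcongr
      exacts [R.bound.norm_gradient_le ω _, ht.1]
  · filter_upwards [hadj] with ω hω
    refine (hp ω).2.congr (eqOn_refl _ _) ?_
    filter_upwards [ae_restrict_mem measurableSet_Icc] with s hs
    rw [hω s hs]
  · filter_upwards [hgrad] with ω hω
    rw [(hp ω).1, Pi.neg_apply, neg_neg, hω]

theorem adjointField_ae_eq (hu : u =ᵐ[volume.restrict (Icc P.t₀ P.T)] u₀)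
    (x : ℝ → Ω → State n) : ∀ᵐ s ∂volume.restrict (Icc P.t₀ P.T), ∀ ω,
      P.adjointField u₀ x s ω = P.adjointField u x s ω :=
  hu.mono fun s hs ω => by
    funext q
    rw [adjointField, adjointField, hs]

theorem IsRegularCostate.memLp [IsFiniteMeasure P.μ] (hp : P.IsRegularCostate u x p C) {t : ℝ}
    (ht : t ∈ Icc P.t₀ P.T) : MemLp (p t) 2 P.μ :=
  MemLp.of_bound (hp.measurable.comp measurable_prodMk_left).aestronglyMeasurable C
    (hp.bound.mono fun _ h => h t ht)

theorem IsRegularCostate.exists_lp_curve (hp : P.IsRegularCostate u x p C)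
    (R : P.IsReference u x X K) : ∃ Q dQ : ℝ → Lp (State n) 2 P.μ,
      (∀ t ∈ Icc P.t₀ P.T, Q t =ᵐ[P.μ] p t) ∧
      (∀ t ∈ Icc P.t₀ P.T, dQ t =ᵐ[P.μ] fun ω => -P.adjointField u x t ω (p t ω)) ∧
      ContinuousOn Q (Icc P.t₀ P.T) ∧ ∀ w, HasVelocityOn (fun t => inner ℝ w (Q t))
        (fun t => inner ℝ w (dQ t)) P.t₀ P.T := by
  have := R.data.prob
  obtain ⟨A, hA, -, hadj⟩ := R.exists_measurable_adjoint
  have hvelm : Measurable fun r : ℝ × Ω => -A (r.1, r.2) (p r.1 r.2) :=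
    (measurable_clm_apply hA hp.measurable).neg
  have hbound : ∀ᵐ ω ∂P.μ, ∀ s ∈ Icc P.t₀ P.T, ‖-P.adjointField u x s ω (p s ω)‖ ≤ K * C := by
    filter_upwards [hp.bound] with ω hω s hs
    rw [norm_neg]
    refine (R.norm_adjointField_le s ω _).trans ?_
    exact mul_le_mul_of_nonneg_left (hω s hs) R.bound.pos.le
  have hC : 0 ≤ K * C := hbound.exists.elim fun ω hω =>
    (norm_nonneg _).trans (hω _ (left_mem_Icc.2 R.lt.le))
  have hmeas : ∀ s ∈ Icc P.t₀ P.T,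
      AEStronglyMeasurable (fun ω => -P.adjointField u x s ω (p s ω)) P.μ := fun s hs =>
    ⟨fun ω => -A (s, ω) (p s ω), (hvelm.comp measurable_prodMk_left).stronglyMeasurable,
      hadj.mono fun ω hω => by simp only [hω s hs]⟩
  obtain ⟨Q, hQ⟩ := EnsembleControl.exists_lp_curve fun t ht => hp.memLp (t := t) ht
  obtain ⟨dQ, hdQ⟩ := EnsembleControl.exists_lp_curve fun s hs =>
    MemLp.of_bound (p := 2) (hmeas s hs) _ (hbound.mono fun _ h => h s hs)
  refine ⟨Q, dQ, hQ, hdQ, continuousOn_lp_of_ae_hasVelocityOn hp.hasVelocityOn hbound hC hQ,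
    hasVelocityOn_inner_of_ae_hasVelocityOn hp.hasVelocityOn
      ⟨_, hvelm.stronglyMeasurable, ?_⟩ hbound hQ hdQ⟩
  filter_upwards [Measure.quasiMeasurePreserving_snd.ae hadj,
    Measure.quasiMeasurePreserving_fst.ae (ae_restrict_mem measurableSet_Icc)] with r hr hrt
  rw [hr _ hrt]

section Uniqueness

variable (R : P.IsReference u x X K) (hu : u =ᵐ[volume.restrict (Icc P.t₀ P.T)] u₀)
  (hp' : P.IsRegularCostate u x p' C)

include R hu hp'

theorem IsCostate.ae_eqOn_isRegularCostate [TopologicalSpace Ω] [HereditarilyLindelofSpace Ω]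
    (hp : P.IsCostate u₀ x p) :
    ∀ᵐ ω ∂P.μ, EqOn (fun t => p t ω) (fun t => p' t ω) (Icc P.t₀ P.T) := by
  obtain ⟨A, hA, hAK, hadj⟩ := R.exists_measurable_adjoint
  have hF := isCaratheodoryField_clm hA R.bound.pos hAK
  filter_upwards [hadj, hp'.hasVelocityOn, hp'.terminal, P.μ.support_mem_ae]
    with ω hω hvel' hterm' hsupp
  have hae : ∀ᵐ s ∂volume.restrict (Icc P.t₀ P.T), P.adjointField u₀ x s ω = A (s, ω) := by
    filter_upwards [adjointField_ae_eq hu x, ae_restrict_mem measurableSet_Icc] with s hs hsm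
    rw [hs, hω s hsm]
  have hpc := hp.continuousOn ω hsupp
  obtain ⟨D, hD⟩ := isCompact_Icc.exists_bound_of_continuousOn hpc
  have hvel := HasVelocityOn.of_eq_add_integral_to_right (y := fun t => p t ω)
    (hF.integrableOn ω (hpc.aestronglyMeasurable measurableSet_Icc) hD) fun t ht => by
      rw [hp.adjoint_eq ω hsupp t ht]
      refine congrArg _ (intervalIntegral.integral_congr_ae ?_)
      filter_upwards [(ae_restrict_iff' measurableSet_Icc).1 hae] with s hs hst
      rw [uIoc_of_le ht.2] at hst
      rw [hs ⟨ht.1.trans hst.1.le, hst.2⟩]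
  refine hF.eqOn_of_right hvel (hvel'.congr (eqOn_refl _ _) ?_) ?_
  · filter_upwards [ae_restrict_mem measurableSet_Icc] with s hs
    rw [hω s hs]
  · rw [← neg_inj, hp.terminal ω hsupp, hterm']

theorem IsMeanCostate.ae_eq_isRegularCostate (hp : P.IsMeanCostate u₀ x p) :
    ∀ t ∈ Icc P.t₀ P.T, p t =ᵐ[P.μ] p' t := by
  obtain ⟨q, dq, hpq, hdq, hq, hdqadj, hqT⟩ := hp
  obtain ⟨Q, dQ, hQ, hdQ, hQc, hQvel⟩ := hp'.exists_lp_curve R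
  have hqvel : HasVelocityOn q dq P.t₀ P.T :=
    ⟨(intervalIntegrable_iff_integrableOn_Icc_of_le R.lt.le).1 hdq, hq⟩
  have hzero : EqOn (fun t => q t - Q t) 0 (Icc P.t₀ P.T) := by
    refine eqOn_zero_of_forall_hasVelocityOn_inner (v := fun s => dq s - dQ s)
      (hqvel.continuousOn.sub hQc) (fun w => ?_) R.bound.pos.le ?_ ?_
    · simp only [inner_sub_right]
      exact (hqvel.clm_comp (innerSL ℝ w)).sub (hQvel w)
    · filter_upwards [hdqadj, adjointField_ae_eq hu x, ae_restrict_mem measurableSet_Icc]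
        with s hs hus hsm
      refine Lp.norm_le_mul_norm_of_ae_le_mul ?_
      filter_upwards [hs, hQ s hsm, hdQ s hsm, Lp.coeFn_sub (q s) (Q s),
        Lp.coeFn_sub (dq s) (dQ s)] with ω hdqω hQω hdQω hsub hdsub
      rw [hsub, hdsub, Pi.sub_apply, Pi.sub_apply, hQω, hdQω, ← neg_neg (dq s ω), hdqω, hus,
        ← neg_sub', norm_neg, adjointField, adjointField, ← map_sub]
      exact R.norm_adjointField_le s ω _
    · rw [sub_eq_zero]
      refine Lp.ext ?_
      filter_upwards [hQ _ (right_mem_Icc.2 R.lt.le), hqT, hp'.terminal] with ω h₁ h₂ h₃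
      rw [h₁, ← neg_inj, h₂, h₃]
  intro t ht
  refine (hpq t ht).trans ?_
  rw [sub_eq_zero.1 (hzero ht)]
  exact hQ t ht

theorem IsReference.ae_eq_isRegularCostate [TopologicalSpace Ω] [HereditarilyLindelofSpace Ω]
    (hp : P.IsCostate u₀ x p ∨ P.IsMeanCostate u₀ x p) :
    ∀ t ∈ Icc P.t₀ P.T, p t =ᵐ[P.μ] p' t := by
  rcases hp with hp | hp
  · intro t ht
    filter_upwards [hp.ae_eqOn_isRegularCostate R hu hp'] with ω hω using hω ht
  · exact hp.ae_eq_isRegularCostate R hu hp'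

end Uniqueness

end Problem

/-! ### The first variation of the cost -/

section Expansion

variable {E F : Type*} [NormedAddCommGroup E] [NormedAddCommGroup F] {x : E} {y : ℝ → E}

theorem isBigO_nhdsGT_of_norm_le {z : ℝ → E} {C : ℝ} (hz : ∀ l ∈ Ioc (0 : ℝ) 1, ‖z l‖ ≤ l * C) :
    z =O[𝓝[>] 0] fun l => l :=
  Asymptotics.IsBigO.of_bound C <| by
    filter_upwards [Ioc_mem_nhdsGT one_pos] with l hl
    rw [Real.norm_of_nonneg hl.1.le, mul_comm]
    exact hz l hl

theorem tendsto_of_isBigO_sub (hy : (fun l => y l - x) =O[𝓝[>] 0] fun l => l) :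
    Tendsto y (𝓝[>] 0) (𝓝 x) :=
  tendsto_sub_nhds_zero_iff.1 (hy.trans_tendsto (tendsto_id'.2 nhdsWithin_le_nhds))

theorem tendsto_inv_smul_sub_of_hasFDerivAt [NormedSpace ℝ E] [NormedSpace ℝ F] {f : E → F}
    {f' : E →L[ℝ] F} (hf : HasFDerivAt f f' x)
    (hy : (fun l => y l - x) =O[𝓝[>] 0] fun l => l) :
    Tendsto (fun l => l⁻¹ • (f (y l) - f x - f' (y l - x))) (𝓝[>] 0) (𝓝 0) :=
  ((hf.isLittleO.comp_tendsto (tendsto_of_isBigO_sub hy)).trans_isBigO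
    hy).tendsto_inv_smul_nhds_zero

end Expansion

theorem exists_lipschitzOnWith_inner {E : Type*} [NormedAddCommGroup E] [InnerProductSpace ℝ E]
    {p z : ℝ → E} {s : Set ℝ} {L M : NNReal} (hs : IsCompact s) (hp : LipschitzOnWith L p s)
    (hz : LipschitzOnWith M z s) : ∃ N, LipschitzOnWith N (fun t => inner ℝ (p t) (z t)) s := by
  obtain ⟨A, hA⟩ := hs.exists_bound_of_continuousOn hp.continuousOn
  obtain ⟨B, hB⟩ := hs.exists_bound_of_continuousOn hz.continuousOn
  refine ⟨(L * |B| + |A| * M).toNNReal, LipschitzOnWith.of_dist_le_mul fun t ht r hr => ?_⟩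
  have hpd := hp.dist_le_mul t ht r hr
  have hzd := hz.dist_le_mul t ht r hr
  rw [dist_eq_norm] at hpd hzd
  have hBt : ‖z t‖ ≤ |B| := (hB t ht).trans (le_abs_self B)
  have hAr : ‖p r‖ ≤ |A| := (hA r hr).trans (le_abs_self A)
  have hsplit : inner ℝ (p t) (z t) - inner ℝ (p r) (z r) =
      inner ℝ (p t - p r) (z t) + inner ℝ (p r) (z t - z r) := by
    rw [inner_sub_left, inner_sub_right]
    ring
  rw [Real.coe_toNNReal _ (by positivity), Real.dist_eq, hsplit]
  calc |inner ℝ (p t - p r) (z t) + inner ℝ (p r) (z t - z r)|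
      ≤ ‖p t - p r‖ * ‖z t‖ + ‖p r‖ * ‖z t - z r‖ :=
        (abs_add_le _ _).trans
          (add_le_add (abs_real_inner_le_norm _ _) (abs_real_inner_le_norm _ _))
    _ ≤ L * dist t r * |B| + |A| * (M * dist t r) := by gcongr
    _ = (L * |B| + |A| * M) * dist t r := by ring

theorem tendsto_integral_inv_mul_inner {E : Type*} [NormedAddCommGroup E] [InnerProductSpace ℝ E]
    {p s : ℝ → E} {r : ℝ → ℝ → E} {a b A B : ℝ} (hab : a ≤ b) (hp : ∀ t ∈ Icc a b, ‖p t‖ ≤ A)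
    (hr : ∀ l ∈ Ioc (0 : ℝ) 1, IntervalIntegrable (fun t => inner ℝ (p t) (r l t)) volume a b)
    (hrB : ∀ l ∈ Ioc (0 : ℝ) 1, ∀ t ∈ Icc a b, ‖r l t‖ ≤ l * B)
    (hlim : ∀ t ∈ Icc a b, Tendsto (fun l => l⁻¹ • r l t) (𝓝[>] 0) (𝓝 (s t))) :
    Tendsto (fun l => ∫ t in a..b, l⁻¹ * inner ℝ (p t) (r l t)) (𝓝[>] 0)
      (𝓝 (∫ t in a..b, inner ℝ (p t) (s t))) := by
  have hunit : ∀ᶠ l in 𝓝[>] (0 : ℝ), l ∈ Ioc (0 : ℝ) 1 := Ioc_mem_nhdsGT one_pos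
  have hmem : ∀ t ∈ uIoc a b, t ∈ Icc a b := fun t ht => Ioc_subset_Icc_self (uIoc_of_le hab ▸ ht)
  refine intervalIntegral.tendsto_integral_filter_of_dominated_convergence
    (fun _ => A * B) ?_ ?_ intervalIntegrable_const ?_
  · filter_upwards [hunit] with l hl
    exact ((hr l hl).const_mul _).def'.aestronglyMeasurable
  · filter_upwards [hunit] with l hl
    refine Eventually.of_forall fun t ht => ?_
    rw [norm_mul, norm_inv, Real.norm_of_nonneg hl.1.le, inv_mul_le_iff₀ hl.1]
    calc ‖inner ℝ (p t) (r l t)‖ ≤ ‖p t‖ * ‖r l t‖ := norm_inner_le_norm _ _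
      _ ≤ A * (l * B) := mul_le_mul (hp t (hmem t ht)) (hrB l hl t (hmem t ht)) (norm_nonneg _)
          ((norm_nonneg _).trans (hp t (hmem t ht)))
      _ = l * (A * B) := by ring
  · refine Eventually.of_forall fun t ht => (tendsto_const_nhds.inner (𝕜 := ℝ)
      (hlim t (hmem t ht))).congr fun l => ?_
    rw [real_inner_smul_right]

namespace Problem

variable {n m : ℕ} {Ω : Type*} [MeasurableSpace Ω] {P : Problem n m Ω}
  {u v : ℝ → Fin m → ℝ} {ω : Ω} {K : ℝ}

theorem IsArc.exists_lipschitzOnWith {y : ℝ → State n} (hy : P.IsArc u ω y) (hK : P.HasBound K)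
    (hu : P.IsBoxControl u) : ∃ L, LipschitzOnWith L y (Icc P.t₀ P.T) := by
  obtain ⟨A, hA⟩ := isCompact_Icc.exists_bound_of_continuousOn hy.continuousOn
  refine ⟨_, hy.lipschitzOnWith (M := K * (1 + A)) ?_⟩
  filter_upwards [ae_restrict_mem measurableSet_Icc] with t ht
  refine (hK.dyn_growth _ (hu.mem t) (y t) ω).trans ?_
  have := hK.pos
  gcongr
  exact hA t ht

section FirstVariation

variable {x p : ℝ → State n} {y : ℝ → ℝ → State n} {C t : ℝ}

theorem exists_lipschitzOnWith_of_adjoint (hK : P.HasBound K) (hu : P.IsBoxControl u)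
    (hp : HasVelocityOn p (fun t => -ContinuousLinearMap.adjoint
      (fderiv ℝ (fun y => P.dyn y (u t) ω) (x t)) (p t)) P.t₀ P.T) :
    ∃ L, LipschitzOnWith L p (Icc P.t₀ P.T) := by
  obtain ⟨A, hA⟩ := isCompact_Icc.exists_bound_of_continuousOn hp.continuousOn
  refine ⟨_, hp.lipschitzOnWith (M := K * A) ?_⟩
  filter_upwards [ae_restrict_mem measurableSet_Icc] with t ht
  rw [norm_neg]
  refine ContinuousLinearMap.le_of_opNorm_le_of_le _ ?_ (hA t ht)
  rw [LinearIsometryEquiv.norm_map]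
  exact hK.norm_fderiv_dyn_le (hu.mem t) ω _

theorem hasVelocityOn_inner_sub (hK : P.HasBound K) {w : ℝ → Fin m → ℝ} (hu : P.IsBoxControl u)
    (hw : P.IsBoxControl w) (hx : P.IsArc u ω x) {z : ℝ → State n} (hz : P.IsArc w ω z)
    (hp : HasVelocityOn p (fun t => -ContinuousLinearMap.adjoint
      (fderiv ℝ (fun y => P.dyn y (u t) ω) (x t)) (p t)) P.t₀ P.T) :
    HasVelocityOn (fun t => inner ℝ (p t) (z t - x t))
      (fun t => inner ℝ (p t) (P.dyn (z t) (w t) ω - P.dyn (x t) (u t) ω -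
        fderiv ℝ (fun y => P.dyn y (u t) ω) (x t) (z t - x t))) P.t₀ P.T := by
  obtain ⟨L, hL⟩ := hx.exists_lipschitzOnWith hK hu
  obtain ⟨M, hM⟩ := hz.exists_lipschitzOnWith hK hw
  obtain ⟨D, hD⟩ := exists_lipschitzOnWith_of_adjoint hK hu hp
  obtain ⟨N, hN⟩ := exists_lipschitzOnWith_inner isCompact_Icc hD (hM.sub hL)
  refine HasVelocityOn.of_lipschitzOnWith hN ?_
  filter_upwards [hp.ae_hasDerivAt, hx.ae_hasDerivAt, hz.ae_hasDerivAt] with t hpt hxt hzt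
  refine (hpt.inner ℝ (hzt.sub hxt)).congr_deriv ?_
  simp only [inner_neg_left, ContinuousLinearMap.adjoint_inner_left, inner_sub_right, map_sub,
    Pi.sub_apply]
  ring

theorem tendsto_inv_smul_dyn_mix_sub (hdiff : ∀ i, DifferentiableAt ℝ (fun y => P.f i y ω) (x t))
    (hy : (fun l => y l t - x t) =O[𝓝[>] 0] fun l => l) :
    Tendsto (fun l => l⁻¹ • (P.dyn (y l t) (mix u v l t) ω - P.dyn (x t) (u t) ω -
      fderiv ℝ (fun y => P.dyn y (u t) ω) (x t) (y l t - x t))) (𝓝[>] 0)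
      (𝓝 (P.dyn (x t) (v t) ω - P.dyn (x t) (u t) ω)) := by
  have hcont : ∀ w, Tendsto (fun l => P.dyn (y l t) w ω) (𝓝[>] 0) (𝓝 (P.dyn (x t) w ω)) :=
    fun w => (differentiableAt_dyn hdiff w).continuousAt.tendsto.comp (tendsto_of_isBigO_sub hy)
  have hsum := (tendsto_inv_smul_sub_of_hasFDerivAt
    (differentiableAt_dyn hdiff (u t)).hasFDerivAt hy).add ((hcont (v t)).sub (hcont (u t)))
  rw [zero_add] at hsum
  refine hsum.congr' ?_
  filter_upwards [self_mem_nhdsWithin] with l (hl : 0 < l)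
  rw [dyn_mix, add_sub_right_comm, add_sub_right_comm, smul_add, smul_smul,
    inv_mul_cancel₀ hl.ne', one_smul]

theorem tendsto_integral_inner_variation (hK : P.HasBound K) (hu : P.IsBoxControl u)
    (hv : P.IsBoxControl v) (hx : P.IsArc u ω x)
    (hy : ∀ l ∈ Ioc (0 : ℝ) 1, P.IsArc (mix u v l) ω (y l))
    (hyC : ∀ l ∈ Ioc (0 : ℝ) 1, ∀ t ∈ Icc P.t₀ P.T, ‖y l t - x t‖ ≤ l * C ∧
      ‖P.dyn (y l t) (mix u v l t) ω - P.dyn (x t) (u t) ω‖ ≤ l * C)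
    (hdiff : ∀ t ∈ Icc P.t₀ P.T, ∀ i, DifferentiableAt ℝ (fun y => P.f i y ω) (x t))
    (hp : HasVelocityOn p (fun t => -ContinuousLinearMap.adjoint
      (fderiv ℝ (fun y => P.dyn y (u t) ω) (x t)) (p t)) P.t₀ P.T) (hT : P.t₀ ≤ P.T) :
    Tendsto (fun l => l⁻¹ * (inner ℝ (p P.T) (y l P.T - x P.T) -
        inner ℝ (p P.t₀) (y l P.t₀ - x P.t₀))) (𝓝[>] 0)
      (𝓝 (∫ t in P.t₀..P.T, inner ℝ (p t) (P.dyn (x t) (v t) ω - P.dyn (x t) (u t) ω))) := by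
  obtain ⟨A, hA⟩ := isCompact_Icc.exists_bound_of_continuousOn hp.continuousOn
  let D t := fderiv ℝ (fun y => P.dyn y (u t) ω) (x t)
  let r l t := P.dyn (y l t) (mix u v l t) ω - P.dyn (x t) (u t) ω - D t (y l t - x t)
  have hr : ∀ l ∈ Ioc (0 : ℝ) 1,
      HasVelocityOn (fun t => inner ℝ (p t) (y l t - x t)) (fun t => inner ℝ (p t) (r l t))
        P.t₀ P.T := fun l hl =>
    hasVelocityOn_inner_sub hK hu (hu.mix hv (Ioc_subset_Icc_self hl)) hx (hy l hl) hp
  have hrC : ∀ l ∈ Ioc (0 : ℝ) 1, ∀ t ∈ Icc P.t₀ P.T, ‖r l t‖ ≤ l * (C + K * C) :=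
    fun l hl t ht => by
      have hD := ContinuousLinearMap.le_of_opNorm_le_of_le _
        (hK.norm_fderiv_dyn_le (hu.mem t) ω (x t)) (hyC l hl t ht).1
      exact (norm_sub_le_of_le (hyC l hl t ht).2 hD).trans_eq (by ring)
  have hlim := tendsto_integral_inv_mul_inner hT hA (fun l hl =>
    (hr l hl).intervalIntegrable (left_mem_Icc.2 hT) (right_mem_Icc.2 hT)) hrC fun t ht =>
      tendsto_inv_smul_dyn_mix_sub (v := v) (hdiff t ht)
        (isBigO_nhdsGT_of_norm_le fun l hl => (hyC l hl t ht).1)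
  refine hlim.congr' ?_
  filter_upwards [Ioc_mem_nhdsGT one_pos] with l hl
  rw [intervalIntegral.integral_const_mul,
    (hr l hl).integral_eq_sub (left_mem_Icc.2 hT) (right_mem_Icc.2 hT)]

theorem tendsto_inv_mul_cost_sub (hK : P.HasBound K) (hu : P.IsBoxControl u)
    (hv : P.IsBoxControl v) (hx : P.IsArc u ω x)
    (hy : ∀ l ∈ Ioc (0 : ℝ) 1, y l P.t₀ = x P.t₀ ∧ P.IsArc (mix u v l) ω (y l))
    (hyC : ∀ l ∈ Ioc (0 : ℝ) 1, ∀ t ∈ Icc P.t₀ P.T, ‖y l t - x t‖ ≤ l * C ∧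
      ‖P.dyn (y l t) (mix u v l t) ω - P.dyn (x t) (u t) ω‖ ≤ l * C)
    (hdiff : ∀ t ∈ Icc P.t₀ P.T, ∀ i, DifferentiableAt ℝ (fun y => P.f i y ω) (x t))
    (hg : DifferentiableAt ℝ (fun z => P.g z ω) (x P.T))
    (hp : HasVelocityOn p (fun t => -ContinuousLinearMap.adjoint
      (fderiv ℝ (fun y => P.dyn y (u t) ω) (x t)) (p t)) P.t₀ P.T)
    (hpT : -p P.T = gradient (fun z => P.g z ω) (x P.T)) (hT : P.t₀ ≤ P.T) :
    Tendsto (fun l => l⁻¹ * (P.g (y l P.T) ω - P.g (x P.T) ω)) (𝓝[>] 0)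
      (𝓝 (-∫ t in P.t₀..P.T, inner ℝ (p t) (P.dyn (x t) (v t) ω - P.dyn (x t) (u t) ω))) := by
  have hunit : ∀ᶠ l in 𝓝[>] (0 : ℝ), l ∈ Ioc (0 : ℝ) 1 := Ioc_mem_nhdsGT one_pos
  have hyT := isBigO_nhdsGT_of_norm_le fun l hl => (hyC l hl _ (right_mem_Icc.2 hT)).1
  have hsub := (tendsto_inv_smul_sub_of_hasFDerivAt hg.hasGradientAt.hasFDerivAt hyT).sub
    (tendsto_integral_inner_variation hK hu hv hx (fun l hl => (hy l hl).2) hyC hdiff hp hT)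
  rw [zero_sub] at hsub
  refine hsub.congr' ?_
  filter_upwards [hunit] with l hl
  rw [(hy l hl).1, sub_self, inner_zero_right, InnerProductSpace.toDual_apply_apply, ← hpT,
    inner_neg_left, smul_eq_mul]
  ring

end FirstVariation

section LocalMinimality

variable {x y : ℝ → Ω → State n}

theorem arcDist_le {y z : ℝ → State n} {B : ℝ≥0∞} (h : ∀ t ∈ Icc P.t₀ P.T, ‖y t - z t‖ₑ ≤ B)
    (hd : ∀ᵐ t ∂volume.restrict (Icc P.t₀ P.T), ‖deriv y t - deriv z t‖ₑ ≤ B) :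
    P.arcDist y z ≤ 2 * ENNReal.ofReal (P.T - P.t₀) * B := by
  refine (add_le_add (setLIntegral_mono' measurableSet_Icc h) (lintegral_mono_ae hd)).trans_eq ?_
  rw [setLIntegral_const, Real.volume_Icc]
  ring

theorem meanDist_le {B : ℝ≥0∞}
    (h : ∀ t ∈ Icc P.t₀ P.T, eLpNorm (fun ω => x t ω - y t ω) 2 P.μ ≤ B)
    (hd : ∀ᵐ t ∂volume.restrict (Icc P.t₀ P.T),
      eLpNorm (fun ω => deriv (fun s => x s ω) t - deriv (fun s => y s ω) t) 2 P.μ ≤ B) :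
    P.meanDist x y ≤ 2 * ENNReal.ofReal (P.T - P.t₀) * B := by
  refine (add_le_add (setLIntegral_mono' measurableSet_Icc h) (lintegral_mono_ae hd)).trans_eq ?_
  rw [setLIntegral_const, Real.volume_Icc]
  ring

/-- No convex variation `u + l (v - u)` with small `l` lowers the cost. This consequence of local
minimality, common to both notions of minimizer, is what the necessary conditions rest on. -/
def IsVariationallyMinimal (P : Problem n m Ω) (u : ℝ → Fin m → ℝ) (x : ℝ → Ω → State n) : Prop :=
  ∀ v, P.IsBoxControl v → ∀ᶠ l in 𝓝[>] (0 : ℝ), ∀ y, P.IsState (mix u v l) y →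
    P.cost x ≤ P.cost y

theorem IsState.ae_ae_hasDerivAt (hy : P.IsState u y) (hu : P.IsBoxControl u)
    (hK : P.HasBound K) (h0 : P.H0) (ht : P.t₀ ≤ P.T) (hφ : AEStronglyMeasurable P.φ P.μ) :
    ∀ᵐ t ∂volume.restrict (Icc P.t₀ P.T), ∀ᵐ ω ∂P.μ,
      HasDerivAt (fun s => y s ω) (P.dyn (y t ω) (u t) ω) t := by
  have := h0.prob
  obtain ⟨Y, hYm, hYc, hY⟩ := hy.exists_measurable_version hu hK h0 ht hφ
  have hd : Measurable fun q : ℝ × Ω => P.dyn (Y q.1 q.2) (u q.1) q.2 :=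
    (measurable_dyn h0).comp
      (hYm.prodMk ((hu.measurable.comp measurable_fst).prodMk measurable_snd))
  have hnhds : ∀ {ω t}, (∀ s ∈ Icc P.t₀ P.T, y s ω = Y s ω) → t ∈ Ioo P.t₀ P.T →
      (fun s => y s ω) =ᶠ[𝓝 t] fun s => Y s ω := fun h ht =>
    mem_of_superset (Icc_mem_nhds ht.1 ht.2) h
  have hYderiv := ae_ae_hasDerivAt_comm (ν := P.μ) (m := volume.restrict (Icc P.t₀ P.T))
    (d := fun t ω => P.dyn (Y t ω) (u t) ω) hYm hYc hd <| by
      filter_upwards [hY] with ω hω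
      filter_upwards [(hy ω).2.ae_hasDerivAt, ae_restrict_Icc_mem_Ioo P.t₀ P.T] with t hyt htm
      rw [← hω t (Ioo_subset_Icc_self htm)]
      exact hyt.congr_of_eventuallyEq (hnhds hω htm).symm
  filter_upwards [hYderiv, ae_restrict_Icc_mem_Ioo P.t₀ P.T] with t hYt htm
  filter_upwards [hYt, hY] with ω hYω hω
  rw [hω t (Ioo_subset_Icc_self htm)]
  exact hYω.congr_of_eventuallyEq (hnhds hω htm)

theorem eventually_mul_ofReal_mul_le {c A : ℝ≥0∞} (hc : c ≠ ∞) (hA : A ≠ ∞) {ε : ℝ}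
    (hε : 0 < ε) : ∀ᶠ l in 𝓝[>] (0 : ℝ), c * (ENNReal.ofReal l * A) ≤ ENNReal.ofReal ε := by
  have hl : Tendsto ENNReal.ofReal (𝓝[>] 0) (𝓝 0) :=
    ENNReal.ofReal_zero ▸ ENNReal.continuous_ofReal.continuousWithinAt.tendsto
  have hlim := ENNReal.Tendsto.const_mul (ENNReal.Tendsto.mul_const hl (Or.inr hA)) (Or.inr hc)
  rw [zero_mul, mul_zero] at hlim
  exact (hlim.eventually_lt_const (ENNReal.ofReal_pos.2 hε)).mono fun _ => le_of_lt

section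

variable (hx : P.IsState u x) (hu : P.IsBoxControl u) (h0 : P.H0) (ht : P.t₀ ≤ P.T)
  {u₀ : ℝ → Fin m → ℝ}

include hx hu h0 ht

theorem IsLocalMinimizer.isVariationallyMinimal [TopologicalSpace Ω]
    (hmin : P.IsLocalMinimizer u₀ x) {r : ℝ} (hr : ∀ ω ∈ P.μ.support, ‖P.φ ω‖ ≤ r) :
    P.IsVariationallyMinimal u x := by
  obtain ⟨-, ε, hε, hopt⟩ := hmin
  obtain ⟨K, hK⟩ := h0.exists_hasBound
  obtain ⟨C, hC, hvar⟩ := hK.exists_norm_sub_le_of_mix ht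
  intro v hv
  have hA : ENNReal.ofReal (C * (1 + r)) ≠ ∞ := ENNReal.ofReal_ne_top
  filter_upwards [eventually_mul_ofReal_mul_le (c := 2 * ENNReal.ofReal (P.T - P.t₀))
    (by finiteness) hA hε, Ioc_mem_nhdsGT one_pos] with l hl hl₁ y hy
  have hlI := Ioc_subset_Icc_self hl₁
  refine hopt _ _ ((hu.mix hv hlI).isAdmissible hy) fun ω hω => le_trans (arcDist_le ?_ ?_) hl
  all_goals
    have hvarω := hvar hu hv hlI (hx ω).2 (hy ω).2 ((hy ω).1.trans (hx ω).1.symm)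
    have hbound : l * (C * (1 + ‖x P.t₀ ω‖)) ≤ l * (C * (1 + r)) := by
      have := hlI.1
      rw [(hx ω).1]
      gcongr
      exact hr ω hω
    rw [← ENNReal.ofReal_mul hlI.1]
  · intro t ht
    rw [← ofReal_norm, norm_sub_rev]
    exact ENNReal.ofReal_le_ofReal ((hvarω t ht).1.trans hbound)
  · filter_upwards [(hx ω).2.ae_hasDerivAt, (hy ω).2.ae_hasDerivAt,
      ae_restrict_mem measurableSet_Icc] with t hxt hyt ht
    rw [hxt.deriv, hyt.deriv, ← ofReal_norm, norm_sub_rev]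
    exact ENNReal.ofReal_le_ofReal ((hvarω t ht).2.trans hbound)

theorem IsMeanLocalMinimizer.isVariationallyMinimal (hφ : MemLp P.φ 2 P.μ)
    (hmin : P.IsMeanLocalMinimizer u₀ x) : P.IsVariationallyMinimal u x := by
  have := h0.prob
  obtain ⟨-, ε, hε, hopt⟩ := hmin
  obtain ⟨K, hK⟩ := h0.exists_hasBound
  obtain ⟨C, hC, hvar⟩ := hK.exists_norm_sub_le_of_mix ht
  intro v hv
  have hA : eLpNorm (fun ω => C * (1 + ‖P.φ ω‖)) 2 P.μ ≠ ∞ :=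
    (((memLp_const (1 : ℝ)).add hφ.norm).const_mul C).eLpNorm_ne_top
  filter_upwards [eventually_mul_ofReal_mul_le (c := 2 * ENNReal.ofReal (P.T - P.t₀))
    (by finiteness) hA hε, Ioc_mem_nhdsGT one_pos] with l hl hl₁ y hy
  have hlI := Ioc_subset_Icc_self hl₁
  have hw := hu.mix hv hlI
  have hvarω : ∀ ω, ∀ t ∈ Icc P.t₀ P.T, ‖x t ω - y t ω‖ ≤ l * ‖C * (1 + ‖P.φ ω‖)‖ ∧
      ‖P.dyn (x t ω) (u t) ω - P.dyn (y t ω) (mix u v l t) ω‖ ≤ l * ‖C * (1 + ‖P.φ ω‖)‖ := by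
    intro ω t ht
    rw [Real.norm_of_nonneg (by positivity), ← (hx ω).1, norm_sub_rev, norm_sub_rev (P.dyn _ _ _)]
    exact hvar hu hv hlI (hx ω).2 (hy ω).2 ((hy ω).1.trans (hx ω).1.symm) t ht
  refine hopt _ _ (hw.isAdmissible hy) ((meanDist_le (fun t ht => ?_) ?_).trans hl)
  · exact eLpNorm_le_mul_eLpNorm_of_ae_le_mul (Eventually.of_forall fun ω => (hvarω ω t ht).1) 2
  · filter_upwards [hx.ae_ae_hasDerivAt hu hK h0 ht hφ.1, hy.ae_ae_hasDerivAt hw hK h0 ht hφ.1,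
      ae_restrict_mem measurableSet_Icc] with t hxt hyt ht
    refine eLpNorm_le_mul_eLpNorm_of_ae_le_mul ?_ 2
    filter_upwards [hxt, hyt] with ω hxω hyω
    rw [hxω.deriv, hyω.deriv]
    exact (hvarω ω t ht).2

end

end LocalMinimality

section VariationalInequality

variable {x X p : ℝ → Ω → State n} {C : ℝ}

theorem H0.integrable_g (h0 : P.H0) {y : Ω → State n} (hy : AEMeasurable y P.μ) :
    Integrable (fun ω => P.g (y ω) ω) P.μ := by
  have := h0.prob
  obtain ⟨M, -, hM⟩ := h0.g_bounded
  exact Integrable.of_bound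
    (h0.g_measurable.comp_aemeasurable (hy.prodMk aemeasurable_id)).aestronglyMeasurable M
    (Eventually.of_forall fun ω => hM _ _)

theorem IsState.aemeasurable {y : ℝ → Ω → State n} (hy : P.IsState u y) (hu : P.IsBoxControl u)
    (hK : P.HasBound K) (h0 : P.H0) (hφ : AEStronglyMeasurable P.φ P.μ) {t : ℝ}
    (ht : t ∈ Icc P.t₀ P.T) : AEMeasurable (y t) P.μ := by
  obtain ⟨Y, hYm, -, hY⟩ := hy.exists_measurable_version hu hK h0 (ht.1.trans ht.2) hφ
  exact ⟨Y t, hYm.comp measurable_prodMk_left, hY.mono fun ω h => h t ht⟩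

theorem IsReference.exists_variations (R : P.IsReference u x X K) (hv : P.IsBoxControl v) :
    ∃ (y : ℝ → ℝ → Ω → State n) (D : ℝ), ∀ l ∈ Ioc (0 : ℝ) 1, P.IsState (mix u v l) (y l) ∧
      ∀ ω, ∀ t ∈ Icc P.t₀ P.T, ‖y l t ω - x t ω‖ ≤ l * (D * (1 + ‖P.φ ω‖)) ∧
        ‖P.dyn (y l t ω) (mix u v l t) ω - P.dyn (x t ω) (u t) ω‖ ≤
          l * (D * (1 + ‖P.φ ω‖)) := by
  obtain ⟨D, -, hvar⟩ := R.bound.exists_norm_sub_le_of_mix R.lt.le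
  have hex : ∀ l, ∃ y, l ∈ Ioc (0 : ℝ) 1 → P.IsState (mix u v l) y := fun l => by
    by_cases hl : l ∈ Ioc (0 : ℝ) 1
    · obtain ⟨y, hy⟩ :=
        (R.control.mix hv (Ioc_subset_Icc_self hl)).exists_isState R.bound R.data R.lt.le
      exact ⟨y, fun _ => hy⟩
    · exact ⟨x, fun h => (hl h).elim⟩
  choose y hy using hex
  refine ⟨y, D, fun l hl => ⟨hy l hl, fun ω => (R.state ω).1 ▸ hvar R.control hv
    (Ioc_subset_Icc_self hl) (R.state ω).2 (hy l hl ω).2 ?_⟩⟩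
  rw [(hy l hl ω).1, (R.state ω).1]

theorem IsReference.integral_integral_variation_le (R : P.IsReference u x X K)
    (hp : P.IsRegularCostate u x p C) (hmin : P.IsVariationallyMinimal u x)
    (hv : P.IsBoxControl v) :
    ∫ ω, (∫ t in P.t₀..P.T,
      inner ℝ (p t ω) (P.dyn (x t ω) (v t) ω - P.dyn (x t ω) (u t) ω)) ∂P.μ ≤ 0 := by
  have := R.data.prob
  have hT := right_mem_Icc.2 R.lt.le
  obtain ⟨y, D, hyD⟩ := R.exists_variations hv
  have hunit : ∀ᶠ l in 𝓝[>] (0 : ℝ), l ∈ Ioc (0 : ℝ) 1 := Ioc_mem_nhdsGT one_pos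
  have hgx := R.data.integrable_g
    (R.state.aemeasurable R.control R.bound R.data R.initial.1 hT)
  have hgy : ∀ l ∈ Ioc (0 : ℝ) 1, Integrable (fun ω => P.g (y l P.T ω) ω) P.μ := fun l hl =>
    R.data.integrable_g ((hyD l hl).1.aemeasurable
      (R.control.mix hv (Ioc_subset_Icc_self hl)) R.bound R.data R.initial.1 hT)
  have hlim : Tendsto (fun l => ∫ ω, l⁻¹ * (P.g (y l P.T ω) ω - P.g (x P.T ω) ω) ∂P.μ) (𝓝[>] 0)
      (𝓝 (∫ ω, (-∫ t in P.t₀..P.T,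
        inner ℝ (p t ω) (P.dyn (x t ω) (v t) ω - P.dyn (x t ω) (u t) ω)) ∂P.μ)) := by
    refine tendsto_integral_filter_of_dominated_convergence
      (fun ω => K * (D * (1 + ‖P.φ ω‖))) ?_ ?_ ?_ ?_
    · filter_upwards [hunit] with l hl
      exact (((hgy l hl).sub hgx).const_mul _).aestronglyMeasurable
    · filter_upwards [hunit] with l hl
      refine Eventually.of_forall fun ω => ?_
      rw [norm_mul, norm_inv, Real.norm_of_nonneg hl.1.le, inv_mul_le_iff₀ hl.1, mul_left_comm]
      exact (R.bound.g_lipschitz _ _ _).trans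
        (mul_le_mul_of_nonneg_left ((hyD l hl).2 ω _ hT).1 R.bound.pos.le)
    · exact (((integrable_const (1 : ℝ)).add
        (R.initial.integrable one_le_two).norm).const_mul D).const_mul K
    · filter_upwards [hp.hasVelocityOn, hp.terminal, R.regular.differentiableAt_f,
        R.regular.g_differentiableAt] with ω hpω hpT hf hg
      exact tendsto_inv_mul_cost_sub R.bound R.control hv (R.state ω).2
        (fun l hl => ⟨((hyD l hl).1 ω).1.trans (R.state ω).1.symm, ((hyD l hl).1 ω).2⟩)
        (fun l hl => (hyD l hl).2 ω) hf hg hpω hpT R.lt.le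
  rw [integral_neg] at hlim
  refine neg_nonneg.1 (ge_of_tendsto hlim ?_)
  filter_upwards [hmin v hv, hunit] with l hcost hl
  rw [integral_const_mul, integral_sub (hgy l hl) hgx]
  exact mul_nonneg (inv_nonneg.2 hl.1.le) (sub_nonneg.2 (hcost _ (hyD l hl).1))

end VariationalInequality

end Problem

/-! ### The maximum principle -/

section DominatedFamilies

variable {Ω F : Type*} [MeasurableSpace Ω] {μ : Measure Ω} {a b t : ℝ} [NormedAddCommGroup F]
  [MeasurableSpace F]

/-- A family of functions of the parameter, indexed by the time in `[a, b]`, which for almost every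
parameter agrees with a jointly measurable family and is dominated, uniformly in time, by an
integrable function of the parameter. -/
structure IsDominatedOn (μ : Measure Ω) (a b : ℝ) (w : ℝ → Ω → F) : Prop where
  exists_measurable : ∃ w' : ℝ → Ω → F, (Measurable fun q : ℝ × Ω => w' q.1 q.2) ∧
    ∀ᵐ ω ∂μ, ∀ t ∈ Icc a b, w t ω = w' t ω
  exists_bound : ∃ B : Ω → ℝ, Integrable B μ ∧ ∀ᵐ ω ∂μ, ∀ t ∈ Icc a b, ‖w t ω‖ ≤ B ω

namespace IsDominatedOn

variable {w w' : ℝ → Ω → F}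

theorem mono {c d : ℝ} (hw : IsDominatedOn μ a b w) (hcd : Icc c d ⊆ Icc a b) :
    IsDominatedOn μ c d w := by
  obtain ⟨w', hw'm, hw'⟩ := hw.exists_measurable
  obtain ⟨B, hB, hwB⟩ := hw.exists_bound
  exact ⟨⟨w', hw'm, hw'.mono fun _ h t ht => h t (hcd ht)⟩,
    ⟨B, hB, hwB.mono fun _ h t ht => h t (hcd ht)⟩⟩

section

variable [BorelSpace F] [SecondCountableTopology F]

theorem integrable (hw : IsDominatedOn μ a b w) (ht : t ∈ Icc a b) : Integrable (w t) μ := by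
  obtain ⟨w', hw'm, hw'⟩ := hw.exists_measurable
  obtain ⟨B, hB, hwB⟩ := hw.exists_bound
  exact hB.mono' ⟨w' t, (hw'm.comp measurable_prodMk_left).stronglyMeasurable,
    hw'.mono fun ω h => h t ht⟩ (hwB.mono fun ω h => h t ht)

theorem integrable_prod [SFinite μ] (hw : IsDominatedOn μ a b w) :
    Integrable (fun q : ℝ × Ω => w q.1 q.2) ((volume.restrict (Icc a b)).prod μ) := by
  obtain ⟨w', hw'm, hw'⟩ := hw.exists_measurable
  obtain ⟨B, hB, hwB⟩ := hw.exists_bound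
  have hmem : ∀ᵐ q ∂(volume.restrict (Icc a b)).prod μ, q.1 ∈ Icc a b :=
    Measure.quasiMeasurePreserving_fst.ae (ae_restrict_mem measurableSet_Icc)
  refine (hB.comp_snd (volume.restrict (Icc a b))).mono'
    ⟨_, hw'm.stronglyMeasurable, ?_⟩ ?_
  · filter_upwards [hmem, Measure.quasiMeasurePreserving_snd.ae hw'] with q hq h using h _ hq
  · filter_upwards [hmem, Measure.quasiMeasurePreserving_snd.ae hwB] with q hq h using h _ hq

theorem sub (hw : IsDominatedOn μ a b w) (hw' : IsDominatedOn μ a b w') :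
    IsDominatedOn μ a b fun t ω => w t ω - w' t ω := by
  obtain ⟨z, hzm, hz⟩ := hw.exists_measurable
  obtain ⟨z', hz'm, hz'⟩ := hw'.exists_measurable
  obtain ⟨B, hB, hwB⟩ := hw.exists_bound
  obtain ⟨B', hB', hwB'⟩ := hw'.exists_bound
  refine ⟨⟨fun t ω => z t ω - z' t ω, hzm.sub hz'm, ?_⟩, ⟨fun ω => B ω + B' ω, hB.add hB', ?_⟩⟩
  · filter_upwards [hz, hz'] with ω h h' t ht
    rw [h t ht, h' t ht]
  · filter_upwards [hwB, hwB'] with ω h h' t ht using norm_sub_le_of_le (h t ht) (h' t ht)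

end

theorem inner {F : Type*} [NormedAddCommGroup F] [InnerProductSpace ℝ F] [MeasurableSpace F]
    [BorelSpace F] [SecondCountableTopology F] {p w : ℝ → Ω → F} {C : ℝ}
    (hp : Measurable fun q : ℝ × Ω => p q.1 q.2)
    (hpC : ∀ᵐ ω ∂μ, ∀ t ∈ Icc a b, ‖p t ω‖ ≤ C) (hw : IsDominatedOn μ a b w) :
    IsDominatedOn μ a b fun t ω => inner ℝ (p t ω) (w t ω) := by
  obtain ⟨w', hw'm, hw'⟩ := hw.exists_measurable
  obtain ⟨B, hB, hwB⟩ := hw.exists_bound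
  refine ⟨⟨fun t ω => Inner.inner ℝ (p t ω) (w' t ω), hp.inner hw'm, ?_⟩,
    ⟨fun ω => C * B ω, hB.const_mul C, ?_⟩⟩
  · filter_upwards [hw'] with ω h t ht
    rw [h t ht]
  · filter_upwards [hpC, hwB] with ω hC hB t ht
    exact (norm_inner_le_norm _ _).trans
      (mul_le_mul (hC t ht) (hB t ht) (norm_nonneg _) ((norm_nonneg _).trans (hC t ht)))

end IsDominatedOn

end DominatedFamilies

namespace Problem

variable {n m : ℕ} {Ω : Type*} [MeasurableSpace Ω] {P : Problem n m Ω}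
  {u v : ℝ → Fin m → ℝ} {x X p : ℝ → Ω → State n} {K C t : ℝ}

theorem IsRegularCostate.isDominatedOn_inner (hp : P.IsRegularCostate u x p C)
    {w : ℝ → Ω → State n} (hw : IsDominatedOn P.μ P.t₀ P.T w) :
    IsDominatedOn P.μ P.t₀ P.T fun t ω => inner ℝ (p t ω) (w t ω) :=
  hw.inner hp.measurable hp.bound

namespace IsReference

theorem exists_integrable_bound (R : P.IsReference u x X K) : ∃ B : Ω → ℝ, MemLp B 2 P.μ ∧
    ∀ ω, ∀ t ∈ Icc P.t₀ P.T, 1 + ‖x t ω‖ ≤ B ω := by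
  have := R.data.prob
  obtain ⟨D, -, hD⟩ := R.bound.exists_one_add_norm_le R.lt.le
  refine ⟨fun ω => D * (1 + ‖P.φ ω‖), ((memLp_const (1 : ℝ)).add R.initial.norm).const_mul D,
    fun ω t ht => ?_⟩
  have h := hD R.control (R.state ω).2 t ht
  rwa [(R.state ω).1] at h

theorem isDominatedOn_of_growth (R : P.IsReference u x X K) {G : ℝ → Ω → State n → State n}
    (hG : Measurable fun q : ℝ × Ω => G q.1 q.2 (X q.1 q.2))
    (hgrowth : ∀ t ω y, ‖G t ω y‖ ≤ K * (1 + ‖y‖)) :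
    IsDominatedOn P.μ P.t₀ P.T fun t ω => G t ω (x t ω) := by
  have := R.data.prob
  obtain ⟨B, hB, hxB⟩ := R.exists_integrable_bound
  refine ⟨⟨_, hG, R.eq.mono fun ω h t ht => by rw [h t ht]⟩, ⟨fun ω => K * B ω,
    (hB.integrable one_le_two).const_mul K, Eventually.of_forall fun ω t ht => ?_⟩⟩
  exact (hgrowth t ω _).trans (mul_le_mul_of_nonneg_left (hxB ω t ht) R.bound.pos.le)

theorem isDominatedOn_f (R : P.IsReference u x X K) (i : Fin (m + 1)) :
    IsDominatedOn P.μ P.t₀ P.T fun t ω => P.f i (x t ω) ω :=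
  R.isDominatedOn_of_growth (G := fun _ ω y => P.f i y ω)
    ((R.data.f_measurable i).comp (R.measurable.prodMk measurable_snd))
    fun _ ω y => R.bound.f_growth i y ω

theorem isDominatedOn_dyn (R : P.IsReference u x X K) (hv : P.IsBoxControl v) :
    IsDominatedOn P.μ P.t₀ P.T fun t ω => P.dyn (x t ω) (v t) ω :=
  R.isDominatedOn_of_growth (G := fun t ω y => P.dyn y (v t) ω)
    ((measurable_dyn R.data).comp
      (R.measurable.prodMk ((hv.measurable.comp measurable_fst).prodMk measurable_snd)))
    fun t ω y => R.bound.dyn_growth _ (hv.mem t) y ω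

end IsReference

section MaximumPrinciple

theorem dyn_sub_dyn_control (y : State n) (w w' : Fin m → ℝ) (ω : Ω) :
    P.dyn y w ω - P.dyn y w' ω = ∑ j, (w j - w' j) • P.f j.succ y ω := by
  simp only [dyn, sub_smul, Finset.sum_sub_distrib, add_sub_add_left_eq_sub]

theorem IsReference.integral_inner_dyn_sub (R : P.IsReference u x X K)
    (hp : P.IsRegularCostate u x p C) (w w' : Fin m → ℝ) (ht : t ∈ Icc P.t₀ P.T) :
    ∫ ω, inner ℝ (p t ω) (P.dyn (x t ω) w ω - P.dyn (x t ω) w' ω) ∂P.μ =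
      ∑ j, (w j - w' j) * P.switching x p j t := by
  simp only [dyn_sub_dyn_control, inner_sum, real_inner_smul_right]
  rw [integral_finsetSum _ fun j _ =>
    ((hp.isDominatedOn_inner (R.isDominatedOn_f j.succ)).integrable ht).const_mul _]
  simp only [integral_const_mul, switching]

theorem IsReference.integrableOn_and_integral_le (R : P.IsReference u x X K)
    (hp : P.IsRegularCostate u x p C) (hmin : P.IsVariationallyMinimal u x)
    (hv : P.IsBoxControl v) :
    IntegrableOn (fun t => ∑ j, (v t j - u t j) * P.switching x p j t) (Icc P.t₀ P.T) ∧
      ∫ t in Icc P.t₀ P.T, ∑ j, (v t j - u t j) * P.switching x p j t ≤ 0 := by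
  have := R.data.prob
  have hint := (hp.isDominatedOn_inner
    ((R.isDominatedOn_dyn hv).sub (R.isDominatedOn_dyn R.control))).integrable_prod
  have hsum : EqOn (fun t => ∫ ω,
      inner ℝ (p t ω) (P.dyn (x t ω) (v t) ω - P.dyn (x t ω) (u t) ω) ∂P.μ)
      (fun t => ∑ j, (v t j - u t j) * P.switching x p j t) (Icc P.t₀ P.T) :=
    fun t ht => R.integral_inner_dyn_sub hp (v t) (u t) ht
  refine ⟨(integrableOn_congr_fun hsum measurableSet_Icc).1 hint.integral_prod_left, ?_⟩
  rw [← setIntegral_congr_fun measurableSet_Icc hsum, integral_integral_swap hint]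
  simp only [integral_Icc_eq_integral_Ioc, ← intervalIntegral.integral_of_le R.lt.le]
  exact R.integral_integral_variation_le hp hmin hv

/-- The control whose `j`-th component is the point of `[uminⱼ, umaxⱼ]` maximizing `s ↦ s Ψⱼ(t)`,
and `uⱼ(t)` where `Ψⱼ(t) = 0`. -/
noncomputable def bangControl (P : Problem n m Ω) (u : ℝ → Fin m → ℝ) (Ψ : Fin m → ℝ → ℝ)
    (t : ℝ) (j : Fin m) : ℝ :=
  if 0 < Ψ j t then P.umax j else if Ψ j t < 0 then P.umin j else u t j

section BangControl

variable {Ψ : Fin m → ℝ → ℝ}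

theorem IsBoxControl.bangControl (hu : P.IsBoxControl u) (hΨ : ∀ j, Measurable (Ψ j)) :
    P.IsBoxControl (P.bangControl u Ψ) := by
  have hbox : ∀ j, P.umin j ≤ P.umax j := fun j => ((hu.mem 0).1 j).trans ((hu.mem 0).2 j)
  refine ⟨measurable_pi_lambda _ fun j => ?_, fun t => ⟨fun j => ?_, fun j => ?_⟩⟩
  · exact Measurable.ite (measurableSet_lt measurable_const (hΨ j)) measurable_const
      (Measurable.ite (measurableSet_lt (hΨ j) measurable_const) measurable_const
        ((measurable_pi_apply j).comp hu.measurable))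
  · unfold Problem.bangControl
    split_ifs
    exacts [hbox j, le_rfl, (hu.mem t).1 j]
  · unfold Problem.bangControl
    split_ifs
    exacts [le_rfl, hbox j, (hu.mem t).2 j]

theorem IsBoxControl.bangControl_sub_mul_nonneg (hu : P.IsBoxControl u) (t : ℝ) (j : Fin m) :
    0 ≤ (P.bangControl u Ψ t j - u t j) * Ψ j t := by
  unfold Problem.bangControl
  split_ifs with hpos hneg
  · exact mul_nonneg (sub_nonneg.2 ((hu.mem t).2 j)) hpos.le
  · exact mul_nonneg_of_nonpos_of_nonpos (sub_nonpos.2 ((hu.mem t).1 j)) hneg.le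
  · rw [sub_self, zero_mul]

theorem eq_bound_of_bangControl_sub_mul_eq_zero {j : Fin m}
    (h : (P.bangControl u Ψ t j - u t j) * Ψ j t = 0) :
    (0 < Ψ j t → u t j = P.umax j) ∧ (Ψ j t < 0 → u t j = P.umin j) := by
  unfold Problem.bangControl at h
  refine ⟨fun hpos => ?_, fun hneg => ?_⟩
  · rw [if_pos hpos, mul_eq_zero_iff_right hpos.ne', sub_eq_zero] at h
    exact h.symm
  · rw [if_neg hneg.not_gt, if_pos hneg, mul_eq_zero_iff_right hneg.ne, sub_eq_zero] at h
    exact h.symm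

end BangControl

theorem measurable_switching [SFinite P.μ] (h0 : P.H0)
    (hX : Measurable fun q : ℝ × Ω => X q.1 q.2) (hp : Measurable fun q : ℝ × Ω => p q.1 q.2)
    (j : Fin m) : Measurable (P.switching X p j) :=
  (StronglyMeasurable.integral_prod_right (ν := P.μ)
    (f := fun t ω => inner ℝ (p t ω) (P.f j.succ (X t ω) ω))
    (hp.inner ((h0.f_measurable j.succ).comp (hX.prodMk measurable_snd))).stronglyMeasurable
    ).measurable

theorem IsReference.switching_eq (R : P.IsReference u x X K) (p : ℝ → Ω → State n) (j : Fin m)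
    (ht : t ∈ Icc P.t₀ P.T) : P.switching X p j t = P.switching x p j t :=
  integral_congr_ae (R.eq.mono fun ω h => by simp only [h t ht])

theorem IsReference.ae_eq_umax_and_eq_umin (R : P.IsReference u x X K)
    (hp : P.IsRegularCostate u x p C) (hmin : P.IsVariationallyMinimal u x) :
    ∀ᵐ t ∂volume.restrict (Icc P.t₀ P.T), ∀ j,
      (0 < P.switching x p j t → u t j = P.umax j) ∧
      (P.switching x p j t < 0 → u t j = P.umin j) := by
  have := R.data.prob
  let v := P.bangControl u (P.switching X p)
  have hv : P.IsBoxControl v :=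
    R.control.bangControl (measurable_switching R.data R.measurable hp.measurable)
  obtain ⟨hint, hle⟩ := R.integrableOn_and_integral_le hp hmin hv
  have hnonneg : ∀ t ∈ Icc P.t₀ P.T, ∀ j, 0 ≤ (v t j - u t j) * P.switching x p j t :=
    fun t ht j => R.switching_eq p j ht ▸ R.control.bangControl_sub_mul_nonneg t j
  have hsum : ∀ t ∈ Icc P.t₀ P.T, 0 ≤ ∑ j, (v t j - u t j) * P.switching x p j t :=
    fun t ht => Finset.sum_nonneg fun j _ => hnonneg t ht j
  have hmem : ∀ᵐ t ∂volume.restrict (Icc P.t₀ P.T), t ∈ Icc P.t₀ P.T :=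
    ae_restrict_mem measurableSet_Icc
  have hzero := (setIntegral_eq_zero_iff_of_nonneg_ae (hmem.mono hsum) hint).1
    (hle.antisymm (setIntegral_nonneg measurableSet_Icc hsum))
  filter_upwards [hzero, hmem] with t ht₀ ht j
  rw [← R.switching_eq p j ht]
  refine eq_bound_of_bangControl_sub_mul_eq_zero ?_
  rw [R.switching_eq p j ht]
  exact (Finset.sum_eq_zero_iff_of_nonneg fun j _ => hnonneg t ht j).1 ht₀ j (Finset.mem_univ j)

end MaximumPrinciple

end Problem

/-! ### Singular arcs -/

theorem exists_lipschitzOnWith_comp_of_contDiffAt {E F : Type*} [NormedAddCommGroup E]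
    [NormedSpace ℝ E] [NormedAddCommGroup F] [NormedSpace ℝ F] {G : E → F} {x : ℝ → E} {a b : ℝ}
    {L : NNReal} (hx : LipschitzOnWith L x (Icc a b))
    (hG : ∀ t ∈ Icc a b, ContDiffAt ℝ 1 G (x t)) :
    ∃ N, LipschitzOnWith N (fun t => G (x t)) (Icc a b) := by
  refine LocallyLipschitzOn.exists_lipschitzOnWith_of_compact isCompact_Icc fun t ht => ?_
  obtain ⟨N, s, hs, hN⟩ := (hG t ht).exists_lipschitzOnWith
  refine ⟨N * L, x ⁻¹' s ∩ Icc a b, inter_mem ((hx.continuousOn t ht) hs) self_mem_nhdsWithin, ?_⟩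
  exact hN.comp (hx.mono inter_subset_right) fun r hr => hr.1

theorem lieBracket_lieBracket_comm {E : Type*} [NormedAddCommGroup E] [NormedSpace ℝ E]
    {U V W : E → E} {y : E} (hU : ContDiffAt ℝ 2 U y) (hV : ContDiffAt ℝ 2 V y)
    (hW : ContDiffAt ℝ 2 W y) (hUW : VectorField.lieBracket ℝ U W =ᶠ[𝓝 y] 0) :
    VectorField.lieBracket ℝ U (VectorField.lieBracket ℝ V W) y =
      VectorField.lieBracket ℝ W (VectorField.lieBracket ℝ V U) y := by
  have hjacobi := VectorField.leibniz_identity_lieBracket (𝕜 := ℝ) (n := 2) (by simp) hU hV hW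
  have hVUW : VectorField.lieBracket ℝ V (VectorField.lieBracket ℝ U W) y = 0 := by
    rw [(EventuallyEq.refl (𝓝 y) V).lieBracket_vectorField_eq hUW,
      VectorField.lieBracket_zero_right]
    rfl
  have hswap : VectorField.lieBracket ℝ U V = -VectorField.lieBracket ℝ V U :=
    funext fun z => VectorField.lieBracket_swap
  rw [hjacobi, hVUW, add_zero, VectorField.lieBracket_swap, hswap]
  simp only [VectorField.lieBracket_eq, fderiv_neg, Pi.neg_apply, map_neg, neg_apply]
  abel

namespace Problem

variable {n m : ℕ} {Ω : Type*} [MeasurableSpace Ω] {P : Problem n m Ω}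
  {u : ℝ → Fin m → ℝ}

theorem hasVelocityOn_inner_comp {ω : Ω} {K : ℝ} {x p : ℝ → State n} {G : State n → State n}
    (hK : P.HasBound K) (hu : P.IsBoxControl u) (hx : P.IsArc u ω x)
    (hp : HasVelocityOn p (fun t => -ContinuousLinearMap.adjoint
      (fderiv ℝ (fun y => P.dyn y (u t) ω) (x t)) (p t)) P.t₀ P.T)
    (hf : ∀ t ∈ Icc P.t₀ P.T, ∀ i, DifferentiableAt ℝ (fun y => P.f i y ω) (x t))
    (hG : ∀ t ∈ Icc P.t₀ P.T, ContDiffAt ℝ 1 G (x t)) :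
    HasVelocityOn (fun t => inner ℝ (p t) (G (x t)))
      (fun t => inner ℝ (p t) (VectorField.lieBracket ℝ (fun y => P.f 0 y ω) G (x t)) +
        ∑ j, u t j * inner ℝ (p t)
          (VectorField.lieBracket ℝ (fun y => P.f j.succ y ω) G (x t))) P.t₀ P.T := by
  obtain ⟨L, hL⟩ := hx.exists_lipschitzOnWith hK hu
  obtain ⟨M, hM⟩ := exists_lipschitzOnWith_comp_of_contDiffAt hL hG
  obtain ⟨D, hD⟩ := exists_lipschitzOnWith_of_adjoint hK hu hp
  obtain ⟨N, hN⟩ := exists_lipschitzOnWith_inner isCompact_Icc hD hM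
  refine HasVelocityOn.of_lipschitzOnWith hN ?_
  filter_upwards [hp.ae_hasDerivAt, hx.ae_hasDerivAt, ae_restrict_mem measurableSet_Icc]
    with t hpt hxt ht
  refine (hasDerivAt_inner_lieBracket (D := fun y => P.dyn y (u t) ω)
    ((hG t ht).differentiableAt (by simp)) hxt hpt).congr_deriv ?_
  rw [lieBracket_dyn (hf t ht), inner_add_right, inner_sum]
  simp only [real_inner_smul_right]

section Brackets

variable {x X p : ℝ → Ω → State n} {K C t : ℝ}

namespace IsReference

theorem isDominatedOn_lieBracket (R : P.IsReference u x X K) (i j : Fin (m + 1)) :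
    IsDominatedOn P.μ P.t₀ P.T fun t ω =>
      VectorField.lieBracket ℝ (fun y => P.f i y ω) (fun y => P.f j y ω) (x t ω) := by
  have := R.data.prob
  refine ⟨⟨fun t ω => paramLieBracket (fun q : State n × Ω => P.f i q.1 q.2)
    (fun q : State n × Ω => P.f j q.1 q.2) (X t ω, ω), ?_, ?_⟩, ?_⟩
  · exact (measurable_paramLieBracket (R.data.f_measurable i) (R.data.f_measurable j)).comp
      (R.measurable.prodMk measurable_snd)
  · filter_upwards [R.eq, R.regular.differentiableAt_f] with ω hω hf t ht
    rw [← hω t ht]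
    exact (paramLieBracket_eq (V := fun q : State n × Ω => P.f i q.1 q.2)
      (W := fun q : State n × Ω => P.f j q.1 q.2) (hf t ht i) (hf t ht j)).symm
  · obtain ⟨B, hB, hxB⟩ := R.exists_integrable_bound
    have hgrowth : ∀ i ω, ∀ t ∈ Icc P.t₀ P.T, ‖P.f i (x t ω) ω‖ ≤ K * B ω := fun i ω t ht =>
      (R.bound.f_growth i _ ω).trans (mul_le_mul_of_nonneg_left (hxB ω t ht) R.bound.pos.le)
    have hKB := ((hB.integrable one_le_two).const_mul K).const_mul K
    exact ⟨_, hKB.add hKB, Eventually.of_forall fun ω t ht =>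
      norm_lieBracket_le (R.bound.norm_fderiv_f_le i ω _) (hgrowth i ω t ht)
        (R.bound.norm_fderiv_f_le j ω _) (hgrowth j ω t ht)⟩

theorem exists_integrable_norm_lieBracket_lieBracket_le (R : P.IsReference u x X K)
    (i j k : Fin (m + 1)) : ∃ B : Ω → ℝ, Integrable B P.μ ∧ ∀ᵐ ω ∂P.μ, ∀ t ∈ Icc P.t₀ P.T,
      ‖VectorField.lieBracket ℝ (fun y => P.f i y ω)
        (VectorField.lieBracket ℝ (fun y => P.f j y ω) (fun y => P.f k y ω)) (x t ω)‖ ≤ B ω := by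
  have := R.data.prob
  obtain ⟨B, hB, hxB⟩ := R.exists_integrable_bound
  obtain ⟨D, hD⟩ := R.regular.exists_norm_fderiv_fderiv_le
  have hgrowth : ∀ i ω, ∀ t ∈ Icc P.t₀ P.T, ‖P.f i (x t ω) ω‖ ≤ K * B ω := fun i ω t ht =>
    (R.bound.f_growth i _ ω).trans (mul_le_mul_of_nonneg_left (hxB ω t ht) R.bound.pos.le)
  refine ⟨fun ω => 4 * K ^ 3 * B ω + 2 * D * K ^ 2 * B ω ^ 2,
    ((hB.integrable one_le_two).const_mul _).add (hB.integrable_sq.const_mul _), ?_⟩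
  filter_upwards [hD, R.regular.f_contDiffAt] with ω hD hf t ht
  exact (norm_lieBracket_lieBracket_le (hf t ht j) (hf t ht k) (R.bound.norm_fderiv_f_le i ω _)
    (R.bound.norm_fderiv_f_le j ω _) (R.bound.norm_fderiv_f_le k ω _) (hgrowth i ω t ht)
    (hgrowth j ω t ht) (hgrowth k ω t ht) (hD t ht j) (hD t ht k)).trans_eq (by ring)

theorem isDominatedOn_lieBracket_lieBracket (R : P.IsReference u x X K) (i j k : Fin (m + 1)) :
    IsDominatedOn P.μ P.t₀ P.T fun t ω => VectorField.lieBracket ℝ (fun y => P.f i y ω)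
      (VectorField.lieBracket ℝ (fun y => P.f j y ω) (fun y => P.f k y ω)) (x t ω) := by
  refine ⟨⟨fun t ω => paramLieBracket (fun q : State n × Ω => P.f i q.1 q.2)
    (paramLieBracket (fun q : State n × Ω => P.f j q.1 q.2)
      fun q : State n × Ω => P.f k q.1 q.2) (X t ω, ω), ?_, ?_⟩,
    R.exists_integrable_norm_lieBracket_lieBracket_le i j k⟩
  · exact (measurable_paramLieBracket (R.data.f_measurable i)
      (measurable_paramLieBracket (R.data.f_measurable j) (R.data.f_measurable k))).comp
      (R.measurable.prodMk measurable_snd)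
  · filter_upwards [R.eq, R.regular.f_contDiffAt] with ω hω hf t ht
    rw [← hω t ht]
    exact (paramLieBracket_paramLieBracket_eq (U := fun q : State n × Ω => P.f i q.1 q.2)
      (V := fun q : State n × Ω => P.f j q.1 q.2) (W := fun q : State n × Ω => P.f k q.1 q.2)
      ((hf t ht i).differentiableAt (by simp)) (hf t ht j) (hf t ht k)).symm

theorem integrable_bracketTerm (R : P.IsReference u x X K) (hp : P.IsRegularCostate u x p C)
    (i j : Fin (m + 1)) (ht : t ∈ Icc P.t₀ P.T) : Integrable (P.bracketTerm x p i j t) P.μ :=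
  (hp.isDominatedOn_inner (R.isDominatedOn_lieBracket_lieBracket i 0 j)).integrable ht

theorem W_succ_comm (R : P.IsReference u x X K) (hcomm : P.CommutesAlong x)
    (p : ℝ → Ω → State n) (i j : Fin m) (ht : t ∈ Icc P.t₀ P.T) :
    P.W x p i.succ j.succ t = P.W x p j.succ i.succ t := by
  refine integral_congr_ae ?_
  filter_upwards [hcomm, R.regular.f_contDiffAt] with ω hω hf
  rw [bracketTerm, bracketTerm, lieBracket_lieBracket_comm (hf t ht _) (hf t ht _) (hf t ht _)
    (hω t ht i j)]

section Differentiation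

variable {a b : ℝ}

theorem ae_integral_inner_lieBracket_eq_zero (R : P.IsReference u x X K)
    (hp : P.IsRegularCostate u x p C) {G : Ω → State n → State n}
    (hG : ∀ᵐ ω ∂P.μ, ∀ t ∈ Icc P.t₀ P.T, ContDiffAt ℝ 1 (G ω) (x t ω))
    (hGx : IsDominatedOn P.μ P.t₀ P.T fun t ω => G ω (x t ω))
    (hfG : ∀ i, IsDominatedOn P.μ P.t₀ P.T fun t ω =>
      VectorField.lieBracket ℝ (fun y => P.f i y ω) (G ω) (x t ω))
    (ha : P.t₀ ≤ a) (hab : a < b) (hb : b ≤ P.T)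
    (hzero : ∀ᵐ t ∂volume.restrict (Icc a b), ∫ ω, inner ℝ (p t ω) (G ω (x t ω)) ∂P.μ = 0) :
    ∀ᵐ t ∂volume.restrict (Icc a b),
      ∫ ω, inner ℝ (p t ω) (VectorField.lieBracket ℝ (fun y => P.f 0 y ω) (G ω) (x t ω)) ∂P.μ +
        ∑ j, u t j * ∫ ω, inner ℝ (p t ω)
          (VectorField.lieBracket ℝ (fun y => P.f j.succ y ω) (G ω) (x t ω)) ∂P.μ = 0 := by
  have := R.data.prob
  have hsub : Icc a b ⊆ Icc P.t₀ P.T := Icc_subset_Icc ha hb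
  have hbr := fun i => (hp.isDominatedOn_inner (hfG i)).mono hsub
  have hvel : ∀ᵐ ω ∂P.μ, HasVelocityOn (fun t => inner ℝ (p t ω) (G ω (x t ω)))
      (fun t => inner ℝ (p t ω) (VectorField.lieBracket ℝ (fun y => P.f 0 y ω) (G ω) (x t ω)) +
        ∑ j, u t j * inner ℝ (p t ω)
          (VectorField.lieBracket ℝ (fun y => P.f j.succ y ω) (G ω) (x t ω))) a b := by
    filter_upwards [hp.hasVelocityOn, R.regular.differentiableAt_f, hG] with ω hpω hf hGω
    exact (hasVelocityOn_inner_comp R.bound R.control (R.state ω).2 hpω hf hGω).mono ha hab.le hb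
  have hu : ∀ j, ∀ t, ‖u t j‖ ≤ |P.umin j| + |P.umax j| := fun j t =>
    abs_le_of_mem_box (R.control.mem t) j
  have hum : ∀ j, Measurable fun t => u t j := fun j =>
    (measurable_pi_apply j).comp R.control.measurable
  have hint := (hbr 0).integrable_prod.add (integrable_finsetSum Finset.univ fun j _ =>
    (hbr (Fin.succ j)).integrable_prod.bdd_mul
      ((hum j).comp measurable_fst).aestronglyMeasurable
      (Eventually.of_forall fun q : ℝ × Ω => hu j q.1))
  have key := ae_integral_velocity_eq_zero hab hvel
    (fun t ht => (hp.isDominatedOn_inner hGx).integrable (hsub ht)) hint hzero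
  filter_upwards [key, ae_restrict_mem measurableSet_Icc] with t hkey ht
  have hsum := fun j (_ : j ∈ Finset.univ) => ((hbr (Fin.succ j)).integrable ht).const_mul (u t j)
  rw [integral_add ((hbr 0).integrable ht) (integrable_finsetSum _ hsum),
    integral_finsetSum _ hsum] at hkey
  simpa only [integral_const_mul] using hkey

theorem ae_integral_inner_lieBracket_drift_eq_zero (R : P.IsReference u x X K)
    (hcomm : P.CommutesAlong x) (hp : P.IsRegularCostate u x p C) (ha : P.t₀ ≤ a) (hab : a < b)
    (hb : b ≤ P.T) {i : Fin m}
    (hzero : ∀ᵐ t ∂volume.restrict (Icc a b), P.switching x p i t = 0) :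
    ∀ᵐ t ∂volume.restrict (Icc a b), ∫ ω, inner ℝ (p t ω)
      (VectorField.lieBracket ℝ (fun y => P.f 0 y ω) (fun y => P.f i.succ y ω) (x t ω)) ∂P.μ =
        0 := by
  have hdiff := R.ae_integral_inner_lieBracket_eq_zero hp (G := fun ω y => P.f i.succ y ω)
    (R.regular.f_contDiffAt.mono fun ω hf t ht => (hf t ht _).of_le (by norm_num))
    (R.isDominatedOn_f _) (fun j => R.isDominatedOn_lieBracket j _) ha hab hb hzero
  filter_upwards [hdiff, ae_restrict_mem measurableSet_Icc] with t ht₀ ht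
  have hvanish : ∀ j : Fin m, ∫ ω, inner ℝ (p t ω) (VectorField.lieBracket ℝ
      (fun y => P.f j.succ y ω) (fun y => P.f i.succ y ω) (x t ω)) ∂P.μ = 0 := fun j =>
    integral_eq_zero_of_ae <| hcomm.mono fun ω hω => by
      simp only [(hω t (Icc_subset_Icc ha hb ht) j i).eq_of_nhds, Pi.zero_apply, inner_zero_right]
  simpa only [hvanish, mul_zero, Finset.sum_const_zero, add_zero] using ht₀

theorem ae_W_add_sum_eq_zero (R : P.IsReference u x X K) (hcomm : P.CommutesAlong x)
    (hp : P.IsRegularCostate u x p C) (ha : P.t₀ ≤ a) (hab : a < b) (hb : b ≤ P.T) {i : Fin m}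
    (hzero : ∀ᵐ t ∂volume.restrict (Icc a b), P.switching x p i t = 0) :
    ∀ᵐ t ∂volume.restrict (Icc a b),
      P.W x p 0 i.succ t + ∑ j, u t j * P.W x p j.succ i.succ t = 0 :=
  R.ae_integral_inner_lieBracket_eq_zero hp
    (G := fun ω => VectorField.lieBracket ℝ (fun y => P.f 0 y ω) (fun y => P.f i.succ y ω))
    (R.regular.f_contDiffAt.mono fun ω hf t ht =>
      ContDiffAt.lieBracket_vectorField (hf t ht _) (hf t ht _) (by norm_num))
    (R.isDominatedOn_lieBracket _ _) (fun j => R.isDominatedOn_lieBracket_lieBracket j _ _)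
    ha hab hb (R.ae_integral_inner_lieBracket_drift_eq_zero hcomm hp ha hab hb hzero)

end Differentiation

end IsReference

end Brackets

section SingularControl

variable {x p q : ℝ → Ω → State n} {t : ℝ}

theorem switching_congr (h : p t =ᵐ[P.μ] q t) (i : Fin m) :
    P.switching x p i t = P.switching x q i t :=
  integral_congr_ae (h.mono fun ω hω => by simp only [hω])

theorem bracketTerm_congr (h : p t =ᵐ[P.μ] q t) (i j : Fin (m + 1)) :
    P.bracketTerm x p i j t =ᵐ[P.μ] P.bracketTerm x q i j t :=
  h.mono fun ω hω => by simp only [bracketTerm, hω]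

theorem W_congr (h : p t =ᵐ[P.μ] q t) (i j : Fin (m + 1)) : P.W x p i j t = P.W x q i j t :=
  integral_congr_ae (bracketTerm_congr h i j)

theorem singularSet_congr {v : ℝ → Fin m → ℝ} (h : u t = v t) :
    P.singularSet u t = P.singularSet v t := by
  simp only [singularSet, h]

theorem bangMin_congr (h : p t =ᵐ[P.μ] q t) : P.bangMin x p t = P.bangMin x q t := by
  simp only [bangMin, switching_congr h]

theorem bangMax_congr (h : p t =ᵐ[P.μ] q t) : P.bangMax x p t = P.bangMax x q t := by
  simp only [bangMax, switching_congr h]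

theorem WS_congr (h : p t =ᵐ[P.μ] q t) (S : Finset (Fin m)) : P.WS x p S t = P.WS x q S t := by
  simp only [WS, W_congr h]

theorem bS_congr (h : p t =ᵐ[P.μ] q t) (S Bmin Bmax : Finset (Fin m)) :
    P.bS x p S Bmin Bmax t = P.bS x q S Bmin Bmax t := by
  funext i
  simp only [bS, W_congr h]

theorem switching_eq_zero_of_mem_singularSet {i : Fin m}
    (hbang : (0 < P.switching x p i t → u t i = P.umax i) ∧
      (P.switching x p i t < 0 → u t i = P.umin i))
    (hi : i ∈ P.singularSet u t) : P.switching x p i t = 0 := by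
  obtain ⟨-, hlt, hgt⟩ := Finset.mem_filter.1 hi
  exact le_antisymm (not_lt.1 fun h => hgt.ne (hbang.1 h)) (not_lt.1 fun h => hlt.ne' (hbang.2 h))

theorem mulVec_WS_add_bS_eq_zero
    (hbang : ∀ j, (0 < P.switching x p j t → u t j = P.umax j) ∧
      (P.switching x p j t < 0 → u t j = P.umin j))
    (hcover : P.singularSet u t ∪ P.bangMin x p t ∪ P.bangMax x p t = Finset.univ)
    (hW : ∀ i j : Fin m, P.W x p i.succ j.succ t = P.W x p j.succ i.succ t)
    (hzero : ∀ i ∈ P.singularSet u t,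
      P.W x p 0 i.succ t + ∑ j, u t j * P.W x p j.succ i.succ t = 0) :
    Matrix.mulVec (P.WS x p (P.singularSet u t) t) (fun j : P.singularSet u t => u t j) +
      P.bS x p (P.singularSet u t) (P.bangMin x p t) (P.bangMax x p t) t = 0 := by
  have hsing : ∀ j ∈ P.singularSet u t, P.switching x p j t = 0 := fun j hj =>
    switching_eq_zero_of_mem_singularSet (hbang j) hj
  have hmin : ∀ j ∈ P.bangMin x p t, P.switching x p j t < 0 := fun j hj =>
    (Finset.mem_filter.1 hj).2
  have hmax : ∀ j ∈ P.bangMax x p t, 0 < P.switching x p j t := fun j hj =>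
    (Finset.mem_filter.1 hj).2
  have hdisj : Disjoint (P.singularSet u t) (P.bangMin x p t) :=
    Finset.disjoint_left.2 fun j hS hj => (hmin j hj).ne (hsing j hS)
  have hdisj' : Disjoint (P.singularSet u t ∪ P.bangMin x p t) (P.bangMax x p t) := by
    refine Finset.disjoint_left.2 fun j hj hj' => ?_
    rcases Finset.mem_union.1 hj with hS | hj
    exacts [(hmax j hj').ne' (hsing j hS), (hmax j hj').not_gt (hmin j hj)]
  funext i
  have hi := hzero i i.2
  have hsumMin : ∑ j ∈ P.bangMin x p t, u t j * P.W x p j.succ i.1.succ t =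
      ∑ j ∈ P.bangMin x p t, P.umin j * P.W x p j.succ i.1.succ t :=
    Finset.sum_congr rfl fun j hj => by rw [(hbang j).2 (hmin j hj)]
  have hsumMax : ∑ j ∈ P.bangMax x p t, u t j * P.W x p j.succ i.1.succ t =
      ∑ j ∈ P.bangMax x p t, P.umax j * P.W x p j.succ i.1.succ t :=
    Finset.sum_congr rfl fun j hj => by rw [(hbang j).1 (hmax j hj)]
  rw [← hcover, Finset.sum_union hdisj', Finset.sum_union hdisj, hsumMin, hsumMax,
    ← Finset.sum_coe_sort (P.singularSet u t) fun j => u t j * P.W x p j.succ i.1.succ t] at hi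
  simp only [Pi.add_apply, Pi.zero_apply, Matrix.mulVec, dotProduct, WS, Matrix.of_apply, bS,
    hW i.1, mul_comm (P.W x p _ _ t)]
  linarith

variable {X : ℝ → Ω → State n} {K C a b : ℝ}

theorem IsReference.ae_mulVec_WS_add_bS_eq_zero (R : P.IsReference u x X K)
    (hcomm : P.CommutesAlong x) (hp : P.IsRegularCostate u x p C)
    (hmin : P.IsVariationallyMinimal u x) (ha : P.t₀ ≤ a) (hab : a < b) (hb : b ≤ P.T)
    {S Bmin Bmax : Finset (Fin m)}
    (hconst : ∀ᵐ t ∂volume.restrict (Icc a b),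
      P.singularSet u t = S ∧ P.bangMin x p t = Bmin ∧ P.bangMax x p t = Bmax)
    (hcover : S ∪ Bmin ∪ Bmax = Finset.univ) :
    ∀ᵐ t ∂volume.restrict (Icc a b),
      Matrix.mulVec (P.WS x p S t) (fun j : S => u t j) + P.bS x p S Bmin Bmax t = 0 := by
  have hsub : Icc a b ⊆ Icc P.t₀ P.T := Icc_subset_Icc ha hb
  have hbang := ae_restrict_of_ae_restrict_of_subset hsub (R.ae_eq_umax_and_eq_umin hp hmin)
  have hzero : ∀ᵐ t ∂volume.restrict (Icc a b), ∀ i : Fin m, i ∈ S →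
      P.W x p 0 i.succ t + ∑ j, u t j * P.W x p j.succ i.succ t = 0 := by
    simp only [ae_all_iff]
    refine fun i hi => R.ae_W_add_sum_eq_zero hcomm hp ha hab hb ?_
    filter_upwards [hconst, hbang] with t hS hbang
    exact switching_eq_zero_of_mem_singularSet (hbang i) (hS.1 ▸ hi)
  filter_upwards [hconst, hbang, hzero, ae_restrict_mem measurableSet_Icc]
    with t hS hbang hzero ht
  obtain ⟨rfl, rfl, rfl⟩ := hS
  exact mulVec_WS_add_bS_eq_zero hbang hcover (fun i j => R.W_succ_comm hcomm p i j (hsub ht))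
    hzero

theorem IsReference.ae_mulVec_WS_add_bS_eq_zero_of_ae_eq (R : P.IsReference u x X K)
    (hcomm : P.CommutesAlong x) (hp : P.IsRegularCostate u x p C)
    (hmin : P.IsVariationallyMinimal u x) {v : ℝ → Fin m → ℝ}
    (huv : u =ᵐ[volume.restrict (Icc P.t₀ P.T)] v)
    (hqp : ∀ t ∈ Icc P.t₀ P.T, q t =ᵐ[P.μ] p t) (ha : P.t₀ ≤ a) (hab : a < b) (hb : b ≤ P.T)
    {S Bmin Bmax : Finset (Fin m)}
    (hconst : ∀ᵐ t ∂volume.restrict (Icc a b),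
      P.singularSet v t = S ∧ P.bangMin x q t = Bmin ∧ P.bangMax x q t = Bmax)
    (hcover : S ∪ Bmin ∪ Bmax = Finset.univ) :
    ∀ᵐ t ∂volume.restrict (Icc a b),
      Matrix.mulVec (P.WS x q S t) (fun j : S => v t j) + P.bS x q S Bmin Bmax t = 0 := by
  have hsub : Icc a b ⊆ Icc P.t₀ P.T := Icc_subset_Icc ha hb
  have huv := ae_restrict_of_ae_restrict_of_subset hsub huv
  have hqp : ∀ᵐ t ∂volume.restrict (Icc a b), q t =ᵐ[P.μ] p t :=
    ae_restrict_of_forall_mem measurableSet_Icc fun t ht => hqp t (hsub ht)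
  have hconst' : ∀ᵐ t ∂volume.restrict (Icc a b),
      P.singularSet u t = S ∧ P.bangMin x p t = Bmin ∧ P.bangMax x p t = Bmax := by
    filter_upwards [hconst, huv, hqp] with t hS hu hq
    rwa [singularSet_congr hu, ← bangMin_congr hq, ← bangMax_congr hq]
  filter_upwards [R.ae_mulVec_WS_add_bS_eq_zero hcomm hp hmin ha hab hb hconst' hcover, huv, hqp]
    with t hlin hu hq
  rwa [WS_congr hq, bS_congr hq, ← hu]

end SingularControl

end Problem

end EnsembleControl

theorem mainTheorem3_general {n m : ℕ} {Ω : Type*} [TopologicalSpace Ω]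
    [HereditarilyLindelofSpace Ω] [MeasurableSpace Ω]
    (P : EnsembleControl.Problem n m Ω) (hφ : MemLp P.φ 2 P.μ) (h0 : P.H0)
    (u : ℝ → Fin m → ℝ) (x : ℝ → Ω → EnsembleControl.State n)
    (hmin : ((∃ R : ℝ, ∀ ω ∈ P.μ.support, ‖P.φ ω‖ ≤ R) ∧ P.IsLocalMinimizer u x) ∨
      P.IsMeanLocalMinimizer u x)
    (hreg : P.IsRegularAlong x) (hcomm : P.CommutesAlong x)
    (p : ℝ → Ω → EnsembleControl.State n)
    (hp : P.IsCostate u x p ∨ P.IsMeanCostate u x p)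
    (a b : ℝ) (ha : P.t₀ ≤ a) (hab : a < b) (hb : b ≤ P.T)
    (S Bmin Bmax : Finset (Fin m))
    (hconst : ∀ᵐ t ∂(volume.restrict (Ioo a b)),
      P.singularSet u t = S ∧ P.bangMin x p t = Bmin ∧ P.bangMax x p t = Bmax)
    (hcover : S ∪ Bmin ∪ Bmax = Finset.univ) :
    ∀ᵐ t ∂(volume.restrict (Ioo a b)),
      (∀ i j : Fin (m + 1), Integrable (P.bracketTerm x p i j t) P.μ) ∧
      Matrix.mulVec (P.WS x p S t) (fun j : S => u t j) + P.bS x p S Bmin Bmax t = 0 := by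
  have ht : P.t₀ < P.T := ha.trans_lt (hab.trans_le hb)
  have hadm : P.IsAdmissible u x := hmin.elim (fun h => h.2.1) fun h => h.1
  obtain ⟨v, hv, hvu⟩ := hadm.1.exists_isBoxControl ht
  have hx : P.IsState v x := hadm.isState hvu hv h0 ht.le
  obtain ⟨X, K, R⟩ := hx.exists_isReference hv h0 ht hφ hreg
  obtain ⟨q, C, hq⟩ := R.exists_isRegularCostate
  have hpq := R.ae_eq_isRegularCostate hvu hq hp
  have hvar : P.IsVariationallyMinimal v x := by
    rcases hmin with ⟨⟨r, hr⟩, hmin⟩ | hmin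
    exacts [hmin.isVariationallyMinimal hx hv h0 ht.le hr,
      hmin.isVariationallyMinimal hx hv h0 ht.le hφ]
  rw [restrict_Ioo_eq_restrict_Icc] at hconst ⊢
  filter_upwards [R.ae_mulVec_WS_add_bS_eq_zero_of_ae_eq hcomm hq hvar hvu hpq ha hab hb hconst
    hcover, ae_restrict_mem measurableSet_Icc] with t hlin htab
  have htT : t ∈ Icc P.t₀ P.T := Icc_subset_Icc ha hb htab
  exact ⟨fun i j => (R.integrable_bracketTerm hq i j htT).congr
    (EnsembleControl.Problem.bracketTerm_congr (hpq t htT) i j).symm, hlin⟩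

theorem mainTheorem3 {n m : ℕ} {Ω : Type*} [MetricSpace Ω] [CompleteSpace Ω]
    [TopologicalSpace.SeparableSpace Ω] [MeasurableSpace Ω] [BorelSpace Ω]
    (P : EnsembleControl.Problem n m Ω) (ht : P.t₀ < P.T)
    (hbox : ∀ i, P.umin i < P.umax i)
    (hφ : MemLp P.φ 2 P.μ) (h0 : P.H0)
    (u : ℝ → Fin m → ℝ) (x : ℝ → Ω → EnsembleControl.State n)
    -- local minimality: pathwise when the initial datum is bounded on the support of the
    -- measure (for instance, known), and in the sense of `L²`-valued states in general
    (hmin : ((∃ R : ℝ, ∀ ω ∈ P.μ.support, ‖P.φ ω‖ ≤ R) ∧ P.IsLocalMinimizer u x) ∨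
      P.IsMeanLocalMinimizer u x)
    (δ : ℝ) (hδ : 0 < δ) (h1 : P.H1 x δ) (hcomm : P.Commuting x δ)
    (p : ℝ → Ω → EnsembleControl.State n)
    (hp : P.IsCostate u x p ∨ P.IsMeanCostate u x p)
    (a b : ℝ) (ha : P.t₀ ≤ a) (hab : a < b) (hb : b ≤ P.T)
    (S Bmin Bmax : Finset (Fin m))
    (hconst : ∀ᵐ t ∂(volume.restrict (Ioo a b)),
      P.singularSet u t = S ∧ P.bangMin x p t = Bmin ∧ P.bangMax x p t = Bmax)
    -- every index is singular or bang
    (hcover : S ∪ Bmin ∪ Bmax = Finset.univ) :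
    ∀ᵐ t ∂(volume.restrict (Ioo a b)),
      (∀ i j : Fin (m + 1), Integrable (P.bracketTerm x p i j t) P.μ) ∧
      Matrix.mulVec (P.WS x p S t) (fun j : S => u t j) + P.bS x p S Bmin Bmax t = 0 := by
  have := UniformSpace.secondCountable_of_separable Ω
  have hadm : P.IsAdmissible u x := hmin.elim (fun h => h.2.1) fun h => h.1
  exact mainTheorem3_general P hφ h0 u x hmin (h1.isRegularAlong hδ ht fun ω => (hadm.2 ω).1)
    (hcomm.commutesAlong hδ) p hp a b ha hab hb S Bmin Bmax hconst hcover
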